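/- Let $d\ge 2$, let $\Omega\subset\mathbb{R}^d$ be a bounded open set with Lipschitz boundary, and let $p>d-1$ be real. For $\mathcal{H}^{d-1}$-a.e. $x\in\partial\Omega$ let $T_x\partial\Omega$ be the tangent space, $N_x\partial\Omega=(T_x\partial\Omega)^\perp$ the normal space and $n(x)$ the outward unit normal. Let $\mathcal{D}_U$ be the set of the $(x,y,F,n)$ with $x\in\partial\Omega$, $y\in\mathbb{R}^d$, $F\in\mathcal{L}(T_x\partial\Omega;\mathbb{R}^d)$ and $n\in N_x\partial\Omega\cap S^{d-1}$, and let $U:\mathcal{D}_U\to\mathbb{R}$ satisfy the following conditions. 1. $U$ is measurable with respect to the product of the $\sigma$-algebra of $\mathcal{H}^{d-1}$-measurable sets in $x$ and the Borel $\sigma$-algebras in $y$, $F$, $n$ (linear maps on $T_x\partial\Omega$ being described by matrices through a measurable basis of the tangent spaces or, equivalently, as restrictions of linear maps on $\mathbb{R}^d$). 2. For $\mathcal{H}^{d-1}$-a.e. $x\in\partial\Omega$ the function $U(x,\cdot,\cdot,\cdot)$ is lower semicontinuous. 3. The functions $U(\cdot,y,\cdot,n)$ are tangentially polyconvex, with an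 exceptional set independent of $(y,n)$: there are measurable maps $v_1,\dots,v_{d-1}:\partial\Omega\to\mathbb{R}^d$ such that $v_1(x),\dots,v_{d-1}(x)$ is a basis of $T_x\partial\Omega$ for $\mathcal{H}^{d-1}$-a.e. $x$, and such that for $\mathcal{H}^{d-1}$-a.e. $x\in\partial\Omega$, for all $y\in\mathbb{R}^d$ and all $n\in N_x\partial\Omega\cap S^{d-1}$, there is a convex function $\Phi_{x,y,n}:\mathbb{R}^{\nu_{d-1}}\to\mathbb{R}$ with $U(x,y,F,n)=\Phi_{x,y,n}(M(F))$ for every $F\in\mathcal{L}(T_x\partial\Omega;\mathbb{R}^d)$. Here $M(F)\in\mathbb{R}^{\nu_{d-1}}$ is the list of all minors, of all orders $1,\dots,d-1$, of the matrix of $F$ with respect to $v_1(x),\dots,v_{d-1}(x)$ and the canonical basis of $\mathbb{R}^d$. 4. There are a constant $c>0$ and a function $a\in L^1(\partial\Omega)$ such that $U(x,y,F,n)\ge a(x)+c|F|^p$ for $\mathcal{H}^{d-1}$-a.e. $x\in\partial\Omega$, all $y\in\mathbb{R}^d$, all $F\in\mathcal{L}(T_x\partial\Omega;\mathbb{R}^d)$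 and all $n\in N_x\partial\Omega\cap S^{d-1}$. Let $u_j,u\in W^{1,p}(\partial\Omega;\mathbb{R}^d)$ be such that $u_j\rightharpoonup u$ weakly in $W^{1,p}(\partial\Omega;\mathbb{R}^d)$ as $j\to\infty$, and let $D^\tau u$ denote the (weak) tangential derivative. Then $$\int_{\partial\Omega}U(x,u(x),D^\tau u(x),n(x))\,d\mathcal{H}^{d-1}(x)\le\liminf_{j\to\infty}\int_{\partial\Omega}U(x,u_j(x),D^\tau u_j(x),n(x))\,d\mathcal{H}^{d-1}(x),$$ where the integrals take values in $(-\infty,+\infty]$. -/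

import Mathlib

open MeasureTheory Filter Topology Set
open scoped ENNReal NNReal ContDiff

namespace BoundarySobolev

noncomputable section

/-- The Euclidean space `ℝ^d`. -/
abbrev E (d : ℕ) : Type := EuclideanSpace ℝ (Fin d)

/-! ### Lipschitz boundaries -/

/-- A graph chart of the boundary of `Ω ⊆ ℝ^d`. In the orthonormal coordinates
`(z, t) ↦ R z + t e` of `ℝ^d`, over the ball `B(z₀, r) ⊆ ℝ^(d-1)` and up to the height `β` above
and below the graph, `Ω` is the set of points strictly below the graph of the Lipschitz
function `f`. -/
structure GraphChart {d : ℕ} (Ω : Set (E d)) where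
  R : E (d - 1) →ₗᵢ[ℝ] E d
  e : E d
  norm_e : ‖e‖ = 1
  orthogonal : ∀ z, inner ℝ (R z) e = 0
  f : E (d - 1) → ℝ
  K : ℝ≥0
  lipschitz : LipschitzWith K f
  z₀ : E (d - 1)
  r : ℝ
  r_pos : 0 < r
  β : ℝ
  β_pos : 0 < β
  mem_iff : ∀ z ∈ Metric.ball z₀ r, ∀ t : ℝ, |t - f z| < β → (R z + t • e ∈ Ω ↔ t < f z)

namespace GraphChart

variable {d : ℕ} {Ω : Set (E d)} (c : GraphChart Ω)

/-- The parameter domain of the chart. -/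
def dom : Set (E (d - 1)) := Metric.ball c.z₀ c.r

/-- The bi-Lipschitz parametrization `z ↦ R z + f(z) e` of a piece of the boundary. -/
def param (z : E (d - 1)) : E d := c.R z + c.f z • c.e

end GraphChart

/-- `Ω` has a Lipschitz boundary: every boundary point lies in a boundary piece that is the graph
of a Lipschitz function, with `Ω` on one side of it. -/
def HasLipschitzBoundary {d : ℕ} (Ω : Set (E d)) : Prop :=
  ∀ x ∈ frontier Ω, ∃ c : GraphChart Ω, x ∈ c.param '' c.dom

/-- The surface measure of `∂Ω`: the Hausdorff measure of dimension `d - 1` (normalized so that it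
is the Lebesgue measure on `ℝ^(d-1)`), restricted to `∂Ω`. -/
def surface {d : ℕ} (Ω : Set (E d)) : Measure (E d) := (μHE[d - 1]).restrict (frontier Ω)

/-! ### Tangent spaces and normals -/

/-- The tangent space of `∂Ω` at `x`: the span of the tangent cone. -/
def tangentSpace {d : ℕ} (Ω : Set (E d)) (x : E d) : Submodule ℝ (E d) :=
  Submodule.span ℝ (tangentConeAt ℝ (frontier Ω) x)

/-- The boundary points at which `∂Ω` has a tangent hyperplane. -/
def regularBoundary {d : ℕ} (Ω : Set (E d)) : Set (E d) :=
  {x | x ∈ frontier Ω ∧ Module.finrank ℝ (tangentSpace Ω x) + 1 = d}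

/-- The unit vectors of the normal space of `∂Ω` at `x`. -/
def unitNormals {d : ℕ} (Ω : Set (E d)) (x : E d) : Set (E d) :=
  {n | n ∈ (tangentSpace Ω x)ᗮ ∧ ‖n‖ = 1}

/-- `n` is a unit normal of `∂Ω` at `x` that points out of `Ω`. -/
def IsOutwardNormal {d : ℕ} (Ω : Set (E d)) (x n : E d) : Prop :=
  n ∈ unitNormals Ω x ∧ ∀ᶠ t : ℝ in 𝓝[>] 0, x - t • n ∈ Ω ∧ x + t • n ∉ closure Ω

open Classical in
/-- The outward unit normal of `Ω` (it exists, and is unique, at almost every point of a Lipschitz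
boundary; where there is none the value is `0`). -/
def outwardNormal {d : ℕ} (Ω : Set (E d)) (x : E d) : E d :=
  if h : ∃ n, IsOutwardNormal Ω x n then h.choose else 0

/-! ### The Sobolev space on the boundary -/

/-- `D` is the tangential derivative of `u`, in the weak sense. For almost every `x`, the map
`D x : ℝ^d → ℝ^d` vanishes on the normal space at `x` (so that it is determined by its restriction
to the tangent space), and in every chart `Ψ` the function `u ∘ Ψ` has the weak derivative
`z ↦ D (Ψ z) ∘ DΨ(z)`. -/
def IsTangentialDerivative {d : ℕ} (Ω : Set (E d)) (u : E d → E d) (D : E d → E d →L[ℝ] E d) :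
    Prop :=
  (∀ᵐ x ∂surface Ω, ∀ w ∈ (tangentSpace Ω x)ᗮ, D x w = 0) ∧
  ∀ c : GraphChart Ω, ∀ φ : E (d - 1) → ℝ, ContDiff ℝ ∞ φ → HasCompactSupport φ →
    tsupport φ ⊆ c.dom → ∀ w : E (d - 1),
      ∫ z in c.dom, fderiv ℝ φ z w • u (c.param z) =
        - ∫ z in c.dom, φ z • D (c.param z) (fderiv ℝ c.param z w)

section Helpers

variable {d : ℕ} {Ω : Set (E d)} (c : GraphChart Ω)

lemma GraphChart.isOpen_dom : IsOpen c.dom := Metric.isOpen_ball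

lemma GraphChart.continuous_param : Continuous c.param :=
  c.R.continuous.add (c.lipschitz.continuous.smul continuous_const)

lemma GraphChart.lipschitz_param : ∃ K : ℝ≥0, LipschitzWith K c.param := by
  have h : LipschitzWith c.K (fun z => c.f z • c.e) := by
    refine LipschitzWith.of_dist_le_mul fun x y => ?_
    rw [dist_eq_norm, ← sub_smul, norm_smul, c.norm_e, mul_one]
    simpa [dist_eq_norm] using c.lipschitz.dist_le_mul x y
  exact ⟨_, c.R.lipschitz.add h⟩

lemma GraphChart.antilipschitz_param : AntilipschitzWith 1 c.param := by
  refine AntilipschitzWith.of_le_mul_dist fun x y => ?_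
  have h1 : c.param x - c.param y = c.R (x - y) + (c.f x - c.f y) • c.e := by
    simp only [GraphChart.param, map_sub, sub_smul]; abel
  have h2 : inner ℝ (c.R (x - y)) ((c.f x - c.f y) • c.e) = 0 := by
    rw [inner_smul_right, c.orthogonal, mul_zero]
  have h3 := norm_add_sq_eq_norm_sq_add_norm_sq_of_inner_eq_zero _ _ h2
  rw [dist_eq_norm, dist_eq_norm, h1, NNReal.coe_one, one_mul]
  rw [c.R.norm_map] at h3
  refine abs_le_of_sq_le_sq' ?_ (norm_nonneg _) |>.2
  nlinarith [mul_self_nonneg ‖(c.f x - c.f y) • c.e‖]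

lemma GraphChart.param_mem_frontier (hΩ : IsOpen Ω) {z : E (d - 1)} (hz : z ∈ c.dom) :
    c.param z ∈ frontier Ω := by
  rw [frontier, hΩ.interior_eq]
  refine ⟨?_, fun h => ?_⟩
  · have hlim : Tendsto (fun t : ℝ => c.R z + t • c.e) (𝓝[<] (c.f z)) (𝓝 (c.param z)) :=
      ((continuous_const.add (continuous_id.smul continuous_const)).tendsto _).mono_left
        nhdsWithin_le_nhds
    refine mem_closure_of_tendsto hlim ?_
    have hb : ∀ᶠ t in 𝓝[<] (c.f z), c.f z - c.β < t :=
      nhdsWithin_le_nhds (lt_mem_nhds (by linarith [c.β_pos]))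
    filter_upwards [hb, self_mem_nhdsWithin] with t ht1 ht2
    have ht2' : t < c.f z := ht2
    refine (c.mem_iff z hz t ?_).2 ht2'
    rw [abs_lt]
    constructor <;> linarith [c.β_pos]
  · have := (c.mem_iff z hz (c.f z) (by simpa using c.β_pos)).1 h
    exact lt_irrefl _ this

lemma GraphChart.map_param_le (hΩ : IsOpen Ω) :
    (volume.restrict c.dom).map c.param ≤ surface Ω := by
  refine Measure.le_iff.2 fun s hs => ?_
  have hm : Measurable c.param := c.continuous_param.measurable
  rw [Measure.map_apply hm hs, Measure.restrict_apply (hm hs), surface, Measure.restrict_apply hs,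
    ← EuclideanSpace.euclideanHausdorffMeasure_eq_volume, Measure.euclideanHausdorffMeasure_def,
    Measure.euclideanHausdorffMeasure_def, Measure.smul_apply, Measure.smul_apply]
  gcongr
  calc _ ≤ Measure.hausdorffMeasure ((d - 1 : ℕ) : ℝ) (c.param ⁻¹' (s ∩ frontier Ω)) :=
        measure_mono fun z hz => ⟨hz.1, c.param_mem_frontier hΩ hz.2⟩
    _ ≤ _ := by
        simpa using c.antilipschitz_param.hausdorffMeasure_preimage_le
          (Nat.cast_nonneg (d - 1)) (s ∩ frontier Ω)

lemma GraphChart.ae_comp (hΩ : IsOpen Ω) {P : E d → Prop} (h : ∀ᵐ x ∂surface Ω, P x) :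
    ∀ᵐ z ∂volume.restrict c.dom, P (c.param z) :=
  ae_of_ae_map c.continuous_param.measurable.aemeasurable
    ((Measure.absolutelyContinuous_of_le (c.map_param_le hΩ)).ae_le h)

lemma GraphChart.integrable_comp (hΩ : IsOpen Ω) {F : Type*} [NormedAddCommGroup F]
    {p : ℝ≥0∞} [hp : Fact (1 ≤ p)] (g : Lp F p (surface Ω)) :
    Integrable (fun z => g (c.param z)) (volume.restrict c.dom) := by
  have : IsFiniteMeasure (volume.restrict c.dom) := by
    constructor
    rw [Measure.restrict_apply_univ]
    exact measure_ball_lt_top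
  have h1 : MemLp g p ((volume.restrict c.dom).map c.param) :=
    (Lp.memLp g).mono_measure (c.map_param_le hΩ)
  exact (h1.comp_of_map c.continuous_param.measurable.aemeasurable).integrable hp.out

lemma GraphChart.integrable_left (hΩ : IsOpen Ω) {p : ℝ≥0∞} [Fact (1 ≤ p)]
    (u : Lp (E d) p (surface Ω)) {φ : E (d - 1) → ℝ} (hφ : ContDiff ℝ ∞ φ)
    (hc : HasCompactSupport φ) (w : E (d - 1)) :
    Integrable (fun z => fderiv ℝ φ z w • u (c.param z)) (volume.restrict c.dom) := by
  have hcont : Continuous (fun z => fderiv ℝ φ z w) :=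
    (hφ.continuous_fderiv (by simp)).clm_apply continuous_const
  have hcs : HasCompactSupport (fun z => fderiv ℝ φ z w) := hc.fderiv_apply ℝ w
  obtain ⟨C, hC⟩ := hcs.exists_bound_of_continuous hcont
  exact (c.integrable_comp hΩ u).bdd_smul C hcont.aestronglyMeasurable (ae_of_all _ hC)

lemma GraphChart.integrable_right (hΩ : IsOpen Ω) {p : ℝ≥0∞} [Fact (1 ≤ p)]
    (D : Lp (E d →L[ℝ] E d) p (surface Ω)) {φ : E (d - 1) → ℝ} (hφ : ContDiff ℝ ∞ φ)
    (hc : HasCompactSupport φ) (w : E (d - 1)) :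
    Integrable (fun z => φ z • D (c.param z) (fderiv ℝ c.param z w))
      (volume.restrict c.dom) := by
  obtain ⟨C, hC⟩ := hc.exists_bound_of_continuous hφ.continuous
  obtain ⟨K, hK⟩ := c.lipschitz_param
  have hD := c.integrable_comp hΩ D
  have hmeas : Measurable (fun z => fderiv ℝ c.param z w) := measurable_fderiv_apply_const ℝ _ w
  have h1 : Integrable (fun z => D (c.param z) (fderiv ℝ c.param z w))
      (volume.restrict c.dom) := by
    refine (hD.norm.mul_const (K * ‖w‖)).mono' ?_ (ae_of_all _ fun z => ?_)
    · exact (ContinuousLinearMap.apply ℝ (E d)).flip.aestronglyMeasurable_comp₂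
        hD.aestronglyMeasurable hmeas.aestronglyMeasurable
    · refine ((D (c.param z)).le_opNorm _).trans ?_
      gcongr
      exact ((fderiv ℝ c.param z).le_opNorm w).trans
        (by gcongr; exact norm_fderiv_le_of_lipschitz ℝ hK)
  exact h1.bdd_smul C hφ.continuous.aestronglyMeasurable (ae_of_all _ hC)

end Helpers

/-- The Sobolev space `W^{1,p}(∂Ω; ℝ^d)` of an open set `Ω`, realized as the space of the pairs
`(u, D)` in `L^p × L^p` for which `D` is the weak tangential derivative of `u`. The norm is the one
of the product, that is, `max ‖u‖_p ‖D‖_p`. -/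
def sobolev {d : ℕ} (Ω : Set (E d)) (hΩ : IsOpen Ω) (p : ℝ≥0∞) [Fact (1 ≤ p)] :
    Submodule ℝ (Lp (E d) p (surface Ω) × Lp (E d →L[ℝ] E d) p (surface Ω)) where
  carrier := {v | IsTangentialDerivative Ω v.1 v.2}
  zero_mem' := by
    have hu := Lp.coeFn_zero (E d) p (surface Ω)
    have hD := Lp.coeFn_zero (E d →L[ℝ] E d) p (surface Ω)
    refine ⟨?_, fun c φ _ _ _ w => ?_⟩
    · filter_upwards [hD] with x hx w _
      rw [Prod.snd_zero, hx]
      rfl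
    · have h1 := integral_congr_ae (μ := volume.restrict c.dom)
        (f := fun z => fderiv ℝ φ z w • (0 : Lp (E d) p (surface Ω)) (c.param z))
        (g := fun _ => 0)
        (by filter_upwards [c.ae_comp hΩ hu] with z hz; rw [hz]; exact smul_zero _)
      have h2 := integral_congr_ae (μ := volume.restrict c.dom)
        (f := fun z => φ z • (0 : Lp (E d →L[ℝ] E d) p (surface Ω)) (c.param z)
          (fderiv ℝ c.param z w))
        (g := fun _ => 0)
        (by filter_upwards [c.ae_comp hΩ hD] with z hz; rw [hz]; exact smul_zero _)
      simp only [Prod.fst_zero, Prod.snd_zero]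
      rw [h1, h2]
      simp
  add_mem' := by
    intro a b ha hb
    have hu := Lp.coeFn_add a.1 b.1
    have hD := Lp.coeFn_add a.2 b.2
    refine ⟨?_, fun c φ h1 h2 h3 w => ?_⟩
    · filter_upwards [hD, ha.1, hb.1] with x hx hax hbx w hw
      rw [Prod.snd_add, hx, Pi.add_apply, _root_.add_apply, hax w hw, hbx w hw,
        add_zero]
    · have e1 : ∫ z in c.dom, fderiv ℝ φ z w • (a + b).1 (c.param z) =
          ∫ z in c.dom, (fderiv ℝ φ z w • a.1 (c.param z) + fderiv ℝ φ z w • b.1 (c.param z)) :=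
        integral_congr_ae (by
          filter_upwards [c.ae_comp hΩ hu] with z hz
          rw [Prod.fst_add, hz, Pi.add_apply, smul_add])
      have e2 : ∫ z in c.dom, φ z • (a + b).2 (c.param z) (fderiv ℝ c.param z w) =
          ∫ z in c.dom, (φ z • a.2 (c.param z) (fderiv ℝ c.param z w) +
            φ z • b.2 (c.param z) (fderiv ℝ c.param z w)) :=
        integral_congr_ae (by
          filter_upwards [c.ae_comp hΩ hD] with z hz
          rw [Prod.snd_add, hz, Pi.add_apply, _root_.add_apply, smul_add])
      rw [e1, e2, integral_add (c.integrable_left hΩ a.1 h1 h2 w) (c.integrable_left hΩ b.1 h1 h2 w),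
        integral_add (c.integrable_right hΩ a.2 h1 h2 w) (c.integrable_right hΩ b.2 h1 h2 w),
        ha.2 c φ h1 h2 h3 w, hb.2 c φ h1 h2 h3 w, neg_add]
  smul_mem' := by
    intro k a ha
    have hu := Lp.coeFn_smul k a.1
    have hD := Lp.coeFn_smul k a.2
    refine ⟨?_, fun c φ h1 h2 h3 w => ?_⟩
    · filter_upwards [hD, ha.1] with x hx hax w hw
      rw [Prod.smul_snd, hx, Pi.smul_apply, _root_.smul_apply, hax w hw, smul_zero]
    · have e1 : ∫ z in c.dom, fderiv ℝ φ z w • (k • a).1 (c.param z) =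
          ∫ z in c.dom, k • (fderiv ℝ φ z w • a.1 (c.param z)) :=
        integral_congr_ae (by
          filter_upwards [c.ae_comp hΩ hu] with z hz
          rw [Prod.smul_fst, hz, Pi.smul_apply, smul_comm])
      have e2 : ∫ z in c.dom, φ z • (k • a).2 (c.param z) (fderiv ℝ c.param z w) =
          ∫ z in c.dom, k • (φ z • a.2 (c.param z) (fderiv ℝ c.param z w)) :=
        integral_congr_ae (by
          filter_upwards [c.ae_comp hΩ hD] with z hz
          rw [Prod.smul_snd, hz, Pi.smul_apply, _root_.smul_apply, smul_comm])
      rw [e1, e2, integral_smul, integral_smul, ha.2 c φ h1 h2 h3 w, smul_neg]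

/-- Weak convergence in the normed space `W^{1,p}(∂Ω; ℝ^d)`. -/
def WeaklyConverges {d : ℕ} {Ω : Set (E d)} {hΩ : IsOpen Ω} {p : ℝ≥0∞} [Fact (1 ≤ p)]
    (u : ℕ → sobolev Ω hΩ p) (v : sobolev Ω hΩ p) : Prop :=
  ∀ ℓ : sobolev Ω hΩ p →L[ℝ] ℝ, Tendsto (fun j => ℓ (u j)) atTop (𝓝 (ℓ v))

/-- The tangential derivative at `x`, as a linear map on the tangent space at `x`. -/
def tangentialDerivative {d : ℕ} {Ω : Set (E d)} {hΩ : IsOpen Ω} {p : ℝ≥0∞} [Fact (1 ≤ p)]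
    (u : sobolev Ω hΩ p) (x : E d) : tangentSpace Ω x →L[ℝ] E d :=
  (u.1.2 x).comp (tangentSpace Ω x).subtypeL

/-! ### Minors and tangential polyconvexity -/

/-- The indices of the minors, of all orders `k + 1 ∈ {1, …, m}`, of a `d × m` matrix: the choices of
`k + 1` rows and of `k + 1` columns, in increasing order. -/
abbrev MinorIndex (d m : ℕ) : Type :=
  Σ k : Fin m, (Fin (k + 1) ↪o Fin d) × (Fin (k + 1) ↪o Fin m)

/-- All the minors of a `d × m` matrix. -/
def minors {d m : ℕ} (A : Matrix (Fin d) (Fin m) ℝ) : MinorIndex d m → ℝ :=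
  fun q => (A.submatrix q.2.1 q.2.2).det

/-- The matrix of `F : V → ℝ^d` with respect to `v` and the canonical basis. -/
def coordMatrix {d m : ℕ} {V : Submodule ℝ (E d)} (v : Fin m → V) (F : V →L[ℝ] E d) :
    Matrix (Fin d) (Fin m) ℝ :=
  Matrix.of fun i j => F (v j) i

/-- `w` is a convex function of the minors of the matrix of `F` with respect to `v`. -/
def IsPolyconvex {d m : ℕ} {V : Submodule ℝ (E d)} (v : Fin m → V) (w : (V →L[ℝ] E d) → ℝ) :
    Prop :=
  ∃ Φ : (MinorIndex d m → ℝ) → ℝ, ConvexOn ℝ univ Φ ∧ ∀ F, w F = Φ (minors (coordMatrix v F))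

/-- A measurable basis of the tangent bundle of `∂Ω`. -/
def IsMeasurableBasis {d : ℕ} (Ω : Set (E d)) (v : (x : E d) → Fin (d - 1) → tangentSpace Ω x) :
    Prop :=
  (∀ j, AEMeasurable (fun x => (v x j : E d)) (surface Ω)) ∧
  ∀ᵐ x ∂surface Ω, LinearIndependent ℝ (v x) ∧ Submodule.span ℝ (range (v x)) = ⊤

/-- A boundary energy density `U(x, y, F, n)`, with `F : T_x ∂Ω → ℝ^d` linear. Only the values at
`x ∈ ∂Ω` and at unit normals `n` of `∂Ω` at `x` matter. -/
abbrev Density {d : ℕ} (Ω : Set (E d)) : Type :=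
  (x : E d) → E d → (tangentSpace Ω x →L[ℝ] E d) → E d → ℝ

/-- The functions `U(·, y, ·, n)` are tangentially polyconvex, for all `y` and all unit normals `n`,
with an exceptional null set of points `x` that does not depend on `(y, n)`. -/
def TangentiallyPolyconvex {d : ℕ} {Ω : Set (E d)} (U : Density Ω) : Prop :=
  ∃ v : (x : E d) → Fin (d - 1) → tangentSpace Ω x, IsMeasurableBasis Ω v ∧
    ∀ᵐ x ∂surface Ω, ∀ y, ∀ n ∈ unitNormals Ω x, IsPolyconvex (v x) (fun F => U x y F n)

/-- `U` is measurable for the product of the σ-algebra of the `H^(d-1)`-measurable sets in `x` and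
the Borel σ-algebras in the other variables. A linear map on the tangent space is given through its
linear extensions `A` to `ℝ^d`. -/
def IsMeasurableDensity {d : ℕ} {Ω : Set (E d)} (U : Density Ω) : Prop :=
  Measurable fun q : {q : NullMeasurableSpace (E d) (surface Ω) × E d × (E d →L[ℝ] E d) × E d //
      q.1 ∈ regularBoundary Ω ∧ q.2.2.2 ∈ unitNormals Ω q.1} =>
    U q.1.1 q.1.2.1 (q.1.2.2.1.comp (tangentSpace Ω q.1.1).subtypeL) q.1.2.2.2

/-- For almost every `x`, the function `(y, F, n) ↦ U(x, y, F, n)` is lower semicontinuous. -/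
def IsLscDensity {d : ℕ} {Ω : Set (E d)} (U : Density Ω) : Prop :=
  ∀ᵐ x ∂surface Ω, LowerSemicontinuousOn
    (fun q : E d × (tangentSpace Ω x →L[ℝ] E d) × E d => U x q.1 q.2.1 q.2.2)
    {q | q.2.2 ∈ unitNormals Ω x}

/-- The integral of a real function with values in `[-∞, ∞]`: the integral of the positive part
minus the integral of the negative part. -/
def extendedIntegral {α : Type*} [MeasurableSpace α] (μ : Measure α) (g : α → ℝ) : EReal :=
  ((∫⁻ x, ENNReal.ofReal (g x) ∂μ : ℝ≥0∞) : EReal) -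
    ((∫⁻ x, ENNReal.ofReal (-g x) ∂μ : ℝ≥0∞) : EReal)

/-- The boundary energy `∫_∂Ω U(x, u(x), D^τ u(x), n(x)) dH^(d-1)(x)`. -/
def boundaryEnergy {d : ℕ} {Ω : Set (E d)} {hΩ : IsOpen Ω} {p : ℝ≥0∞} [Fact (1 ≤ p)]
    (U : Density Ω) (u : sobolev Ω hΩ p) : EReal :=
  extendedIntegral (surface Ω) fun x =>
    U x (u.1.1 x) (tangentialDerivative u x) (outwardNormal Ω x)

end

end BoundarySobolev

/-!
The functional is lower semicontinuous because minors are weakly continuous, and this is used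
without Young measures, through convex combinations.

*Minors.* Let `m = d - 1 < p`. In a chart, a weakly convergent sequence in `W^{1,p}(∂Ω; ℝ^d)`
becomes a bounded sequence in `W^{1,p}` of a ball of `ℝ^m`. After multiplication by a cutoff
function it converges strongly in `L^p` (`tendsto_eLpNorm_of_weak`, by mollification). Since a
minor of a gradient is a divergence (`integral_mul_minorOf_fderiv`), the integrals of the minors
of the gradients against test functions converge (`tendsto_integral_minorOf`). The minors have
order at most `m < p`, so they are bounded in `L^{p/m}` with `p/m > 1`, and Mazur's lemma gives
convex combinations, of tails of a subsequence, along which *all* minors converge almost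
everywhere (`exists_subseq_convex_combination_minors`).

*A fixed boundary point.* Suppose that `y_j → y` and that tail convex combinations of the minors
of `G_j` converge to the minors of `F`. By polyconvexity, `U(x, y, ·, n)` has a minorant that is
affine in the minors and almost exact at `F`. Lower semicontinuity, on bounded sets of matrices,
and the growth of degree `p > m`, outside, show that this is up to a small error a minorant of
`U(x, y_j, ·, n)` for all large `j`. Hence the convex combinations of the numbers `U(x, y_j, G_j,
n)` are asymptotically at least `U(x, y, F, n)` (`eventually_le_convex_combination`).

*Integration.* By Fatou's lemma, applied to the convex combinations along a subsequence with small
energies, the energy is lower semicontinuous on any measurable part of a chart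
(`lintegral_le_liminf_of_convex_combination`). Finitely many charts cover the compact boundary,
and the parts can be made disjoint (`lintegral_le_liminf_of_cover`). The integrable minorant `a`
reduces the extended integral to the integral of a nonnegative function (`extendedIntegral_eq`).

*Geometry.* By Rademacher's theorem the graph function of a chart is differentiable almost
everywhere. At such a point the tangent space is the range of the derivative of the
parametrization, and the outward normal is the upward normal of the graph
(`GraphChart.tangentSpace_param`, `GraphChart.outwardNormal_param`); null sets pass between a
chart and the boundary in both directions because the parametrization is bi-Lipschitz
(`GraphChart.ae_tube`).
-/

namespace BoundarySobolev

/-! ### Mollification in `L^p` -/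

section Mollification

/-- Jensen's inequality and Tonelli's theorem: an average of functions that are bounded in `L^p` is
bounded in `L^p`. -/
lemma lintegral_rpow_le_of_average {α β : Type*} [MeasurableSpace α] [MeasurableSpace β]
    {μ : Measure α} {ν : Measure β} [SFinite μ] [IsProbabilityMeasure ν] {p : ℝ} (hp : 1 ≤ p)
    {H : α → β → ℝ≥0∞} (hH : AEMeasurable (Function.uncurry H) (μ.prod ν))
    {h : α → ℝ≥0∞} (hh : ∀ᵐ x ∂μ, h x ≤ ∫⁻ y, H x y ∂ν) {K : ℝ≥0∞}
    (hK : ∀ᵐ y ∂ν, ∫⁻ x, H x y ^ p ∂μ ≤ K) : ∫⁻ x, h x ^ p ∂μ ≤ K := by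
  have h0 : ∀ᵐ x ∂μ, AEMeasurable (H x) ν := by
    filter_upwards [hH.aestronglyMeasurable.prodMk_left] with x hx using hx.aemeasurable
  calc ∫⁻ x, h x ^ p ∂μ ≤ ∫⁻ x, ∫⁻ y, H x y ^ p ∂ν ∂μ := by
        refine lintegral_mono_ae ?_
        filter_upwards [hh, h0] with x hx hm
        have h1 := eLpNorm'_le_eLpNorm'_of_exponent_le (p := 1) (q := p) one_pos hp ν
          (f := H x) hm.aestronglyMeasurable
        simp only [eLpNorm', enorm_eq_self, ENNReal.rpow_one, one_div_one] at h1
        calc h x ^ p ≤ ((∫⁻ y, H x y ^ p ∂ν) ^ (1 / p)) ^ p := by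
              gcongr
              exact hx.trans h1
          _ = _ := by
              rw [← ENNReal.rpow_mul, one_div_mul_cancel (by linarith), ENNReal.rpow_one]
    _ = ∫⁻ y, ∫⁻ x, H x y ^ p ∂μ ∂ν := lintegral_lintegral_swap (hH.pow_const p)
    _ ≤ ∫⁻ _, K ∂ν := lintegral_mono_ae hK
    _ = K := by simp

lemma eLpNorm_le_iff_lintegral_rpow {α F : Type*} [MeasurableSpace α] [NormedAddCommGroup F]
    {μ : Measure α} {p : ℝ} (hp : 0 < p) (f : α → F) (K : ℝ≥0∞) :
    eLpNorm f (ENNReal.ofReal p) μ ≤ K ↔ ∫⁻ x, ‖f x‖ₑ ^ p ∂μ ≤ K ^ p := by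
  rw [eLpNorm_eq_lintegral_rpow_enorm_toReal (by simpa using hp) ENNReal.ofReal_ne_top,
    ENNReal.toReal_ofReal hp.le, one_div, ENNReal.rpow_inv_le_iff hp]

variable {m : ℕ} {F : Type*} [NormedAddCommGroup F] [NormedSpace ℝ F]

/-- A sequence of bump functions whose supports shrink to the origin. -/
noncomputable def shrinkingBump (m n : ℕ) : ContDiffBump (0 : E m) where
  rIn := 1 / (2 * ((n : ℝ) + 1))
  rOut := 1 / ((n : ℝ) + 1)
  rIn_pos := by positivity
  rIn_lt_rOut := by
    apply one_div_lt_one_div_of_lt <;> linarith [(Nat.cast_nonneg n : (0 : ℝ) ≤ n)]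

/-- The mollification of `f` at scale `1 / (n + 1)`. -/
noncomputable def mollify (n : ℕ) (f : E m → F) : E m → F :=
  convolution ((shrinkingBump m n).normed volume) f (ContinuousLinearMap.lsmul ℝ ℝ) volume

/-- The probability measure whose density is the mollifying kernel. -/
noncomputable def kernelMeasure (m n : ℕ) : Measure (E m) :=
  volume.withDensity fun y => ENNReal.ofReal ((shrinkingBump m n).normed volume y)

instance (n : ℕ) : IsProbabilityMeasure (kernelMeasure m n) := by
  constructor
  rw [kernelMeasure, withDensity_apply _ MeasurableSet.univ, Measure.restrict_univ,
    ← ofReal_integral_eq_lintegral_ofReal (ContDiffBump.integrable_normed _)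
      (ae_of_all _ (ContDiffBump.nonneg_normed _)), ContDiffBump.integral_normed]
  simp

lemma kernelMeasure_ae (n : ℕ) : ∀ᵐ y ∂kernelMeasure m n, ‖y‖ ≤ 1 / ((n : ℝ) + 1) := by
  rw [kernelMeasure,
    ae_withDensity_iff (ContDiffBump.continuous_normed _).measurable.ennreal_ofReal]
  refine ae_of_all _ fun y hy => ?_
  have h1 : y ∈ Function.support ((shrinkingBump m n).normed volume) := by
    intro h
    simp [h] at hy
  rw [ContDiffBump.support_normed_eq] at h1
  simpa [shrinkingBump] using (Metric.mem_ball.1 h1).le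

lemma mollify_apply (n : ℕ) (f : E m → F) (x : E m) :
    mollify n f x = ∫ y, (shrinkingBump m n).normed volume y • f (x - y) := rfl

lemma integrable_mollify {f : E m → F} (hf : LocallyIntegrable f) (n : ℕ) (x : E m) :
    Integrable (fun y => (shrinkingBump m n).normed volume y • f (x - y)) :=
  ((ContDiffBump.hasCompactSupport_normed _).convolutionExists_left
    (ContinuousLinearMap.lsmul ℝ ℝ) (ContDiffBump.continuous_normed _) hf) x

lemma contDiff_mollify [CompleteSpace F] {f : E m → F} (hf : LocallyIntegrable f) (n : ℕ) :
    ContDiff ℝ ∞ (mollify n f) :=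
  (ContDiffBump.hasCompactSupport_normed _).contDiff_convolution_left _
    (ContDiffBump.contDiff_normed _) hf

lemma hasCompactSupport_mollify {f : E m → F} (hf : HasCompactSupport f) (n : ℕ) :
    HasCompactSupport (mollify n f) :=
  HasCompactSupport.convolution _ (ContDiffBump.hasCompactSupport_normed _) hf

/-- The distance of a function to its mollification is controlled by its small translations. -/
lemma eLpNorm_mollify_sub_le [CompleteSpace F] {p : ℝ} (hp : 1 ≤ p) {f : E m → F}
    (hf : LocallyIntegrable f)
    (n : ℕ) {K : ℝ≥0∞} (hK : ∀ y : E m, ‖y‖ ≤ 1 / ((n : ℝ) + 1) →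
      eLpNorm (fun x => f (x - y) - f x) (ENNReal.ofReal p) volume ≤ K) :
    eLpNorm (fun x => mollify n f x - f x) (ENNReal.ofReal p) volume ≤ K := by
  have hp0 : 0 < p := by linarith
  rw [eLpNorm_le_iff_lintegral_rpow hp0]
  have hac : kernelMeasure m n ≪ volume := withDensity_absolutelyContinuous _ _
  refine lintegral_rpow_le_of_average (ν := kernelMeasure m n) hp
    (H := fun x y => ‖f (x - y) - f x‖ₑ) ?_ (ae_of_all _ fun x => ?_) ?_
  · have h1 : AEStronglyMeasurable (fun q : E m × E m => f (q.1 - q.2)) (volume.prod volume) :=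
      hf.aestronglyMeasurable.comp_quasiMeasurePreserving
        (quasiMeasurePreserving_sub_of_right_invariant volume volume)
    have h2 : AEStronglyMeasurable (fun q : E m × E m => f q.1) (volume.prod volume) :=
      hf.aestronglyMeasurable.comp_fst
    exact ((h1.sub h2).mono_ac (Measure.AbsolutelyContinuous.rfl.prod hac)).enorm
  · have hi := integrable_mollify hf n x
    have hi2 : Integrable (fun y => (shrinkingBump m n).normed volume y • f x) :=
      (ContDiffBump.integrable_normed _).smul_const _
    have h1 : mollify n f x - f x =
        ∫ y, (shrinkingBump m n).normed volume y • (f (x - y) - f x) := by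
      simp only [smul_sub]
      rw [integral_sub hi hi2, integral_smul_const, ContDiffBump.integral_normed, one_smul,
        mollify_apply]
    rw [h1, kernelMeasure, lintegral_withDensity_eq_lintegral_mul₀']
    · refine (enorm_integral_le_lintegral_enorm _).trans (lintegral_mono fun y => ?_)
      rw [enorm_smul, Real.enorm_of_nonneg (ContDiffBump.nonneg_normed _ _)]
      rfl
    · exact (ContDiffBump.continuous_normed _).measurable.ennreal_ofReal.aemeasurable
    · have : AEStronglyMeasurable (fun y => f (x - y)) volume :=
        hf.aestronglyMeasurable.comp_quasiMeasurePreserving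
          (quasiMeasurePreserving_sub_left volume x)
      exact ((this.sub aestronglyMeasurable_const).mono_ac hac).enorm
  · filter_upwards [kernelMeasure_ae n] with y hy
    exact (eLpNorm_le_iff_lintegral_rpow hp0 _ _).1 (hK y hy)

lemma eLpNorm_translate {m : ℕ} {F : Type*} [NormedAddCommGroup F] {f : E m → F}
    (hf : AEStronglyMeasurable f) (P : ℝ≥0∞) (y : E m) :
    eLpNorm (fun x => f (x - y)) P volume = eLpNorm f P volume :=
  eLpNorm_comp_measurePreserving hf (measurePreserving_sub_right volume y)

/-- Translation estimate for smooth functions. -/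
lemma eLpNorm_translate_sub_le_of_contDiff [CompleteSpace F] {p : ℝ} (hp : 1 ≤ p) {f : E m → F}
    (hf : ContDiff ℝ ∞ f) (y : E m) :
    eLpNorm (fun x => f (x - y) - f x) (ENNReal.ofReal p) volume ≤
      ‖y‖ₑ * eLpNorm (fderiv ℝ f) (ENNReal.ofReal p) volume := by
  have hp0 : 0 < p := by linarith
  have hcD : Continuous (fderiv ℝ f) := hf.continuous_fderiv (by simp)
  rw [eLpNorm_le_iff_lintegral_rpow hp0]
  have : IsProbabilityMeasure (volume.restrict (Icc (0 : ℝ) 1)) := ⟨by simp⟩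
  refine lintegral_rpow_le_of_average (ν := volume.restrict (Icc (0 : ℝ) 1)) hp
    (H := fun x t => ‖y‖ₑ * ‖fderiv ℝ f (x - t • y)‖ₑ) ?_ (ae_of_all _ fun x => ?_)
    (ae_of_all _ fun t => ?_)
  · have : Continuous (fun q : E m × ℝ => fderiv ℝ f (q.1 - q.2 • y)) :=
      hcD.comp (continuous_fst.sub (continuous_snd.smul continuous_const))
    exact ((this.enorm).measurable.const_mul _).aemeasurable
  · have h1 : ∀ t : ℝ, HasDerivAt (fun t : ℝ => f (x - t • y)) (fderiv ℝ f (x - t • y) (-y)) t := by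
      intro t
      have h2 : HasDerivAt (fun t : ℝ => x - t • y) (-y) t := by
        simpa using ((hasDerivAt_id t).smul_const y).const_sub x
      exact ((hf.differentiable (by simp)) _).hasFDerivAt.comp_hasDerivAt t h2
    have hcont : Continuous (fun t : ℝ => fderiv ℝ f (x - t • y) (-y)) :=
      (hcD.comp (continuous_const.sub (continuous_id.smul continuous_const))).clm_apply
        continuous_const
    have h3 := intervalIntegral.integral_eq_sub_of_hasDerivAt (fun t _ => h1 t)
      (hcont.intervalIntegrable 0 1)
    simp only [one_smul, zero_smul, sub_zero] at h3
    rw [← h3, intervalIntegral.integral_of_le zero_le_one, ← integral_Icc_eq_integral_Ioc]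
    refine (enorm_integral_le_lintegral_enorm _).trans (lintegral_mono fun t => ?_)
    rw [mul_comm, ← enorm_neg y]
    exact ContinuousLinearMap.le_opENorm _ _
  · have h1 := eLpNorm_translate hcD.aestronglyMeasurable (ENNReal.ofReal p) (t • y)
    have h2 := (eLpNorm_le_iff_lintegral_rpow hp0 _ _).1 h1.le
    simp only [ENNReal.mul_rpow_of_nonneg _ _ hp0.le]
    rw [lintegral_const_mul' _ _ (ENNReal.rpow_ne_top_of_nonneg hp0.le (by simp))]
    gcongr

/-- Mollifications converge in `L^p`. -/
lemma tendsto_eLpNorm_mollify_sub [CompleteSpace F] {p : ℝ} (hp : 1 ≤ p) {f : E m → F}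
    (hf : MemLp f (ENNReal.ofReal p) volume) :
    Tendsto (fun n => eLpNorm (fun x => mollify n f x - f x) (ENNReal.ofReal p) volume) atTop
      (𝓝 0) := by
  have hp1 : 1 ≤ ENNReal.ofReal p := by simpa using hp
  rw [ENNReal.tendsto_nhds_zero]
  intro ε hε
  by_cases hεt : ε = ⊤
  · simp [hεt]
  have hε3 : 0 < ε.toReal / 3 := div_pos (ENNReal.toReal_pos hε.ne' hεt) (by norm_num)
  obtain ⟨g, hgc, hgs, hg⟩ := hf.exist_eLpNorm_sub_le ENNReal.ofReal_ne_top hp1 hε3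
  have hDg : MemLp (fderiv ℝ g) (ENNReal.ofReal p) volume :=
    (hgs.continuous_fderiv (by simp)).memLp_of_hasCompactSupport (hgc.fderiv ℝ)
  have hsm : Tendsto (fun n : ℕ => ENNReal.ofReal (1 / ((n : ℝ) + 1)) *
      eLpNorm (fderiv ℝ g) (ENNReal.ofReal p) volume) atTop (𝓝 0) := by
    have h1 : Tendsto (fun n : ℕ => ENNReal.ofReal (1 / ((n : ℝ) + 1))) atTop (𝓝 0) := by
      simpa using ENNReal.tendsto_ofReal (tendsto_one_div_add_atTop_nhds_zero_nat (𝕜 := ℝ))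
    simpa using ENNReal.Tendsto.mul_const h1 (Or.inr hDg.eLpNorm_ne_top)
  have hεε : ENNReal.ofReal (ε.toReal / 3) + ENNReal.ofReal (ε.toReal / 3) +
      ENNReal.ofReal (ε.toReal / 3) = ε := by
    rw [← ENNReal.ofReal_add hε3.le hε3.le, ← ENNReal.ofReal_add (by positivity) hε3.le,
      add_thirds, ENNReal.ofReal_toReal hεt]
  filter_upwards [(ENNReal.tendsto_nhds_zero.1 hsm) _ (ENNReal.ofReal_pos.2 hε3)] with n hn
  refine eLpNorm_mollify_sub_le hp (hf.locallyIntegrable hp1) n fun y hy => ?_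
  have hfg : AEStronglyMeasurable (f - g) volume :=
    hf.aestronglyMeasurable.sub hgs.continuous.aestronglyMeasurable
  have hT : AEStronglyMeasurable (fun x => (f - g) (x - y)) volume :=
    hfg.comp_quasiMeasurePreserving (measurePreserving_sub_right volume y).quasiMeasurePreserving
  have hG : AEStronglyMeasurable (fun x => g (x - y) - g x) volume :=
    ((hgs.continuous.comp (continuous_id.sub continuous_const)).sub
      hgs.continuous).aestronglyMeasurable
  have e : (fun x => f (x - y) - f x) =
      ((fun x => (f - g) (x - y)) - (f - g)) + fun x => g (x - y) - g x := by
    ext x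
    simp
    abel
  rw [e, ← hεε]
  refine (eLpNorm_add_le (hT.sub hfg) hG hp1).trans (add_le_add ?_ ?_)
  · refine (eLpNorm_sub_le hT hfg hp1).trans (add_le_add ?_ hg)
    rwa [eLpNorm_translate hfg]
  · refine (eLpNorm_translate_sub_le_of_contDiff hp hgs y).trans (le_trans ?_ hn)
    gcongr
    rw [← ofReal_norm]
    exact ENNReal.ofReal_le_ofReal hy

end Mollification

/-! ### Weak gradients on the whole space -/

section WeakGradient

variable {m : ℕ}

/-- `g` is the weak gradient of `w` on `ℝ^m`. The integrals are Bochner integrals; for locally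
integrable `w` and `g` they all exist. -/
def HasWeakGradient (w : E m → ℝ) (g : E m → E m →L[ℝ] ℝ) : Prop :=
  ∀ φ : E m → ℝ, ContDiff ℝ ∞ φ → HasCompactSupport φ → ∀ v : E m,
    ∫ z, fderiv ℝ φ z v * w z = - ∫ z, φ z * g z v

/-- The gradient of a mollification is the mollification of the weak gradient. -/
lemma HasWeakGradient.fderiv_mollify {w : E m → ℝ} {g : E m → E m →L[ℝ] ℝ}
    (h : HasWeakGradient w g) (hw : LocallyIntegrable w) (hg : LocallyIntegrable g) (n : ℕ) :
    fderiv ℝ (mollify n w) = mollify n g := by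
  ext x v
  set ρ := (shrinkingBump m n).normed (volume : Measure (E m)) with hρ
  have hρs : ContDiff ℝ ∞ ρ := ContDiffBump.contDiff_normed _
  have hρc : HasCompactSupport ρ := ContDiffBump.hasCompactSupport_normed _
  have h1 := hρc.hasFDerivAt_convolution_left (ContinuousLinearMap.lsmul ℝ ℝ)
    (hρs.of_le (by simp)) hw x
  have h2 : fderiv ℝ (mollify n w) x = _ := h1.fderiv
  have hint : Integrable (fun y => (fderiv ℝ ρ y).smulRight (w (x - y))) := by
    have := ((hρc.fderiv ℝ).convolutionExists_left
      ((ContinuousLinearMap.lsmul ℝ ℝ).precompL (E m) : (E m →L[ℝ] ℝ) →L[ℝ] ℝ →L[ℝ] (E m →L[ℝ] ℝ))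
      (hρs.continuous_fderiv (by simp)) hw) x
    refine this.congr (ae_of_all _ fun y => ?_)
    ext v
    simp [ContinuousLinearMap.precompL_apply]
  have h3 : fderiv ℝ (mollify n w) x v = ∫ y, fderiv ℝ ρ y v * w (x - y) := by
    rw [h2, convolution_def]
    have e : ∀ y, ((ContinuousLinearMap.lsmul ℝ ℝ).precompL (E m) :
        (E m →L[ℝ] ℝ) →L[ℝ] ℝ →L[ℝ] (E m →L[ℝ] ℝ)) (fderiv ℝ ρ y) (w (x - y)) =
        (fderiv ℝ ρ y).smulRight (w (x - y)) := by
      intro y; ext v; simp [ContinuousLinearMap.precompL_apply]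
    simp only [e]
    rw [ContinuousLinearMap.integral_apply hint]
    simp
  have h4 : mollify n g x v = ∫ y, ρ y * g (x - y) v := by
    rw [mollify_apply, ContinuousLinearMap.integral_apply (integrable_mollify hg n x)]
    simp [hρ]
  rw [h3, h4]
  rw [← integral_sub_left_eq_self _ volume x,
    ← integral_sub_left_eq_self (fun y => ρ y * _) volume x]
  simp only [sub_sub_cancel]
  have hφs : ContDiff ℝ ∞ (fun z => ρ (x - z)) := hρs.comp (contDiff_const.sub contDiff_id)
  have hφc : HasCompactSupport (fun z => ρ (x - z)) :=
    hρc.comp_homeomorph (Homeomorph.subLeft x)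
  have h5 := h _ hφs hφc v
  have h6 : ∀ z, fderiv ℝ (fun z => ρ (x - z)) z v = - fderiv ℝ ρ (x - z) v := by
    intro z
    have h7 : HasFDerivAt (fun z => x - z) (-ContinuousLinearMap.id ℝ (E m)) z :=
      (hasFDerivAt_id z).const_sub x
    have h8 : HasFDerivAt (fun z => ρ (x - z))
        ((fderiv ℝ ρ (x - z)).comp (-ContinuousLinearMap.id ℝ (E m))) z :=
      (hρs.differentiable (by simp) (x - z)).hasFDerivAt.comp z h7
    rw [h8.fderiv]
    simp
  simp only [h6, neg_mul, integral_neg, neg_inj] at h5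
  exact h5

/-- Translation estimate for functions with a weak gradient. -/
lemma HasWeakGradient.eLpNorm_translate_sub_le {p : ℝ} (hp : 1 ≤ p) {w : E m → ℝ}
    {g : E m → E m →L[ℝ] ℝ} (h : HasWeakGradient w g)
    (hw : MemLp w (ENNReal.ofReal p) volume) (hg : MemLp g (ENNReal.ofReal p) volume) (y : E m) :
    eLpNorm (fun x => w (x - y) - w x) (ENNReal.ofReal p) volume ≤
      ‖y‖ₑ * eLpNorm g (ENNReal.ofReal p) volume := by
  have hp1 : 1 ≤ ENNReal.ofReal p := by simpa using hp
  have hwl := hw.locallyIntegrable hp1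
  have hgl := hg.locallyIntegrable hp1
  have key : ∀ n : ℕ, eLpNorm (fun x => w (x - y) - w x) (ENNReal.ofReal p) volume ≤
      (eLpNorm (fun x => mollify n w x - w x) (ENNReal.ofReal p) volume +
        eLpNorm (fun x => mollify n w x - w x) (ENNReal.ofReal p) volume) +
      ‖y‖ₑ * (eLpNorm (fun x => mollify n g x - g x) (ENNReal.ofReal p) volume +
        eLpNorm g (ENNReal.ofReal p) volume) := by
    intro n
    have hs := contDiff_mollify hwl n
    have hm : AEStronglyMeasurable (fun x => mollify n w x - w x) volume :=
      hs.continuous.aestronglyMeasurable.sub hw.aestronglyMeasurable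
    have hT : AEStronglyMeasurable (fun x => mollify n w (x - y) - w (x - y)) volume :=
      hm.comp_quasiMeasurePreserving (measurePreserving_sub_right volume y).quasiMeasurePreserving
    have hG : AEStronglyMeasurable (fun x => mollify n w (x - y) - mollify n w x) volume :=
      ((hs.continuous.comp (continuous_id.sub continuous_const)).sub
        hs.continuous).aestronglyMeasurable
    have hmg : AEStronglyMeasurable (fun x => mollify n g x - g x) volume :=
      (contDiff_mollify hgl n).continuous.aestronglyMeasurable.sub hg.aestronglyMeasurable
    have e : (fun x => w (x - y) - w x) =
        ((fun x => mollify n w x - w x) - (fun x => mollify n w (x - y) - w (x - y))) +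
          fun x => mollify n w (x - y) - mollify n w x := by
      ext x
      simp only [Pi.add_apply, Pi.sub_apply]
      ring
    have e3 : eLpNorm (mollify n g) (ENNReal.ofReal p) volume ≤
        eLpNorm (fun x => mollify n g x - g x) (ENNReal.ofReal p) volume +
          eLpNorm g (ENNReal.ofReal p) volume := by
      have e2 : mollify n g = (fun x => mollify n g x - g x) + g := by
        funext x
        exact (sub_add_cancel _ _).symm
      have e4 := eLpNorm_add_le hmg hg.aestronglyMeasurable hp1
      rwa [← e2] at e4
    rw [e]
    refine (eLpNorm_add_le (hm.sub hT) hG hp1).trans (add_le_add ?_ ?_)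
    · refine (eLpNorm_sub_le hm hT hp1).trans (add_le_add le_rfl ?_)
      exact (eLpNorm_translate hm _ y).le
    · refine (eLpNorm_translate_sub_le_of_contDiff hp hs y).trans ?_
      rw [h.fderiv_mollify hwl hgl]
      exact mul_le_mul_right e3 _
  have l1 := tendsto_eLpNorm_mollify_sub hp hw
  have l2 : Tendsto (fun n => eLpNorm (fun x => mollify n g x - g x) (ENNReal.ofReal p) volume)
      atTop (𝓝 0) := tendsto_eLpNorm_mollify_sub (F := E m →L[ℝ] ℝ) hp hg
  generalize eLpNorm (fun x => w (x - y) - w x) (ENNReal.ofReal p) volume = A at key ⊢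
  generalize eLpNorm g (ENNReal.ofReal p) volume = G at key ⊢
  have l4 : Tendsto (fun n => eLpNorm (fun x => mollify n g x - g x) (ENNReal.ofReal p) volume + G)
      atTop (𝓝 (0 + G)) := l2.add tendsto_const_nhds
  have l5 := ENNReal.Tendsto.const_mul (a := ‖y‖ₑ) l4 (Or.inr enorm_ne_top)
  have l3 := (l1.add l1).add l5
  rw [add_zero, zero_add, zero_add] at l3
  exact ge_of_tendsto' l3 key

/-- The mollification error at scale `1 / (n + 1)` is controlled by the weak gradient. -/
lemma HasWeakGradient.eLpNorm_mollify_sub_le {p : ℝ} (hp : 1 ≤ p) {w : E m → ℝ}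
    {g : E m → E m →L[ℝ] ℝ} (h : HasWeakGradient w g)
    (hw : MemLp w (ENNReal.ofReal p) volume) (hg : MemLp g (ENNReal.ofReal p) volume) (n : ℕ) :
    eLpNorm (fun x => mollify n w x - w x) (ENNReal.ofReal p) volume ≤
      ENNReal.ofReal (1 / ((n : ℝ) + 1)) * eLpNorm g (ENNReal.ofReal p) volume := by
  have hp1 : 1 ≤ ENNReal.ofReal p := by simpa using hp
  refine BoundarySobolev.eLpNorm_mollify_sub_le hp (hw.locallyIntegrable hp1) n fun y hy => ?_
  refine (h.eLpNorm_translate_sub_le hp hw hg y).trans ?_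
  gcongr
  rw [← ofReal_norm]
  exact ENNReal.ofReal_le_ofReal hy

end WeakGradient

/-! ### Strong convergence of weakly convergent Sobolev functions -/

section Rellich

variable {m : ℕ}

lemma mollify_eq_integral_mul (n : ℕ) (f : E m → ℝ) (x : E m) :
    mollify n f x = ∫ z, (shrinkingBump m n).normed volume (x - z) * f z := by
  rw [mollify_apply, ← integral_sub_left_eq_self _ volume x]
  simp

/-- For a fixed scale, the mollifications of a bounded sequence that vanishes in the limit against
test functions converge to `0` strongly. -/
lemma tendsto_eLpNorm_mollify_of_weak {p : ℝ} (hp : 1 ≤ p) {δ : ℕ → E m → ℝ} {R : ℝ}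
    (hδ : ∀ j, MemLp (δ j) (ENNReal.ofReal p) volume)
    (hsupp : ∀ j, Function.support (δ j) ⊆ Metric.closedBall 0 R)
    {C : ℝ≥0∞} (hC : C ≠ ⊤) (hb : ∀ j, eLpNorm (δ j) (ENNReal.ofReal p) volume ≤ C)
    (hweak : ∀ φ : E m → ℝ, ContDiff ℝ ∞ φ → HasCompactSupport φ →
      Tendsto (fun j => ∫ z, φ z * δ j z) atTop (𝓝 0)) (n : ℕ) :
    Tendsto (fun j => eLpNorm (mollify n (δ j)) (ENNReal.ofReal p) volume) atTop (𝓝 0) := by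
  have hp0 : 0 < p := by linarith
  have hp1 : 1 ≤ ENNReal.ofReal p := by simpa using hp
  set ρ := (shrinkingBump m n).normed (volume : Measure (E m)) with hρ
  have hρs : ContDiff ℝ ∞ ρ := ContDiffBump.contDiff_normed _
  have hρc : HasCompactSupport ρ := ContDiffBump.hasCompactSupport_normed _
  obtain ⟨M, hM⟩ := hρc.exists_bound_of_continuous hρs.continuous
  set B : Set (E m) := Metric.closedBall 0 R with hB
  set L : ℝ≥0∞ := C * volume B ^ (1 / (1 : ℝ≥0∞).toReal - 1 / (ENNReal.ofReal p).toReal) with hL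
  have hBfin : volume B ≠ ⊤ := measure_closedBall_lt_top.ne
  have hexp : 0 ≤ 1 / (1 : ℝ≥0∞).toReal - 1 / (ENNReal.ofReal p).toReal := by
    rw [ENNReal.toReal_ofReal hp0.le, ENNReal.toReal_one, one_div_one, sub_nonneg]
    exact (div_le_one hp0).2 hp
  have hLt : L ≠ ⊤ := ENNReal.mul_ne_top hC (ENNReal.rpow_ne_top_of_nonneg hexp hBfin)
  have hL1 : ∀ j, ∫⁻ z, ‖δ j z‖ₑ ≤ L := by
    intro j
    have e : ∫⁻ z, ‖δ j z‖ₑ = ∫⁻ z in B, ‖δ j z‖ₑ := by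
      rw [← lintegral_indicator Metric.isClosed_closedBall.measurableSet]
      refine lintegral_congr fun z => ?_
      by_cases hz : z ∈ B
      · rw [indicator_of_mem hz]
      · have : δ j z = 0 := by
          by_contra h0
          exact hz (hsupp j h0)
        rw [indicator_of_notMem hz, this, enorm_zero]
    rw [e, ← eLpNorm_one_eq_lintegral_enorm]
    refine (eLpNorm_le_eLpNorm_mul_rpow_measure_univ hp1
      (hδ j).aestronglyMeasurable.restrict).trans ?_
    rw [Measure.restrict_apply_univ]
    exact mul_le_mul_left ((eLpNorm_mono_measure _ Measure.restrict_le_self).trans (hb j)) _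
  have hbd : ∀ j x, ‖mollify n (δ j) x‖ₑ ≤ ENNReal.ofReal M * L := by
    intro j x
    rw [mollify_eq_integral_mul]
    calc ‖∫ z, ρ (x - z) * δ j z‖ₑ ≤ ∫⁻ z, ‖ρ (x - z) * δ j z‖ₑ :=
          enorm_integral_le_lintegral_enorm _
      _ ≤ ∫⁻ z, ENNReal.ofReal M * ‖δ j z‖ₑ := by
          refine lintegral_mono fun z => ?_
          rw [enorm_mul]
          gcongr
          rw [← ofReal_norm]
          exact ENNReal.ofReal_le_ofReal (hM _)
      _ = ENNReal.ofReal M * ∫⁻ z, ‖δ j z‖ₑ := lintegral_const_mul' _ _ ENNReal.ofReal_ne_top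
      _ ≤ _ := by gcongr; exact hL1 j
  have hpt : ∀ x, Tendsto (fun j => mollify n (δ j) x) atTop (𝓝 0) := by
    intro x
    simp only [mollify_eq_integral_mul]
    exact hweak _ (hρs.comp (contDiff_const.sub contDiff_id))
      (hρc.comp_homeomorph (Homeomorph.subLeft x))
  set K : Set (E m) := Metric.closedBall 0 (R + 1)
  have hK : ∀ j x, x ∉ K → mollify n (δ j) x = 0 := by
    intro j x hx
    by_contra h0
    obtain ⟨a, ha, b, hb, hab⟩ := support_convolution_subset (ContinuousLinearMap.lsmul ℝ ℝ)
      (show x ∈ Function.support (mollify n (δ j)) from h0)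
    rw [ContDiffBump.support_normed_eq] at ha
    have h1 : ‖b‖ ≤ R := by simpa [hB] using hsupp j hb
    have h2 : ‖a‖ < 1 / ((n : ℝ) + 1) := by simpa [shrinkingBump] using ha
    have h3 : 1 / ((n : ℝ) + 1) ≤ 1 := by
      rw [div_le_one (by positivity)]
      linarith [(Nat.cast_nonneg n : (0 : ℝ) ≤ n)]
    apply hx
    simp only [K, Metric.mem_closedBall, dist_zero_right]
    rw [← hab]
    change ‖a + b‖ ≤ _
    linarith [norm_add_le a b]
  have hlim : Tendsto (fun j => ∫⁻ x, ‖mollify n (δ j) x‖ₑ ^ p) atTop (𝓝 (∫⁻ _ : E m, 0)) := by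
    refine tendsto_lintegral_of_dominated_convergence'
      (K.indicator fun _ => (ENNReal.ofReal M * L) ^ p) (fun j => ?_)
      (fun j => ae_of_all _ fun x => ?_) ?_ (ae_of_all _ fun x => ?_)
    · exact ((contDiff_mollify ((hδ j).locallyIntegrable
        hp1) n).continuous.enorm.measurable.pow_const p).aemeasurable
    · by_cases hx : x ∈ K
      · rw [indicator_of_mem hx]
        exact ENNReal.rpow_le_rpow (hbd j x) hp0.le
      · simp [hK j x hx, hp0]
    · rw [lintegral_indicator Metric.isClosed_closedBall.measurableSet, lintegral_const,
        Measure.restrict_apply_univ]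
      exact ENNReal.mul_ne_top (ENNReal.rpow_ne_top_of_nonneg hp0.le
        (ENNReal.mul_ne_top ENNReal.ofReal_ne_top hLt)) measure_closedBall_lt_top.ne
    · have h1 := ((hpt x).enorm).ennrpow_const p
      simpa [hp0] using h1
  have h2 := hlim.ennrpow_const (1 / p)
  simp only [lintegral_zero] at h2
  rw [ENNReal.zero_rpow_of_pos (by positivity)] at h2
  refine h2.congr fun j => ?_
  rw [eLpNorm_eq_lintegral_rpow_enorm_toReal (by simpa using hp0) ENNReal.ofReal_ne_top,
    ENNReal.toReal_ofReal hp0.le]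

/-- Rellich's theorem for a sequence whose weak limit is known: a bounded sequence in `W^{1,p}`,
with supports in a fixed ball, that vanishes in the limit against test functions converges to `0`
strongly in `L^p`. -/
lemma tendsto_eLpNorm_of_weak {p : ℝ} (hp : 1 ≤ p) {δ : ℕ → E m → ℝ}
    {g : ℕ → E m → E m →L[ℝ] ℝ} {R : ℝ}
    (hδ : ∀ j, MemLp (δ j) (ENNReal.ofReal p) volume)
    (hg : ∀ j, MemLp (g j) (ENNReal.ofReal p) volume)
    (hδg : ∀ j, HasWeakGradient (δ j) (g j))
    (hsupp : ∀ j, Function.support (δ j) ⊆ Metric.closedBall 0 R)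
    {C : ℝ≥0∞} (hC : C ≠ ⊤) (hb : ∀ j, eLpNorm (δ j) (ENNReal.ofReal p) volume ≤ C)
    (hbg : ∀ j, eLpNorm (g j) (ENNReal.ofReal p) volume ≤ C)
    (hweak : ∀ φ : E m → ℝ, ContDiff ℝ ∞ φ → HasCompactSupport φ →
      Tendsto (fun j => ∫ z, φ z * δ j z) atTop (𝓝 0)) :
    Tendsto (fun j => eLpNorm (δ j) (ENNReal.ofReal p) volume) atTop (𝓝 0) := by
  have hp1 : 1 ≤ ENNReal.ofReal p := by simpa using hp
  rw [ENNReal.tendsto_nhds_zero]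
  intro ε hε
  have hε2 : 0 < ε / 2 := ENNReal.half_pos hε.ne'
  have hsm : Tendsto (fun n : ℕ => ENNReal.ofReal (1 / ((n : ℝ) + 1)) * C) atTop (𝓝 0) := by
    have h1 : Tendsto (fun n : ℕ => ENNReal.ofReal (1 / ((n : ℝ) + 1))) atTop (𝓝 0) := by
      simpa using ENNReal.tendsto_ofReal (tendsto_one_div_add_atTop_nhds_zero_nat (𝕜 := ℝ))
    simpa using ENNReal.Tendsto.mul_const h1 (Or.inr hC)
  obtain ⟨n, hn⟩ := ((ENNReal.tendsto_nhds_zero.1 hsm) _ hε2).exists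
  filter_upwards [(ENNReal.tendsto_nhds_zero.1
    (tendsto_eLpNorm_mollify_of_weak hp hδ hsupp hC hb hweak n)) _ hε2] with j hj
  have hs : AEStronglyMeasurable (mollify n (δ j)) volume :=
    (contDiff_mollify ((hδ j).locallyIntegrable hp1) n).continuous.aestronglyMeasurable
  have e : δ j = mollify n (δ j) - fun x => mollify n (δ j) x - δ j x := by
    funext x
    simp
  have h1 := eLpNorm_sub_le hs (hs.sub (hδ j).aestronglyMeasurable) hp1
  have e' : mollify n (δ j) - (mollify n (δ j) - δ j) = δ j := sub_sub_cancel _ _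
  rw [e'] at h1
  refine h1.trans ?_
  rw [← ENNReal.add_halves ε]
  refine add_le_add hj (le_trans ?_ hn)
  exact ((hδg j).eLpNorm_mollify_sub_le hp (hδ j) (hg j) n).trans (mul_le_mul_right (hbg j) _)

end Rellich

/-! ### Jacobian minors of smooth functions -/

section NullLagrangian

variable {m k : ℕ}

/-- The minor formed by the covectors `ξ i` in the directions `s j`. The rows of the matrix are the
covectors; directions may be repeated. -/
noncomputable def minorOf (s : Fin k → E m) (ξ : Fin k → E m →L[ℝ] ℝ) : ℝ :=
  (Matrix.of fun i j => ξ i (s j)).det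

lemma minorOf_eq_sum (s : Fin k → E m) (ξ : Fin k → E m →L[ℝ] ℝ) :
    minorOf s ξ = ∑ σ : Equiv.Perm (Fin k), (Equiv.Perm.sign σ : ℝ) * ∏ i, ξ i (s (σ i)) := by
  rw [minorOf, ← Matrix.det_transpose, Matrix.det_apply']
  simp

lemma minorOf_update (s : Fin k → E m) (ξ : Fin k → E m →L[ℝ] ℝ) (l : Fin k) (η : E m →L[ℝ] ℝ) :
    minorOf s (Function.update ξ l η) =
      ((Matrix.of fun i j => ξ i (s j)).updateRow l fun j => η (s j)).det := by
  rw [minorOf]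
  congr 1
  ext i j
  by_cases h : i = l
  · subst h; simp
  · simp [h]

lemma minorOf_update_add (s : Fin k → E m) (ξ : Fin k → E m →L[ℝ] ℝ) (l : Fin k)
    (η ζ : E m →L[ℝ] ℝ) : minorOf s (Function.update ξ l (η + ζ)) =
      minorOf s (Function.update ξ l η) + minorOf s (Function.update ξ l ζ) := by
  simp only [minorOf_update]
  exact Matrix.det_updateRow_add _ _ _ _

lemma minorOf_update_smul (s : Fin k → E m) (ξ : Fin k → E m →L[ℝ] ℝ) (l : Fin k)
    (c : ℝ) (η : E m →L[ℝ] ℝ) : minorOf s (Function.update ξ l (c • η)) =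
      c * minorOf s (Function.update ξ l η) := by
  simp only [minorOf_update]
  exact Matrix.det_updateRow_smul _ _ _ _

lemma minorOf_update_sub (s : Fin k → E m) (ξ : Fin k → E m →L[ℝ] ℝ) (l : Fin k)
    (η ζ : E m →L[ℝ] ℝ) : minorOf s (Function.update ξ l (η - ζ)) =
      minorOf s (Function.update ξ l η) - minorOf s (Function.update ξ l ζ) := by
  rw [sub_eq_add_neg, minorOf_update_add, ← neg_one_smul ℝ ζ, minorOf_update_smul]
  ring

lemma continuous_minorOf (s : Fin k → E m) : Continuous (minorOf s) := by
  unfold minorOf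
  refine Continuous.matrix_det (continuous_matrix fun i j => ?_)
  exact (continuous_apply i).clm_apply continuous_const

/-- The bound of a minor by the product of the norms of its rows. -/
lemma exists_abs_minorOf_le (s : Fin k → E m) :
    ∃ C : ℝ, 0 ≤ C ∧ ∀ ξ, |minorOf s ξ| ≤ C * ∏ i, ‖ξ i‖ := by
  refine ⟨∑ σ : Equiv.Perm (Fin k), ∏ i, ‖s (σ i)‖, by positivity, fun ξ => ?_⟩
  rw [minorOf_eq_sum, Finset.sum_mul]
  refine (Finset.abs_sum_le_sum_abs _ _).trans (Finset.sum_le_sum fun σ _ => ?_)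
  have h1 : |((Equiv.Perm.sign σ : ℤ) : ℝ)| = 1 := by
    rcases Int.units_eq_one_or (Equiv.Perm.sign σ) with h | h <;> simp [h]
  rw [abs_mul, h1, one_mul, Finset.abs_prod, ← Finset.prod_mul_distrib]
  refine Finset.prod_le_prod (fun i _ => abs_nonneg _) fun i _ => ?_
  rw [mul_comm]
  exact (ξ i).le_opNorm _

/-- A signed sum over permutations of a quantity that is invariant under a transposition vanishes.
For the second derivatives of the rows of a minor, the invariance is their symmetry. -/
lemma sum_sign_mul_eq_zero {A : Equiv.Perm (Fin k) → ℝ} {l i : Fin k} (hil : i ≠ l)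
    (hA : ∀ σ, A (σ * Equiv.swap l i) = A σ) :
    ∑ σ : Equiv.Perm (Fin k), (Equiv.Perm.sign σ : ℝ) * A σ = 0 := by
  have h1 := Equiv.sum_comp (Equiv.mulRight (Equiv.swap l i))
    (fun σ : Equiv.Perm (Fin k) => (Equiv.Perm.sign σ : ℝ) * A σ)
  simp only [Equiv.coe_mulRight, hA, Equiv.Perm.sign_mul, Equiv.Perm.sign_swap hil.symm] at h1
  simp only [mul_neg, mul_one, Units.val_neg, Int.cast_neg, neg_mul, Finset.sum_neg_distrib] at h1
  linarith

/-- Jacobian minors are null Lagrangians: for smooth functions with compact support their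
integral vanishes. -/
lemma integral_minorOf_fderiv_eq_zero (s : Fin k → E m) {h : Fin k → E m → ℝ}
    (hs : ∀ i, ContDiff ℝ ∞ (h i)) (hc : ∀ i, HasCompactSupport (h i)) (l : Fin k) :
    ∫ z, minorOf s (fun i => fderiv ℝ (h i) z) = 0 := by
  classical
  have hD : ∀ i v, ContDiff ℝ ∞ fun z => fderiv ℝ (h i) z v := fun i v =>
    ((hs i).fderiv_right (by simp)).clm_apply contDiff_const
  have hDc : ∀ i v, HasCompactSupport fun z => fderiv ℝ (h i) z v := fun i v =>
    (hc i).fderiv_apply ℝ v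
  set D2 : Fin k → E m → E m → E m → ℝ := fun i z v w =>
    fderiv ℝ (fun z => fderiv ℝ (h i) z w) z v with hD2
  have hsymm : ∀ i z v w, D2 i z v w = D2 i z w v := by
    intro i z v w
    have h1 : ∀ v w, D2 i z v w = fderiv ℝ (fderiv ℝ (h i)) z v w := by
      intro v w
      simp only [hD2]
      rw [fderiv_clm_apply (((hs i).fderiv_right (m := ∞) (by simp)).differentiable (by simp) z)
        (differentiableAt_const w)]
      simp
    rw [h1, h1]
    have h2 : IsSymmSndFDerivAt ℝ (h i) z :=
      (hs i).contDiffAt.isSymmSndFDerivAt (by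
      simp only [minSmoothness_of_isRCLikeNormedField]
      exact WithTop.coe_le_coe.2 (le_top : (2 : ℕ∞) ≤ ⊤))
    exact h2 v w
  -- in each term of the Leibniz formula the derivative of `h l` is moved to the other factors
  set S := Finset.univ.erase l with hS
  have hprod : ∀ σ : Equiv.Perm (Fin k),
      ∫ z, ∏ i, fderiv ℝ (h i) z (s (σ i)) = - ∫ z, h l z *
        ∑ i ∈ S, (∏ j ∈ S.erase i, fderiv ℝ (h j) z (s (σ j))) * D2 i z (s (σ l)) (s (σ i)) := by
    intro σ
    set P : E m → ℝ := fun z => ∏ i ∈ S, fderiv ℝ (h i) z (s (σ i)) with hP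
    have hPs : ContDiff ℝ ∞ P := contDiff_prod fun i _ => hD i _
    have hdP : ∀ z, fderiv ℝ P z (s (σ l)) =
        ∑ i ∈ S, (∏ j ∈ S.erase i, fderiv ℝ (h j) z (s (σ j))) * D2 i z (s (σ l)) (s (σ i)) := by
      intro z
      rw [hP, fderiv_finsetProd fun i _ => (hD i _).differentiable (by simp) z]
      simp [hD2]
    have hibp : ∫ z, h l z * fderiv ℝ P z (s (σ l)) =
        - ∫ z, fderiv ℝ (h l) z (s (σ l)) * P z := by
      refine integral_mul_fderiv_eq_neg_fderiv_mul_of_integrable ?_ ?_ ?_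
        (fun z _ => (hs l).differentiable (by simp) z)
        (fun z _ => hPs.differentiable (by simp) z)
      · exact ((hD l _).continuous.mul hPs.continuous).integrable_of_hasCompactSupport
          (hDc l _).mul_right
      · exact ((hs l).continuous.mul ((hPs.continuous_fderiv (by simp)).clm_apply
          continuous_const)).integrable_of_hasCompactSupport (hc l).mul_right
      · exact ((hs l).continuous.mul hPs.continuous).integrable_of_hasCompactSupport
          (hc l).mul_right
    simp only [hdP] at hibp
    rw [hibp, neg_neg]
    refine integral_congr_ae (ae_of_all _ fun z => ?_)
    exact (Finset.mul_prod_erase Finset.univ (fun i => fderiv ℝ (h i) z (s (σ i)))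
      (Finset.mem_univ l)).symm
  have hcont : ∀ σ : Equiv.Perm (Fin k), Continuous fun z =>
      ∑ i ∈ S, (∏ j ∈ S.erase i, fderiv ℝ (h j) z (s (σ j))) * D2 i z (s (σ l)) (s (σ i)) := by
    intro σ
    refine continuous_finsetSum _ fun i _ => (continuous_finsetProd _ fun j _ =>
      (hD j _).continuous).mul ?_
    exact ((hD i (s (σ i))).continuous_fderiv (by simp)).clm_apply continuous_const
  have hint : ∀ σ : Equiv.Perm (Fin k), Integrable fun z => ∏ i, fderiv ℝ (h i) z (s (σ i)) := by
    intro σ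
    refine (continuous_finsetProd _ fun i _ =>
      (hD i _).continuous).integrable_of_hasCompactSupport ?_
    refine (hDc l (s (σ l))).mono fun z hz => ?_
    exact (Finset.prod_ne_zero_iff.1 hz) l (Finset.mem_univ l)
  have hint2 : ∀ σ : Equiv.Perm (Fin k), Integrable fun z => h l z *
        ∑ i ∈ S, (∏ j ∈ S.erase i, fderiv ℝ (h j) z (s (σ j))) * D2 i z (s (σ l)) (s (σ i)) :=
    fun σ => ((hs l).continuous.mul (hcont σ)).integrable_of_hasCompactSupport (hc l).mul_right
  simp only [minorOf_eq_sum]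
  rw [integral_finsetSum _ fun σ _ => (hint σ).const_mul _]
  simp only [integral_const_mul, hprod, mul_neg]
  rw [Finset.sum_neg_distrib, neg_eq_zero]
  simp only [← integral_const_mul]
  rw [← integral_finsetSum _ fun σ _ => (hint2 σ).const_mul _]
  have hzero : ∀ z, ∑ σ : Equiv.Perm (Fin k), (Equiv.Perm.sign σ : ℝ) * (h l z *
      ∑ i ∈ S, (∏ j ∈ S.erase i, fderiv ℝ (h j) z (s (σ j))) *
        D2 i z (s (σ l)) (s (σ i))) = 0 := by
    intro z
    have e : ∀ σ : Equiv.Perm (Fin k), (Equiv.Perm.sign σ : ℝ) * (h l z *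
        ∑ i ∈ S, (∏ j ∈ S.erase i, fderiv ℝ (h j) z (s (σ j))) *
          D2 i z (s (σ l)) (s (σ i))) =
        h l z * ∑ i ∈ S, (Equiv.Perm.sign σ : ℝ) *
          ((∏ j ∈ S.erase i, fderiv ℝ (h j) z (s (σ j))) * D2 i z (s (σ l)) (s (σ i))) := by
      intro σ
      rw [mul_left_comm, Finset.mul_sum (a := ((Equiv.Perm.sign σ : ℤ) : ℝ))]
    simp only [e]
    rw [← Finset.mul_sum, Finset.sum_comm]
    refine mul_eq_zero_of_right _ (Finset.sum_eq_zero fun i hi => ?_)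
    have hil : i ≠ l := Finset.ne_of_mem_erase hi
    refine sum_sign_mul_eq_zero hil fun σ => ?_
    simp only [Equiv.Perm.mul_apply, Equiv.swap_apply_left, Equiv.swap_apply_right]
    rw [hsymm]
    congr 1
    refine Finset.prod_congr rfl fun j hj => ?_
    have hji : j ≠ i := Finset.ne_of_mem_erase hj
    have hjl : j ≠ l := Finset.ne_of_mem_erase (Finset.mem_of_mem_erase hj)
    rw [Equiv.swap_apply_of_ne_of_ne hjl hji]
  simp [hzero]

/-- Integration by parts in a Jacobian minor: the derivative of one of the functions is moved to
the test function. -/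
lemma integral_mul_minorOf_fderiv (s : Fin k → E m) {h : Fin k → E m → ℝ}
    (hs : ∀ i, ContDiff ℝ ∞ (h i)) (hc : ∀ i, HasCompactSupport (h i)) {φ : E m → ℝ}
    (hφ : ContDiff ℝ ∞ φ) (l : Fin k) :
    ∫ z, φ z * minorOf s (fun i => fderiv ℝ (h i) z) =
      - ∫ z, h l z * minorOf s (Function.update (fun i => fderiv ℝ (h i) z) l
          (fderiv ℝ φ z)) := by
  have h0 := integral_minorOf_fderiv_eq_zero s
    (h := Function.update h l fun z => φ z * h l z)
    (fun i => by
      by_cases hi : i = l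
      · subst hi; simpa using hφ.mul (hs i)
      · simpa [hi] using hs i)
    (fun i => by
      by_cases hi : i = l
      · subst hi
        rw [Function.update_self]
        exact (hc i).mul_left
      · simpa [hi] using hc i) l
  have e : ∀ z, minorOf s (fun i => fderiv ℝ (Function.update h l (fun z => φ z * h l z) i) z) =
      φ z * minorOf s (fun i => fderiv ℝ (h i) z) +
      h l z * minorOf s (Function.update (fun i => fderiv ℝ (h i) z) l (fderiv ℝ φ z)) := by
    intro z
    have e1 : (fun i => fderiv ℝ (Function.update h l (fun z => φ z * h l z) i) z) =
        Function.update (fun i => fderiv ℝ (h i) z) l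
          (φ z • fderiv ℝ (h l) z + h l z • fderiv ℝ φ z) := by
      funext i
      by_cases hi : i = l
      · subst hi
        simp only [Function.update_self]
        exact fderiv_fun_mul (hφ.differentiable (by simp) z) ((hs i).differentiable (by simp) z)
      · simp [hi]
    rw [e1, minorOf_update_add, minorOf_update_smul, minorOf_update_smul]
    congr 3
    exact Function.update_eq_self l (fun i => fderiv ℝ (h i) z)
  simp only [e] at h0
  have hDcont : ∀ i, Continuous fun z => fderiv ℝ (h i) z := fun i =>
    (hs i).continuous_fderiv (by simp)
  have hm1 : Continuous fun z => minorOf s (fun i => fderiv ℝ (h i) z) :=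
    (continuous_minorOf s).comp (continuous_pi hDcont)
  have hm2 : Continuous fun z =>
      minorOf s (Function.update (fun i => fderiv ℝ (h i) z) l (fderiv ℝ φ z)) :=
    (continuous_minorOf s).comp ((continuous_pi hDcont).update l (hφ.continuous_fderiv (by simp)))
  have hcs : HasCompactSupport fun z => minorOf s (fun i => fderiv ℝ (h i) z) := by
    refine ((hc l).fderiv ℝ).mono fun z hz => ?_
    intro h0
    refine hz ?_
    have : minorOf s (Function.update (fun i => fderiv ℝ (h i) z) l ((0 : ℝ) • 0)) = 0 := by
      rw [minorOf_update_smul, zero_mul]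
    rw [smul_zero, ← h0] at this
    rw [← this]
    exact congrArg (minorOf s) (Function.update_eq_self l (fun i => fderiv ℝ (h i) z)).symm
  have i1 : Integrable fun z => φ z * minorOf s (fun i => fderiv ℝ (h i) z) :=
    (hφ.continuous.mul hm1).integrable_of_hasCompactSupport hcs.mul_left
  have i2 : Integrable fun z => h l z *
      minorOf s (Function.update (fun i => fderiv ℝ (h i) z) l (fderiv ℝ φ z)) :=
    ((hs l).continuous.mul hm2).integrable_of_hasCompactSupport (hc l).mul_right
  rw [integral_add i1 i2] at h0
  linarith

end NullLagrangian

/-! ### Weak continuity of Jacobian minors -/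

section Products

variable {α : Type*} [MeasurableSpace α] {μ : Measure α} {k : ℕ} {p : ℝ}

lemma prod_le_one_add_sum_rpow (hp : 0 < p) (hk : (k : ℝ) ≤ p) (y : Fin k → ℝ≥0∞) :
    ∏ i, y i ≤ 1 + ∑ i, y i ^ p := by
  set S := 1 + ∑ i, y i ^ p with hS
  have h1 : 1 ≤ S := le_self_add
  have hy : ∀ i, y i ≤ S ^ (1 / p) := by
    intro i
    rw [one_div, ENNReal.le_rpow_inv_iff hp]
    exact (Finset.single_le_sum (f := fun i => y i ^ p) (fun _ _ => zero_le)
      (Finset.mem_univ i)).trans le_add_self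
  calc ∏ i, y i ≤ ∏ _i : Fin k, S ^ (1 / p) := Finset.prod_le_prod' fun i _ => hy i
    _ = S ^ ((k : ℝ) / p) := by
        rw [Finset.prod_const, Finset.card_univ, Fintype.card_fin, ← ENNReal.rpow_natCast,
          ← ENNReal.rpow_mul]
        congr 1
        ring
    _ ≤ S ^ (1 : ℝ) := ENNReal.rpow_le_rpow_of_exponent_le h1 ((div_le_one hp).2 hk)
    _ = S := ENNReal.rpow_one S

lemma lintegral_prod_le (hp : 0 < p) (hk : (k : ℝ) ≤ p) {a : Fin k → α → ℝ≥0∞}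
    (ha : ∀ i, AEMeasurable (a i) μ) {C : ℝ≥0∞} (hC : ∀ i, ∫⁻ x, a i x ^ p ∂μ ≤ C) :
    ∫⁻ x, ∏ i, a i x ∂μ ≤ μ univ + k * C := by
  calc ∫⁻ x, ∏ i, a i x ∂μ ≤ ∫⁻ x, (1 + ∑ i, a i x ^ p) ∂μ :=
        lintegral_mono fun x => prod_le_one_add_sum_rpow hp hk _
    _ = μ univ + ∑ i, ∫⁻ x, a i x ^ p ∂μ := by
        rw [lintegral_add_left measurable_const, lintegral_one,
          lintegral_finsetSum' _ fun i _ => (ha i).pow_const p]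
    _ ≤ μ univ + ∑ _i : Fin k, C := by gcongr with i; exact hC i
    _ = _ := by simp

/-- A product of at most `p` factors that are bounded in `L^p` tends to `0` in `L^1` as soon as one
of the factors tends to `0` in `L^p`. -/
lemma tendsto_lintegral_prod [IsFiniteMeasure μ] (hp : 0 < p) (hk : (k : ℝ) ≤ p)
    {a : ℕ → Fin k → α → ℝ≥0∞} (ha : ∀ j i, AEMeasurable (a j i) μ) {C : ℝ≥0∞} (hCt : C ≠ ⊤)
    (hC : ∀ j i, ∫⁻ x, a j i x ^ p ∂μ ≤ C) (l : Fin k)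
    (hl : Tendsto (fun j => ∫⁻ x, a j l x ^ p ∂μ) atTop (𝓝 0)) :
    Tendsto (fun j => ∫⁻ x, ∏ i, a j i x ∂μ) atTop (𝓝 0) := by
  classical
  have key : ∀ η : ℝ≥0, η ≠ 0 → ∀ j, ∫⁻ x, ∏ i, a j i x ∂μ ≤
      η * (μ univ + k * C) + η * ((η⁻¹ : ℝ≥0) : ℝ≥0∞) ^ p * ∫⁻ x, a j l x ^ p ∂μ := by
    intro η hη j
    have hη1 : (η : ℝ≥0∞) * ((η⁻¹ : ℝ≥0) : ℝ≥0∞) = 1 := by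
      rw [← ENNReal.coe_mul, mul_inv_cancel₀ hη, ENNReal.coe_one]
    have hpt : ∀ x, ∏ i, a j i x ≤
        η * (1 + ∑ i, a j i x ^ p) + η * ((η⁻¹ : ℝ≥0) : ℝ≥0∞) ^ p * a j l x ^ p := by
      intro x
      -- the factor `l` is divided by `η` before the products are compared with `p`-th powers
      set y : Fin k → ℝ≥0∞ := Function.update (fun i => a j i x) l
        (((η⁻¹ : ℝ≥0) : ℝ≥0∞) * a j l x) with hy
      have h1 : ∏ i, a j i x = η * ∏ i, y i := by
        rw [hy, Finset.prod_update_of_mem (Finset.mem_univ l), ← mul_assoc, ← mul_assoc, hη1,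
          one_mul, Finset.sdiff_singleton_eq_erase,
          Finset.mul_prod_erase Finset.univ (fun i => a j i x) (Finset.mem_univ l)]
      have h2 : ∑ i, y i ^ p ≤ ∑ i, a j i x ^ p + ((η⁻¹ : ℝ≥0) : ℝ≥0∞) ^ p * a j l x ^ p := by
        rw [← Finset.add_sum_erase _ _ (Finset.mem_univ l), add_comm]
        refine add_le_add ?_ ?_
        · calc ∑ i ∈ Finset.univ.erase l, y i ^ p
              = ∑ i ∈ Finset.univ.erase l, a j i x ^ p := by
                refine Finset.sum_congr rfl fun i hi => ?_
                rw [hy, Function.update_of_ne (Finset.ne_of_mem_erase hi)]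
            _ ≤ _ := Finset.sum_le_sum_of_subset (Finset.erase_subset _ _)
        · rw [hy, Function.update_self, ENNReal.mul_rpow_of_nonneg _ _ hp.le]
      rw [h1]
      calc η * ∏ i, y i ≤ η * (1 + ∑ i, y i ^ p) := by
            gcongr
            exact prod_le_one_add_sum_rpow hp hk y
        _ ≤ η * (1 + (∑ i, a j i x ^ p + ((η⁻¹ : ℝ≥0) : ℝ≥0∞) ^ p * a j l x ^ p)) := by gcongr
        _ = _ := by ring
    have hm : AEMeasurable (fun x => η * (1 + ∑ i, a j i x ^ p)) μ :=
      (aemeasurable_const.add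
        (Finset.aemeasurable_fun_sum _ fun i _ => (ha j i).pow_const p)).const_mul _
    refine (lintegral_mono hpt).trans ?_
    rw [lintegral_add_left' hm, lintegral_const_mul' _ _ ENNReal.coe_ne_top,
      lintegral_const_mul' _ _ (ENNReal.mul_ne_top ENNReal.coe_ne_top
        (ENNReal.rpow_ne_top_of_nonneg hp.le ENNReal.coe_ne_top)),
      lintegral_add_left measurable_const, lintegral_one,
      lintegral_finsetSum' _ fun i _ => (ha j i).pow_const p]
    gcongr
    calc ∑ i, ∫⁻ x, a j i x ^ p ∂μ ≤ ∑ _i : Fin k, C := Finset.sum_le_sum fun i _ => hC j i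
      _ = k * C := by simp
  have hfin : μ univ + k * C ≠ ⊤ := by
    refine ENNReal.add_ne_top.2 ⟨measure_ne_top _ _, ENNReal.mul_ne_top (by simp) hCt⟩
  rw [ENNReal.tendsto_nhds_zero]
  intro ε hε
  have hε2 : 0 < ε / 2 := ENNReal.half_pos hε.ne'
  obtain ⟨η, hη0, hη⟩ : ∃ η : ℝ≥0, η ≠ 0 ∧ η * (μ univ + k * C) ≤ ε / 2 := by
    obtain ⟨η, hη0, hη⟩ := ENNReal.exists_nnreal_pos_mul_lt hfin hε2.ne'
    exact ⟨η, hη0.ne', hη.le⟩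
  have hlim : Tendsto (fun j => η * ((η⁻¹ : ℝ≥0) : ℝ≥0∞) ^ p * ∫⁻ x, a j l x ^ p ∂μ) atTop
      (𝓝 0) := by
    have := ENNReal.Tendsto.const_mul hl (a := η * ((η⁻¹ : ℝ≥0) : ℝ≥0∞) ^ p)
      (Or.inr (ENNReal.mul_ne_top ENNReal.coe_ne_top
        (ENNReal.rpow_ne_top_of_nonneg hp.le ENNReal.coe_ne_top)))
    rwa [mul_zero] at this
  filter_upwards [(ENNReal.tendsto_nhds_zero.1 hlim) _ hε2] with j hj
  refine (key η hη0 j).trans ?_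
  rw [← ENNReal.add_halves ε]
  exact add_le_add hη hj

lemma lintegral_enorm_rpow_eq {F : Type*} [NormedAddCommGroup F] (hp : 0 < p) (f : α → F) :
    ∫⁻ x, ‖f x‖ₑ ^ p ∂μ = eLpNorm f (ENNReal.ofReal p) μ ^ p := by
  rw [eLpNorm_eq_lintegral_rpow_enorm_toReal (by simpa using hp) ENNReal.ofReal_ne_top,
    ENNReal.toReal_ofReal hp.le, ← ENNReal.rpow_mul, one_div_mul_cancel hp.ne', ENNReal.rpow_one]

lemma tendsto_lintegral_enorm_rpow {F : Type*} [NormedAddCommGroup F] (hp : 0 < p)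
    {f : ℕ → α → F} (h : Tendsto (fun j => eLpNorm (f j) (ENNReal.ofReal p) μ) atTop (𝓝 0)) :
    Tendsto (fun j => ∫⁻ x, ‖f j x‖ₑ ^ p ∂μ) atTop (𝓝 0) := by
  simp only [lintegral_enorm_rpow_eq hp]
  simpa [hp] using h.ennrpow_const p

/-- A property of sequences of tuples that is kept when one entry is replaced is kept when all
entries are replaced. -/
lemma replace_induction {T : Type*} {P : (ℕ → Fin k → T) → Prop} {X X' : ℕ → Fin k → T}
    (h0 : P X) (step : ∀ Z l, (∀ j i, Z j i = X j i ∨ Z j i = X' j i) → (∀ j, Z j l = X j l) →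
      P Z → P fun j => Function.update (Z j) l (X' j l)) : P X' := by
  classical
  have key : ∀ t : Finset (Fin k), P fun j i => if i ∈ t then X' j i else X j i := by
    intro t
    induction t using Finset.induction_on with
    | empty => simpa using h0
    | insert l t hl ih =>
      have h1 := step _ l (fun j i => by by_cases hi : i ∈ t <;> simp [hi]) (by simp [hl]) ih
      convert h1 using 3 with j i
      by_cases hi : i = l
      · subst hi; simp
      · simp [hi]
  simpa using key Finset.univ

end Products

section MinorConvergence

variable {m k : ℕ} {p : ℝ}

lemma exists_enorm_minorOf_le (s : Fin k → E m) :
    ∃ C : ℝ≥0, ∀ ξ, ‖minorOf s ξ‖ₑ ≤ C * ∏ i, ‖ξ i‖ₑ := by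
  obtain ⟨C, hC, h⟩ := exists_abs_minorOf_le s
  refine ⟨C.toNNReal, fun ξ => ?_⟩
  have h1 : ∏ i, ‖ξ i‖ₑ = ENNReal.ofReal (∏ i, ‖ξ i‖) := by
    rw [ENNReal.ofReal_prod_of_nonneg fun i _ => norm_nonneg _]
    simp
  rw [h1, ← ofReal_norm, Real.norm_eq_abs]
  change _ ≤ ENNReal.ofReal C * _
  rw [← ENNReal.ofReal_mul hC]
  exact ENNReal.ofReal_le_ofReal (h ξ)

variable {μ : Measure (E m)}

lemma aestronglyMeasurable_minorOf (s : Fin k → E m) {G : Fin k → E m → E m →L[ℝ] ℝ}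
    (hG : ∀ i, AEStronglyMeasurable (G i) μ) :
    AEStronglyMeasurable (fun z => minorOf s fun i => G i z) μ :=
  (continuous_minorOf s).comp_aestronglyMeasurable
    (aemeasurable_pi_lambda _ fun i => (hG i).aemeasurable).aestronglyMeasurable

lemma integrable_minorOf [IsFiniteMeasure μ] (hp : 0 < p) (hk : (k : ℝ) ≤ p) (s : Fin k → E m)
    {G : Fin k → E m → E m →L[ℝ] ℝ} (hG : ∀ i, MemLp (G i) (ENNReal.ofReal p) μ) :
    Integrable (fun z => minorOf s fun i => G i z) μ := by
  refine ⟨aestronglyMeasurable_minorOf s fun i => (hG i).aestronglyMeasurable, ?_⟩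
  obtain ⟨C, hC⟩ := exists_enorm_minorOf_le s
  have h1 := lintegral_prod_le (μ := μ) hp hk (a := fun i z => ‖G i z‖ₑ)
    (fun i => (hG i).aestronglyMeasurable.enorm) (C := ∑ i, ∫⁻ z, ‖G i z‖ₑ ^ p ∂μ)
    (fun i => Finset.single_le_sum (f := fun i => ∫⁻ z, ‖G i z‖ₑ ^ p ∂μ) (fun _ _ => zero_le)
      (Finset.mem_univ i))
  refine lt_of_le_of_lt (lintegral_mono fun z => hC _) ?_
  rw [lintegral_const_mul' _ _ ENNReal.coe_ne_top]
  refine ENNReal.mul_lt_top ENNReal.coe_lt_top (lt_of_le_of_lt h1 ?_)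
  refine ENNReal.add_lt_top.2 ⟨measure_lt_top _ _, ENNReal.mul_lt_top (by simp) ?_⟩
  refine ENNReal.sum_lt_top.2 fun i _ => ?_
  rw [lintegral_enorm_rpow_eq hp]
  exact ENNReal.rpow_lt_top_of_nonneg hp.le (hG i).eLpNorm_ne_top

/-- Minors of orders at most `p` depend continuously, in `L^1`, on their rows in `L^p`. -/
lemma tendsto_lintegral_minorOf_sub [IsFiniteMeasure μ] (hp : 0 < p) (hk : (k : ℝ) ≤ p)
    (s : Fin k → E m) {G G' : ℕ → Fin k → E m → E m →L[ℝ] ℝ}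
    (hG : ∀ j i, AEStronglyMeasurable (G j i) μ) (hG' : ∀ j i, AEStronglyMeasurable (G' j i) μ)
    {C : ℝ≥0∞} (hCt : C ≠ ⊤) (hC : ∀ j i, eLpNorm (G j i) (ENNReal.ofReal p) μ ≤ C)
    (hC' : ∀ j i, eLpNorm (G' j i) (ENNReal.ofReal p) μ ≤ C)
    (hd : ∀ i, Tendsto (fun j => eLpNorm (G j i - G' j i) (ENNReal.ofReal p) μ) atTop (𝓝 0)) :
    Tendsto (fun j => ∫⁻ z, ‖minorOf s (fun i => G j i z) - minorOf s (fun i => G' j i z)‖ₑ ∂μ)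
      atTop (𝓝 0) := by
  by_cases hk0 : k = 0
  · subst hk0
    simp [minorOf]
  have hp1 : 1 ≤ ENNReal.ofReal p := by
    rw [ENNReal.one_le_ofReal]
    have : (1 : ℝ) ≤ k := by exact_mod_cast Nat.one_le_iff_ne_zero.2 hk0
    linarith
  obtain ⟨D, hD⟩ := exists_enorm_minorOf_le s
  refine replace_induction (X := G) (X' := G')
    (P := fun Z : ℕ → Fin k → E m → E m →L[ℝ] ℝ => Tendsto (fun j =>
      ∫⁻ z, ‖minorOf s (fun i => G j i z) - minorOf s (fun i => Z j i z)‖ₑ ∂μ) atTop (𝓝 0))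
    (by simp) fun Z l hZ hZl ih => ?_
  have hZm : ∀ j i, AEStronglyMeasurable (Z j i) μ := by
    intro j i
    rcases hZ j i with h | h <;> rw [h]
    exacts [hG j i, hG' j i]
  have hZC : ∀ j i, eLpNorm (Z j i) (ENNReal.ofReal p) μ ≤ C := by
    intro j i
    rcases hZ j i with h | h <;> rw [h]
    exacts [hC j i, hC' j i]
  set W : ℕ → Fin k → E m → E m →L[ℝ] ℝ := fun j =>
    Function.update (Z j) l (G j l - G' j l) with hW
  have hWm : ∀ j i, AEStronglyMeasurable (W j i) μ := by
    intro j i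
    by_cases hi : i = l
    · subst hi; simpa [hW] using (hG j i).sub (hG' j i)
    · simpa [hW, hi] using hZm j i
  have hWC : ∀ j i, eLpNorm (W j i) (ENNReal.ofReal p) μ ≤ C + C := by
    intro j i
    by_cases hi : i = l
    · subst hi
      simpa [hW] using (eLpNorm_sub_le (hG j i) (hG' j i) hp1).trans
        (add_le_add (hC j i) (hC' j i))
    · simpa [hW, hi] using (hZC j i).trans le_self_add
  have hone : Tendsto (fun j => ∫⁻ z, ∏ i, ‖W j i z‖ₑ ∂μ) atTop (𝓝 0) := by
    refine tendsto_lintegral_prod hp hk (fun j i => (hWm j i).enorm) (C := (C + C) ^ p)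
      (ENNReal.rpow_ne_top_of_nonneg hp.le (ENNReal.add_ne_top.2 ⟨hCt, hCt⟩)) (fun j i => ?_) l ?_
    · rw [lintegral_enorm_rpow_eq hp]
      exact ENNReal.rpow_le_rpow (hWC j i) hp.le
    · refine tendsto_lintegral_enorm_rpow hp ?_
      simpa [hW] using hd l
  have hlim : Tendsto (fun j => (∫⁻ z, ‖minorOf s (fun i => G j i z) -
      minorOf s (fun i => Z j i z)‖ₑ ∂μ) + D * ∫⁻ z, ∏ i, ‖W j i z‖ₑ ∂μ) atTop (𝓝 0) := by
    simpa using ih.add (ENNReal.Tendsto.const_mul hone (Or.inr ENNReal.coe_ne_top))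
  refine tendsto_of_tendsto_of_tendsto_of_le_of_le tendsto_const_nhds hlim
    (fun _ => zero_le) fun j => ?_
  dsimp only
  rw [← lintegral_const_mul' _ _ ENNReal.coe_ne_top, ← lintegral_add_left']
  · refine lintegral_mono fun z => ?_
    have e1 : (fun i => Function.update (Z j) l (G' j l) i z) =
        Function.update (fun i => Z j i z) l (G' j l z) := by
      funext i
      by_cases hi : i = l
      · subst hi; simp
      · simp [hi]
    have e2 : minorOf s (fun i => Z j i z) =
        minorOf s (Function.update (fun i => Z j i z) l (G j l z)) := by
      have : Function.update (fun i => Z j i z) l (G j l z) = fun i => Z j i z := by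
        rw [← hZl j]
        exact Function.update_eq_self l (fun i => Z j i z)
      rw [this]
    have e3 : (fun i => W j i z) = Function.update (fun i => Z j i z) l (G j l z - G' j l z) := by
      funext i
      by_cases hi : i = l
      · subst hi; simp [hW]
      · simp [hW, hi]
    have e4 : minorOf s (fun i => Z j i z) -
        minorOf s (fun i => Function.update (Z j) l (G' j l) i z) = minorOf s fun i => W j i z := by
      rw [e1, e2, e3, minorOf_update_sub]
    calc _ = ‖(minorOf s (fun i => G j i z) - minorOf s (fun i => Z j i z)) +
          minorOf s fun i => W j i z‖ₑ := by rw [← e4, sub_add_sub_cancel]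
      _ ≤ _ := (enorm_add_le _ _).trans (add_le_add le_rfl (hD _))
  · exact ((aestronglyMeasurable_minorOf s (hG j)).sub
      (aestronglyMeasurable_minorOf s (hZm j))).enorm

lemma tendsto_integral_mul_sub_of_lintegral {φ : E m → ℝ} (hφ : Continuous φ)
    (hφc : HasCompactSupport φ) {f f' : ℕ → E m → ℝ}
    (hf : ∀ j, IntegrableOn (f j) (tsupport φ)) (hf' : ∀ j, IntegrableOn (f' j) (tsupport φ))
    (h : Tendsto (fun j => ∫⁻ z in tsupport φ, ‖f j z - f' j z‖ₑ) atTop (𝓝 0)) :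
    Tendsto (fun j => (∫ z, φ z * f j z) - ∫ z, φ z * f' j z) atTop (𝓝 0) := by
  obtain ⟨M, hM⟩ := hφc.exists_bound_of_continuous hφ
  have hres : ∀ f : E m → ℝ, ∫ z, φ z * f z = ∫ z in tsupport φ, φ z * f z := by
    intro f
    refine (setIntegral_eq_integral_of_forall_compl_eq_zero fun z hz => ?_).symm
    rw [image_eq_zero_of_notMem_tsupport hz, zero_mul]
  have hint : ∀ {f : E m → ℝ}, IntegrableOn f (tsupport φ) →
      IntegrableOn (fun z => φ z * f z) (tsupport φ) := fun hf =>
    Integrable.bdd_mul hf hφ.aestronglyMeasurable (ae_of_all _ hM)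
  have h2 : Tendsto (fun j => ENNReal.ofReal M * ∫⁻ z in tsupport φ, ‖f j z - f' j z‖ₑ) atTop
      (𝓝 0) := by
    simpa using ENNReal.Tendsto.const_mul h (Or.inr ENNReal.ofReal_ne_top)
  rw [tendsto_zero_iff_enorm_tendsto_zero]
  refine tendsto_of_tendsto_of_tendsto_of_le_of_le tendsto_const_nhds h2
    (fun _ => zero_le) fun j => ?_
  dsimp only
  rw [hres, hres, ← integral_sub (hint (hf j)) (hint (hf' j)),
    ← lintegral_const_mul' _ _ ENNReal.ofReal_ne_top]
  refine (enorm_integral_le_lintegral_enorm _).trans (lintegral_mono fun z => ?_)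
  rw [← mul_sub, enorm_mul]
  gcongr
  rw [← ofReal_norm]
  exact ENNReal.ofReal_le_ofReal (hM _)

/-- Two bounded sequences of smooth maps at vanishing `L^p` distance have the same minors in the
limit, against every test function. -/
lemma tendsto_integral_minorOf_fderiv_sub (hp : 1 ≤ p) (hk : (k : ℝ) ≤ p) (s : Fin k → E m)
    {h h' : ℕ → Fin k → E m → ℝ}
    (hs : ∀ j i, ContDiff ℝ ∞ (h j i)) (hc : ∀ j i, HasCompactSupport (h j i))
    (hs' : ∀ j i, ContDiff ℝ ∞ (h' j i)) (hc' : ∀ j i, HasCompactSupport (h' j i))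
    {C : ℝ≥0∞} (hCt : C ≠ ⊤)
    (hC : ∀ j i, eLpNorm (fderiv ℝ (h j i)) (ENNReal.ofReal p) volume ≤ C)
    (hC' : ∀ j i, eLpNorm (fderiv ℝ (h' j i)) (ENNReal.ofReal p) volume ≤ C)
    (hd : ∀ i, Tendsto (fun j => eLpNorm (h j i - h' j i) (ENNReal.ofReal p) volume) atTop (𝓝 0))
    {φ : E m → ℝ} (hφ : ContDiff ℝ ∞ φ) (hφc : HasCompactSupport φ) :
    Tendsto (fun j => (∫ z, φ z * minorOf s (fun i => fderiv ℝ (h j i) z)) -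
      ∫ z, φ z * minorOf s (fun i => fderiv ℝ (h' j i) z)) atTop (𝓝 0) := by
  have hp0 : 0 < p := by linarith
  obtain ⟨D, hD⟩ := exists_enorm_minorOf_le s
  obtain ⟨M, hM⟩ := (hφc.fderiv ℝ).exists_bound_of_continuous (hφ.continuous_fderiv (by simp))
  have hcm : ∀ {f : Fin k → E m → ℝ}, (∀ i, ContDiff ℝ ∞ (f i)) →
      Continuous fun z => minorOf s fun i => fderiv ℝ (f i) z := fun hf =>
    (continuous_minorOf s).comp (continuous_pi fun i => (hf i).continuous_fderiv (by simp))
  have hint : ∀ {f : Fin k → E m → ℝ}, (∀ i, ContDiff ℝ ∞ (f i)) →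
      Integrable fun z => φ z * minorOf s fun i => fderiv ℝ (f i) z := fun hf =>
    (hφ.continuous.mul (hcm hf)).integrable_of_hasCompactSupport hφc.mul_right
  set K := tsupport φ with hK
  have : IsFiniteMeasure ((volume : Measure (E m)).restrict K) :=
    ⟨by rw [Measure.restrict_apply_univ]; exact hφc.isCompact.measure_lt_top⟩
  refine replace_induction (X := h) (X' := h') (P := fun Z : ℕ → Fin k → E m → ℝ =>
    Tendsto (fun j => (∫ z, φ z * minorOf s (fun i => fderiv ℝ (h j i) z)) -
      ∫ z, φ z * minorOf s (fun i => fderiv ℝ (Z j i) z)) atTop (𝓝 0))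
    (by simp) fun Z l hZ hZl ih => ?_
  have hZs : ∀ j i, ContDiff ℝ ∞ (Z j i) := by
    intro j i
    rcases hZ j i with h | h <;> rw [h]
    exacts [hs j i, hs' j i]
  have hZc : ∀ j i, HasCompactSupport (Z j i) := by
    intro j i
    rcases hZ j i with h | h <;> rw [h]
    exacts [hc j i, hc' j i]
  have hZC : ∀ j i, eLpNorm (fderiv ℝ (Z j i)) (ENNReal.ofReal p) volume ≤ C := by
    intro j i
    rcases hZ j i with h | h <;> rw [h]
    exacts [hC j i, hC' j i]
  -- the difference of the two integrals is the minor of the family with entry `l` replaced by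
  -- `h j l - h' j l`, and the derivative of this entry is moved to the test function
  set W : ℕ → Fin k → E m → ℝ := fun j => Function.update (Z j) l (h j l - h' j l) with hW
  have hWs : ∀ j i, ContDiff ℝ ∞ (W j i) := by
    intro j i
    by_cases hi : i = l
    · subst hi
      simp only [hW, Function.update_self]
      exact (hs j i).sub (hs' j i)
    · simpa [hW, hi] using hZs j i
  have hWc : ∀ j i, HasCompactSupport (W j i) := by
    intro j i
    by_cases hi : i = l
    · subst hi; simpa [hW] using (hc j i).sub (hc' j i)
    · simpa [hW, hi] using hZc j i
  have hUs : ∀ j i, ContDiff ℝ ∞ (Function.update (Z j) l (h' j l) i) := by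
    intro j i
    by_cases hi : i = l
    · subst hi; simpa using hs' j i
    · simpa [hi] using hZs j i
  have ediff : ∀ j, (∫ z, φ z * minorOf s (fun i => fderiv ℝ (Z j i) z)) -
      ∫ z, φ z * minorOf s (fun i => fderiv ℝ (Function.update (Z j) l (h' j l) i) z) =
      - ∫ z, (h j l - h' j l) z *
        minorOf s (Function.update (fun i => fderiv ℝ (W j i) z) l (fderiv ℝ φ z)) := by
    intro j
    have h1 := integral_mul_minorOf_fderiv s (hWs j) (hWc j) hφ l
    have h2 : W j l = h j l - h' j l := by simp [hW]
    rw [h2] at h1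
    rw [← h1, ← integral_sub (hint (hZs j)) (hint (hUs j))]
    refine integral_congr_ae (ae_of_all _ fun z => ?_)
    have e1 : (fun i => fderiv ℝ (Function.update (Z j) l (h' j l) i) z) =
        Function.update (fun i => fderiv ℝ (Z j i) z) l (fderiv ℝ (h' j l) z) := by
      funext i
      by_cases hi : i = l
      · subst hi; simp
      · simp [hi]
    have e2 : minorOf s (fun i => fderiv ℝ (Z j i) z) =
        minorOf s (Function.update (fun i => fderiv ℝ (Z j i) z) l (fderiv ℝ (h j l) z)) := by
      have : Function.update (fun i => fderiv ℝ (Z j i) z) l (fderiv ℝ (h j l) z) =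
          fun i => fderiv ℝ (Z j i) z := by
        rw [← hZl j]
        exact Function.update_eq_self l (fun i => fderiv ℝ (Z j i) z)
      rw [this]
    have e3 : (fun i => fderiv ℝ (W j i) z) = Function.update (fun i => fderiv ℝ (Z j i) z) l
        (fderiv ℝ (h j l) z - fderiv ℝ (h' j l) z) := by
      funext i
      by_cases hi : i = l
      · subst hi
        simp only [hW, Function.update_self]
        exact fderiv_sub ((hs j i).differentiable (by simp) z)
          ((hs' j i).differentiable (by simp) z)
      · simp [hW, hi]
    dsimp only
    rw [e1, e2, e3, minorOf_update_sub, mul_sub]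
  set A : ℕ → Fin k → E m → ℝ≥0∞ := fun j => Function.update
    (fun i z => ‖fderiv ℝ (Z j i) z‖ₑ) l (fun z => ‖(h j l - h' j l) z‖ₑ) with hA
  have hAm : ∀ j i, Measurable (A j i) := by
    intro j i
    by_cases hi : i = l
    · subst hi
      simpa [hA] using ((hs j i).continuous.sub (hs' j i).continuous).enorm.measurable
    · simpa [hA, hi] using ((hZs j i).continuous_fderiv (by simp)).enorm.measurable
  have hAl : Tendsto (fun j => ∫⁻ z in K, A j l z ^ p) atTop (𝓝 0) := by
    have h1 := tendsto_lintegral_enorm_rpow hp0 (hd l)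
    refine tendsto_of_tendsto_of_tendsto_of_le_of_le tendsto_const_nhds h1
      (fun _ => zero_le) fun j => ?_
    simpa [hA] using setLIntegral_le_lintegral K fun z => ‖h j l z - h' j l z‖ₑ ^ p
  -- the entry `l` is bounded in `L^p` only from some index on, so the sequence is shifted
  obtain ⟨N, hN⟩ : ∃ N, ∀ j ≥ N, ∫⁻ z in K, A j l z ^ p ≤ 1 :=
    eventually_atTop.1 ((ENNReal.tendsto_nhds_zero.1 hAl) 1 one_pos)
  have hAC : ∀ j i, ∫⁻ z in K, A (j + N) i z ^ p ≤ C ^ p + 1 := by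
    intro j i
    by_cases hi : i = l
    · subst hi
      exact (hN (j + N) (Nat.le_add_left _ _)).trans le_add_self
    · refine le_trans ?_ le_self_add
      simp only [hA, Function.update_of_ne hi]
      refine (setLIntegral_le_lintegral K _).trans ?_
      rw [lintegral_enorm_rpow_eq hp0]
      exact ENNReal.rpow_le_rpow (hZC _ i) hp0.le
  have hprod : Tendsto (fun j => ∫⁻ z in K, ∏ i, A j i z) atTop (𝓝 0) := by
    rw [← tendsto_add_atTop_iff_nat N]
    exact tendsto_lintegral_prod hp0 hk (fun j i => (hAm (j + N) i).aemeasurable)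
      (ENNReal.add_ne_top.2 ⟨ENNReal.rpow_ne_top_of_nonneg hp0.le hCt, ENNReal.one_ne_top⟩) hAC l
      ((tendsto_add_atTop_iff_nat N).2 hAl)
  have hlast : Tendsto (fun j => (∫ z, φ z * minorOf s (fun i => fderiv ℝ (Z j i) z)) -
      ∫ z, φ z * minorOf s (fun i => fderiv ℝ (Function.update (Z j) l (h' j l) i) z)) atTop
      (𝓝 0) := by
    have h2 : Tendsto (fun j => (D * ENNReal.ofReal M) * ∫⁻ z in K, ∏ i, A j i z) atTop
        (𝓝 0) := by
      simpa using ENNReal.Tendsto.const_mul hprod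
        (Or.inr (ENNReal.mul_ne_top ENNReal.coe_ne_top ENNReal.ofReal_ne_top))
    rw [tendsto_zero_iff_enorm_tendsto_zero]
    refine tendsto_of_tendsto_of_tendsto_of_le_of_le tendsto_const_nhds h2
      (fun _ => zero_le) fun j => ?_
    dsimp only
    rw [ediff, enorm_neg, ← lintegral_const_mul' _ _
      (ENNReal.mul_ne_top ENNReal.coe_ne_top ENNReal.ofReal_ne_top)]
    have hres : ∫ z, (h j l - h' j l) z *
        minorOf s (Function.update (fun i => fderiv ℝ (W j i) z) l (fderiv ℝ φ z)) =
        ∫ z in K, (h j l - h' j l) z *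
        minorOf s (Function.update (fun i => fderiv ℝ (W j i) z) l (fderiv ℝ φ z)) := by
      refine (setIntegral_eq_integral_of_forall_compl_eq_zero fun z hz => ?_).symm
      have h0 : fderiv ℝ φ z = (0 : ℝ) • 0 := by
        rw [zero_smul]
        exact image_eq_zero_of_notMem_tsupport fun h => hz (tsupport_fderiv_subset ℝ h)
      rw [h0, minorOf_update_smul, zero_mul, mul_zero]
    rw [hres]
    refine (enorm_integral_le_lintegral_enorm _).trans (lintegral_mono fun z => ?_)
    rw [enorm_mul]
    have h3 := hD (Function.update (fun i => fderiv ℝ (W j i) z) l (fderiv ℝ φ z))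
    have h4 : ∏ i, ‖Function.update (fun i => fderiv ℝ (W j i) z) l (fderiv ℝ φ z) i‖ₑ =
        ‖fderiv ℝ φ z‖ₑ * ∏ i ∈ Finset.univ.erase l, ‖fderiv ℝ (Z j i) z‖ₑ := by
      rw [← Finset.mul_prod_erase Finset.univ _ (Finset.mem_univ l), Function.update_self]
      congr 1
      refine Finset.prod_congr rfl fun i hi => ?_
      have hi' := Finset.ne_of_mem_erase hi
      simp [hW, hi']
    have h5 : ∏ i, A j i z = ‖(h j l - h' j l) z‖ₑ *
        ∏ i ∈ Finset.univ.erase l, ‖fderiv ℝ (Z j i) z‖ₑ := by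
      rw [← Finset.mul_prod_erase Finset.univ _ (Finset.mem_univ l)]
      congr 1
      · simp [hA]
      · refine Finset.prod_congr rfl fun i hi => ?_
        simp [hA, Finset.ne_of_mem_erase hi]
    rw [h4] at h3
    rw [h5]
    have h6 : ‖fderiv ℝ φ z‖ₑ ≤ ENNReal.ofReal M := by
      rw [← ofReal_norm]
      exact ENNReal.ofReal_le_ofReal (hM z)
    calc _ ≤ ‖(h j l - h' j l) z‖ₑ * (D * (ENNReal.ofReal M *
          ∏ i ∈ Finset.univ.erase l, ‖fderiv ℝ (Z j i) z‖ₑ)) := by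
          gcongr
          exact h3.trans (by gcongr)
      _ = _ := by ring
  have := ih.add hlast
  simpa using this

/-- Weak continuity of minors: if maps are bounded in `W^{1,p}` and converge strongly in `L^p`,
then their minors of orders at most `p` converge against test functions. -/
theorem tendsto_integral_minorOf (hp : 1 ≤ p) (hk : (k : ℝ) ≤ p) (s : Fin k → E m)
    {w : ℕ → Fin k → E m → ℝ} {g : ℕ → Fin k → E m → E m →L[ℝ] ℝ}
    {w' : Fin k → E m → ℝ} {g' : Fin k → E m → E m →L[ℝ] ℝ}
    (hw : ∀ j i, MemLp (w j i) (ENNReal.ofReal p) volume)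
    (hg : ∀ j i, MemLp (g j i) (ENNReal.ofReal p) volume)
    (hw' : ∀ i, MemLp (w' i) (ENNReal.ofReal p) volume)
    (hg' : ∀ i, MemLp (g' i) (ENNReal.ofReal p) volume)
    (hwg : ∀ j i, HasWeakGradient (w j i) (g j i)) (hwg' : ∀ i, HasWeakGradient (w' i) (g' i))
    (hc : ∀ j i, HasCompactSupport (w j i)) (hc' : ∀ i, HasCompactSupport (w' i))
    {C : ℝ≥0∞} (hCt : C ≠ ⊤) (hC : ∀ j i, eLpNorm (g j i) (ENNReal.ofReal p) volume ≤ C)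
    (hd : ∀ i, Tendsto (fun j => eLpNorm (w j i - w' i) (ENNReal.ofReal p) volume) atTop (𝓝 0))
    {φ : E m → ℝ} (hφ : ContDiff ℝ ∞ φ) (hφc : HasCompactSupport φ) :
    Tendsto (fun j => ∫ z, φ z * minorOf s (fun i => g j i z)) atTop
      (𝓝 (∫ z, φ z * minorOf s (fun i => g' i z))) := by
  have hp0 : 0 < p := by linarith
  have hp1 : 1 ≤ ENNReal.ofReal p := by simpa using hp
  have hN : ∀ j : ℕ, ∃ n : ℕ, ∀ i,
      (eLpNorm (mollify n (w j i) - w j i) (ENNReal.ofReal p) volume ≤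
        ENNReal.ofReal (1 / ((j : ℝ) + 1)) ∧
      eLpNorm (mollify n (g j i) - g j i) (ENNReal.ofReal p) volume ≤
        ENNReal.ofReal (1 / ((j : ℝ) + 1))) ∧
      (eLpNorm (mollify n (w' i) - w' i) (ENNReal.ofReal p) volume ≤
        ENNReal.ofReal (1 / ((j : ℝ) + 1)) ∧
      eLpNorm (mollify n (g' i) - g' i) (ENNReal.ofReal p) volume ≤
        ENNReal.ofReal (1 / ((j : ℝ) + 1))) := by
    intro j
    have hpos : 0 < ENNReal.ofReal (1 / ((j : ℝ) + 1)) := ENNReal.ofReal_pos.2 (by positivity)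
    refine (eventually_all.2 fun i => ?_ : ∀ᶠ n in atTop, _).exists
    exact (((ENNReal.tendsto_nhds_zero.1 (tendsto_eLpNorm_mollify_sub hp (hw j i))) _ hpos).and
      ((ENNReal.tendsto_nhds_zero.1 (tendsto_eLpNorm_mollify_sub hp (hg j i))) _ hpos)).and
      (((ENNReal.tendsto_nhds_zero.1 (tendsto_eLpNorm_mollify_sub hp (hw' i))) _ hpos).and
      ((ENNReal.tendsto_nhds_zero.1 (tendsto_eLpNorm_mollify_sub hp (hg' i))) _ hpos))
  choose N hN using hN
  have hsmall : Tendsto (fun n : ℕ => ENNReal.ofReal (1 / ((n : ℝ) + 1))) atTop (𝓝 0) := by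
    simpa using ENNReal.tendsto_ofReal (tendsto_one_div_add_atTop_nhds_zero_nat (𝕜 := ℝ))
  have hle1 : ∀ j : ℕ, ENNReal.ofReal (1 / ((j : ℝ) + 1)) ≤ 1 := by
    intro j
    rw [ENNReal.ofReal_le_one, div_le_one (by positivity)]
    linarith [(Nat.cast_nonneg j : (0 : ℝ) ≤ j)]
  set C' : ℝ≥0∞ := 1 + (C + ∑ i, eLpNorm (g' i) (ENNReal.ofReal p) volume) with hC'
  have hC't : C' ≠ ⊤ := by
    refine ENNReal.add_ne_top.2 ⟨ENNReal.one_ne_top, ENNReal.add_ne_top.2 ⟨hCt, ?_⟩⟩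
    exact ENNReal.sum_ne_top.2 fun i _ => (hg' i).eLpNorm_ne_top
  have hgC : ∀ j i, eLpNorm (g j i) (ENNReal.ofReal p) volume ≤ C' := fun j i =>
    ((hC j i).trans le_self_add).trans le_add_self
  have hg'C : ∀ i, eLpNorm (g' i) (ENNReal.ofReal p) volume ≤
      C + ∑ i, eLpNorm (g' i) (ENNReal.ofReal p) volume := fun i =>
    (Finset.single_le_sum (f := fun i => eLpNorm (g' i) (ENNReal.ofReal p) volume)
      (fun _ _ => zero_le) (Finset.mem_univ i)).trans le_add_self
  have hwl := fun j i => (hw j i).locallyIntegrable hp1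
  have hgl := fun j i => (hg j i).locallyIntegrable hp1
  have hwl' := fun i => (hw' i).locallyIntegrable hp1
  have hgl' := fun i => (hg' i).locallyIntegrable hp1
  have hms := fun j i n => (contDiff_mollify (hgl j i) n).continuous.aestronglyMeasurable
    (μ := (volume : Measure (E m)))
  have hms' := fun i n => (contDiff_mollify (hgl' i) n).continuous.aestronglyMeasurable
    (μ := (volume : Measure (E m)))
  have hbound : ∀ {f F : E m → E m →L[ℝ] ℝ} {B : ℝ≥0∞}, AEStronglyMeasurable f volume →
      AEStronglyMeasurable F volume → eLpNorm (F - f) (ENNReal.ofReal p) volume ≤ 1 →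
      eLpNorm f (ENNReal.ofReal p) volume ≤ B → eLpNorm F (ENNReal.ofReal p) volume ≤ 1 + B := by
    intro f F B hf hF h1 h2
    have h3 := eLpNorm_add_le (hF.sub hf) hf hp1
    rw [sub_add_cancel] at h3
    exact h3.trans (add_le_add h1 h2)
  have hMC : ∀ j i, eLpNorm (mollify (N j) (g j i)) (ENNReal.ofReal p) volume ≤ C' := fun j i =>
    hbound (hg j i).aestronglyMeasurable (hms j i _) ((hN j i).1.2.trans (hle1 j))
      ((hC j i).trans le_self_add)
  have hMC' : ∀ j i, eLpNorm (mollify (N j) (g' i)) (ENNReal.ofReal p) volume ≤ C' := fun j i =>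
    hbound (hg' i).aestronglyMeasurable (hms' i _) ((hN j i).2.2.trans (hle1 j)) (hg'C i)
  set K := tsupport φ with hK
  have : IsFiniteMeasure ((volume : Measure (E m)).restrict K) :=
    ⟨by rw [Measure.restrict_apply_univ]; exact hφc.isCompact.measure_lt_top⟩
  have hr : ∀ {f : E m → E m →L[ℝ] ℝ} {B : ℝ≥0∞}, eLpNorm f (ENNReal.ofReal p) volume ≤ B →
      eLpNorm f (ENNReal.ofReal p) (volume.restrict K) ≤ B := fun h =>
    (eLpNorm_mono_measure _ Measure.restrict_le_self).trans h
  have hmem : ∀ {f : E m → E m →L[ℝ] ℝ}, AEStronglyMeasurable f volume →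
      eLpNorm f (ENNReal.ofReal p) volume ≤ C' →
      MemLp f (ENNReal.ofReal p) (volume.restrict K) := fun h1 h2 =>
    ⟨h1.restrict, lt_of_le_of_lt (hr h2) hC't.lt_top⟩
  -- each sequence of weak gradients is compared with its mollifications
  have step1 : Tendsto (fun j => (∫ z, φ z * minorOf s (fun i => g j i z)) -
      ∫ z, φ z * minorOf s (fun i => mollify (N j) (g j i) z)) atTop (𝓝 0) := by
    refine tendsto_integral_mul_sub_of_lintegral hφ.continuous hφc
      (fun j => integrable_minorOf hp0 hk s fun i => hmem (hg j i).aestronglyMeasurable (hgC j i))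
      (fun j => integrable_minorOf hp0 hk s fun i => hmem (hms j i _) (hMC j i))
      (tendsto_lintegral_minorOf_sub hp0 hk s
        (fun j i => (hg j i).aestronglyMeasurable.restrict) (fun j i => (hms j i _).restrict) hC't
        (fun j i => hr (hgC j i)) (fun j i => hr (hMC j i)) fun i => ?_)
    refine tendsto_of_tendsto_of_tendsto_of_le_of_le tendsto_const_nhds hsmall
      (fun _ => zero_le) fun j => hr ?_
    rw [eLpNorm_sub_comm]
    exact (hN j i).1.2
  have step3 : Tendsto (fun j => (∫ z, φ z * minorOf s (fun i => g' i z)) -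
      ∫ z, φ z * minorOf s (fun i => mollify (N j) (g' i) z)) atTop (𝓝 0) := by
    refine tendsto_integral_mul_sub_of_lintegral hφ.continuous hφc
      (fun j => integrable_minorOf hp0 hk s fun i =>
        hmem (hg' i).aestronglyMeasurable ((hg'C i).trans le_add_self))
      (fun j => integrable_minorOf hp0 hk s fun i => hmem (hms' i _) (hMC' j i))
      (tendsto_lintegral_minorOf_sub hp0 hk s (G := fun _ => g')
        (fun j i => (hg' i).aestronglyMeasurable.restrict) (fun j i => (hms' i _).restrict) hC't
        (fun j i => hr ((hg'C i).trans le_add_self)) (fun j i => hr (hMC' j i)) fun i => ?_)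
    refine tendsto_of_tendsto_of_tendsto_of_le_of_le tendsto_const_nhds hsmall
      (fun _ => zero_le) fun j => hr ?_
    rw [eLpNorm_sub_comm]
    exact (hN j i).2.2
  have step2 : Tendsto (fun j => (∫ z, φ z * minorOf s (fun i => mollify (N j) (g j i) z)) -
      ∫ z, φ z * minorOf s (fun i => mollify (N j) (g' i) z)) atTop (𝓝 0) := by
    have e : ∀ j i, fderiv ℝ (mollify (N j) (w j i)) = mollify (N j) (g j i) := fun j i =>
      (hwg j i).fderiv_mollify (hwl j i) (hgl j i) _
    have e' : ∀ j i, fderiv ℝ (mollify (N j) (w' i)) = mollify (N j) (g' i) := fun j i =>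
      (hwg' i).fderiv_mollify (hwl' i) (hgl' i) _
    have h1 := tendsto_integral_minorOf_fderiv_sub hp hk s
      (h := fun j i => mollify (N j) (w j i)) (h' := fun j i => mollify (N j) (w' i))
      (fun j i => contDiff_mollify (hwl j i) _) (fun j i => hasCompactSupport_mollify (hc j i) _)
      (fun j i => contDiff_mollify (hwl' i) _) (fun j i => hasCompactSupport_mollify (hc' i) _)
      hC't (fun j i => by rw [e]; exact hMC j i) (fun j i => by rw [e']; exact hMC' j i)
      (fun i => ?_) hφ hφc
    · simpa only [e, e'] using h1
    · have h2 : Tendsto (fun j : ℕ => ENNReal.ofReal (1 / ((j : ℝ) + 1)) +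
          eLpNorm (w j i - w' i) (ENNReal.ofReal p) volume +
          ENNReal.ofReal (1 / ((j : ℝ) + 1))) atTop (𝓝 0) := by
        have := (hsmall.add (hd i)).add hsmall
        rwa [add_zero, add_zero] at this
      refine tendsto_of_tendsto_of_tendsto_of_le_of_le tendsto_const_nhds h2
        (fun _ => zero_le) fun j => ?_
      have m1 : AEStronglyMeasurable (mollify (N j) (w j i) - w j i) volume :=
        (contDiff_mollify (hwl j i) _).continuous.aestronglyMeasurable.sub
          (hw j i).aestronglyMeasurable
      have m2 : AEStronglyMeasurable (w j i - w' i) volume :=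
        (hw j i).aestronglyMeasurable.sub (hw' i).aestronglyMeasurable
      have m3 : AEStronglyMeasurable (mollify (N j) (w' i) - w' i) volume :=
        (contDiff_mollify (hwl' i) _).continuous.aestronglyMeasurable.sub
          (hw' i).aestronglyMeasurable
      have e3 : mollify (N j) (w j i) - mollify (N j) (w' i) =
          (mollify (N j) (w j i) - w j i) + (w j i - w' i) - (mollify (N j) (w' i) - w' i) := by
        abel
      dsimp only
      rw [e3]
      refine (eLpNorm_sub_le (m1.add m2) m3 hp1).trans (add_le_add ?_ (hN j i).2.1)
      exact (eLpNorm_add_le m1 m2 hp1).trans (add_le_add (hN j i).1.1 le_rfl)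
  have h4 := (step1.add step2).sub step3
  rw [← tendsto_sub_nhds_zero_iff]
  simp only [add_zero, sub_zero] at h4
  refine h4.congr fun j => ?_
  ring

end MinorConvergence

/-! ### Convex combinations of weakly convergent sequences -/

section Mazur

/-- Mazur's lemma: convex combinations of the tail of a weakly convergent sequence come arbitrarily
close to the limit. -/
lemma exists_convex_combination_of_weak {X : Type*} [NormedAddCommGroup X] [NormedSpace ℝ X]
    {x : ℕ → X} {y : X} (h : ∀ ℓ : X →L[ℝ] ℝ, Tendsto (fun j => ℓ (x j)) atTop (𝓝 (ℓ y)))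
    (n : ℕ) {ε : ℝ} (hε : 0 < ε) :
    ∃ (s : Finset ℕ) (a : ℕ → ℝ), (∀ j ∈ s, n ≤ j) ∧ (∀ j, 0 ≤ a j) ∧ ∑ j ∈ s, a j = 1 ∧
      dist (∑ j ∈ s, a j • x j) y < ε := by
  classical
  have hy : y ∈ closure (convexHull ℝ (x '' Ici n)) := by
    by_contra hy
    obtain ⟨f, u, hf, hu⟩ := geometric_hahn_banach_closed_point
      (convex_convexHull ℝ (x '' Ici n)).closure isClosed_closure hy
    refine absurd (le_of_tendsto (h f) ?_) (not_le.2 hu)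
    filter_upwards [eventually_ge_atTop n] with j hj
    exact (hf _ (subset_closure (subset_convexHull ℝ _ ⟨j, hj, rfl⟩))).le
  obtain ⟨z, hz, hzy⟩ := Metric.mem_closure_iff.1 hy ε hε
  obtain ⟨ι, hι, w, g, hw0, hw1, hg, rfl⟩ := mem_convexHull_iff_exists_fintype.1 hz
  choose idx hidx hgx using hg
  refine ⟨Finset.univ.image idx, fun j => ∑ i with idx i = j, w i, ?_, ?_, ?_, ?_⟩
  · intro j hj
    obtain ⟨i, -, rfl⟩ := Finset.mem_image.1 hj
    exact hidx i
  · exact fun j => Finset.sum_nonneg fun i _ => hw0 i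
  · rw [Finset.sum_fiberwise_of_maps_to fun i hi => Finset.mem_image_of_mem idx hi]
    exact hw1
  · have : ∑ j ∈ Finset.univ.image idx, (∑ i with idx i = j, w i) • x j = ∑ i, w i • g i := by
      rw [← Finset.sum_fiberwise_of_maps_to (s := Finset.univ) (t := Finset.univ.image idx)
        (g := idx) fun i hi => Finset.mem_image_of_mem idx hi]
      refine Finset.sum_congr rfl fun j _ => ?_
      rw [Finset.sum_smul]
      refine Finset.sum_congr rfl fun i hi => ?_
      rw [← hgx, (Finset.mem_filter.1 hi).2]
    rw [this, dist_comm]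
    exact hzy

variable {α : Type*} [MeasurableSpace α] {μ : Measure α}

/-- The dual of `L^1` of a finite measure is `L^∞`. -/
lemma exists_bounded_representative [IsFiniteMeasure μ] (ℓ : Lp ℝ 1 μ →L[ℝ] ℝ) :
    ∃ g : α → ℝ, AEStronglyMeasurable g μ ∧ (∀ᵐ x ∂μ, ‖g x‖ ≤ ‖ℓ‖) ∧
      ∀ f : Lp ℝ 1 μ, ℓ f = ∫ x, g x * f x ∂μ := by
  -- the functional is restricted to `L^2`, where Riesz' theorem applies
  set one : Lp ℝ 2 μ := (memLp_const (1 : ℝ)).toLp _ with hone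
  set T : Lp ℝ 2 μ →L[ℝ] Lp ℝ 1 μ := (ContinuousLinearMap.mul ℝ ℝ).holderL μ 2 2 1 one with hT
  set g : Lp ℝ 2 μ := (InnerProductSpace.toDual ℝ (Lp ℝ 2 μ)).symm (ℓ ∘L T) with hg
  have hTf : ∀ f : Lp ℝ 2 μ, T f =ᵐ[μ] f := by
    intro f
    have h1 : T f =ᵐ[μ] fun x => ContinuousLinearMap.mul ℝ ℝ (one x) (f x) :=
      (ContinuousLinearMap.mul ℝ ℝ).coeFn_holder one f
    filter_upwards [h1, (memLp_const (p := 2) (μ := μ) (1 : ℝ)).coeFn_toLp] with x hx h2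
    rw [hx, hone, h2]
    simp
  have hgi : Integrable g μ := (Lp.memLp g).integrable (by norm_num)
  have hind : ∀ (s : Set α) (hs : MeasurableSet s),
      ℓ (indicatorConstLp 1 hs (measure_ne_top μ s) (1 : ℝ)) = ∫ x in s, g x ∂μ := by
    intro s hs
    have h1 : T (indicatorConstLp 2 hs (measure_ne_top μ s) (1 : ℝ)) =
        indicatorConstLp 1 hs (measure_ne_top μ s) (1 : ℝ) := by
      refine Lp.ext ?_
      filter_upwards [hTf (indicatorConstLp 2 hs (measure_ne_top μ s) (1 : ℝ)),
        indicatorConstLp_coeFn (p := 2) (hs := hs) (hμs := measure_ne_top μ s) (c := (1 : ℝ)),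
        indicatorConstLp_coeFn (p := 1) (hs := hs) (hμs := measure_ne_top μ s) (c := (1 : ℝ))]
        with x h1 h2 h3
      rw [h1, h2, h3]
    have h2 : inner ℝ g (indicatorConstLp 2 hs (measure_ne_top μ s) (1 : ℝ)) =
        ℓ (T (indicatorConstLp 2 hs (measure_ne_top μ s) (1 : ℝ))) :=
      InnerProductSpace.toDual_symm_apply
    rw [← h1, ← h2, real_inner_comm, L2.inner_indicatorConstLp_one]
  have hle : ∀ (s : Set α), MeasurableSet s → |∫ x in s, g x ∂μ| ≤ ∫ _ in s, ‖ℓ‖ ∂μ := by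
    intro s hs
    rw [← hind s hs, setIntegral_const, smul_eq_mul, mul_comm, ← Real.norm_eq_abs]
    refine (ℓ.le_opNorm _).trans ?_
    gcongr
    rw [norm_indicatorConstLp one_ne_zero ENNReal.one_ne_top]
    simp
  have hb : ∀ᵐ x ∂μ, ‖g x‖ ≤ ‖ℓ‖ := by
    have h1 : (fun x => g x) ≤ᵐ[μ] fun _ => ‖ℓ‖ :=
      ae_le_of_forall_setIntegral_le hgi (integrable_const _) fun s hs _ =>
        (le_abs_self _).trans (hle s hs)
    have h2 : (fun x => - g x) ≤ᵐ[μ] fun _ => ‖ℓ‖ :=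
      ae_le_of_forall_setIntegral_le hgi.neg (integrable_const _) fun s hs _ => by
        rw [integral_neg]
        exact (neg_le_abs _).trans (hle s hs)
    filter_upwards [h1, h2] with x h1 h2
    rw [Real.norm_eq_abs, abs_le]
    constructor <;> linarith
  refine ⟨g, Lp.aestronglyMeasurable g, hb, ?_⟩
  have hgt : MemLp g ⊤ μ := memLp_top_of_bound (Lp.aestronglyMeasurable g) _ hb
  set L : Lp ℝ 1 μ →L[ℝ] ℝ := (ContinuousLinearMap.mul ℝ ℝ).lpPairing μ ⊤ 1 hgt.toLp with hL
  have hLf : ∀ f : Lp ℝ 1 μ, L f = ∫ x, g x * f x ∂μ := by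
    intro f
    rw [hL, ContinuousLinearMap.lpPairing_eq_integral]
    refine integral_congr_ae ?_
    filter_upwards [hgt.coeFn_toLp] with x hx
    rw [hx]
    rfl
  intro f
  rw [← hLf]
  induction f using Lp.induction ENNReal.one_ne_top with
  | indicatorConst c hs hμs =>
    rename_i s
    have e : ((Lp.simpleFunc.indicatorConst 1 hs hμs.ne c : Lp.simpleFunc ℝ 1 μ) : Lp ℝ 1 μ) =
        c • indicatorConstLp 1 hs (measure_ne_top μ s) (1 : ℝ) := by
      rw [Lp.simpleFunc.coe_indicatorConst]
      refine Lp.ext ?_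
      filter_upwards [indicatorConstLp_coeFn (p := 1) (hs := hs) (hμs := hμs.ne) (c := c),
        indicatorConstLp_coeFn (p := 1) (hs := hs) (hμs := measure_ne_top μ s) (c := (1 : ℝ)),
        Lp.coeFn_smul c (indicatorConstLp 1 hs (measure_ne_top μ s) (1 : ℝ))] with x h1 h2 h3
      rw [h1, h3, Pi.smul_apply, h2]
      by_cases hx : x ∈ s <;> simp [hx]
    rw [e, map_smul, map_smul, hind s hs, hLf]
    congr 1
    rw [← integral_indicator hs]
    refine integral_congr_ae ?_
    filter_upwards [indicatorConstLp_coeFn (p := 1) (hs := hs) (hμs := measure_ne_top μ s)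
      (c := (1 : ℝ))] with x h1
    rw [h1]
    by_cases hx : x ∈ s <;> simp [hx]
  | add hf hg hd h1 h2 => rw [map_add, map_add, h1, h2]
  | isClosed => exact isClosed_eq ℓ.continuous L.continuous

/-- A sequence that is bounded in `L^q`, with `q > 1`, and vanishes in the limit against smooth
test functions vanishes in the limit against bounded functions. -/
lemma tendsto_integral_mul_of_bounded {m : ℕ} {μ : Measure (E m)} [IsFiniteMeasure μ] {q : ℝ}
    (hq : 1 < q) {f : ℕ → E m → ℝ} (hf : ∀ j, MemLp (f j) (ENNReal.ofReal q) μ) {C : ℝ≥0∞}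
    (hCt : C ≠ ⊤) (hC : ∀ j, eLpNorm (f j) (ENNReal.ofReal q) μ ≤ C)
    (hweak : ∀ φ : E m → ℝ, ContDiff ℝ ∞ φ → HasCompactSupport φ →
      Tendsto (fun j => ∫ z, φ z * f j z ∂μ) atTop (𝓝 0))
    {g : E m → ℝ} (hg : AEStronglyMeasurable g μ) {M : ℝ} (hM : ∀ᵐ z ∂μ, ‖g z‖ ≤ M) :
    Tendsto (fun j => ∫ z, g z * f j z ∂μ) atTop (𝓝 0) := by
  have hconj := Real.HolderConjugate.conjExponent hq
  set r := q.conjExponent with hr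
  have hr1 : 1 < r := hconj.symm.lt
  have hrl : 1 ≤ ENNReal.ofReal r := by simpa using hr1.le
  have hql : 1 ≤ ENNReal.ofReal q := by simpa using hq.le
  have : ENNReal.HolderConjugate (ENNReal.ofReal r) (ENNReal.ofReal q) := hconj.symm.ennrealOfReal
  have hgr : MemLp g (ENNReal.ofReal r) μ := MemLp.of_bound hg M hM
  have hhold : ∀ {h : E m → ℝ} (j : ℕ), AEStronglyMeasurable h μ → ‖∫ z, h z * f j z ∂μ‖ₑ ≤
      eLpNorm h (ENNReal.ofReal r) μ * C := by
    intro h j hh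
    refine (enorm_integral_le_lintegral_enorm _).trans ?_
    rw [← eLpNorm_one_eq_lintegral_enorm]
    exact (eLpNorm_smul_le_mul_eLpNorm (r := 1) (hf j).aestronglyMeasurable hh).trans
      (mul_le_mul_right (hC j) _)
  rw [tendsto_zero_iff_enorm_tendsto_zero, ENNReal.tendsto_nhds_zero]
  intro ε hε
  have hε2 : 0 < ε / 2 := ENNReal.half_pos hε.ne'
  obtain ⟨δ, hδ0, hδ⟩ := ENNReal.exists_nnreal_pos_mul_lt hCt hε2.ne'
  obtain ⟨φ, hφc, hφs, hφ⟩ := hgr.exist_eLpNorm_sub_le ENNReal.ofReal_ne_top hrl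
    (NNReal.coe_pos.2 hδ0)
  rw [ENNReal.ofReal_coe_nnreal] at hφ
  have h1 := (tendsto_zero_iff_enorm_tendsto_zero.1 (hweak φ hφs hφc))
  filter_upwards [(ENNReal.tendsto_nhds_zero.1 h1) _ hε2] with j hj
  have hφm : AEStronglyMeasurable φ μ := hφs.continuous.aestronglyMeasurable
  have hfi : Integrable (f j) μ := (hf j).integrable hql
  obtain ⟨M', hM'⟩ := hφc.exists_bound_of_continuous hφs.continuous
  have i1 : Integrable (fun z => g z * f j z) μ := hfi.bdd_mul hg hM
  have i2 : Integrable (fun z => φ z * f j z) μ := hfi.bdd_mul hφm (ae_of_all _ hM')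
  have e : ∫ z, g z * f j z ∂μ = ∫ z, (g - φ) z * f j z ∂μ + ∫ z, φ z * f j z ∂μ := by
    rw [← sub_eq_iff_eq_add, ← integral_sub i1 i2]
    refine integral_congr_ae (ae_of_all _ fun z => ?_)
    simp [sub_mul]
  rw [e, ← ENNReal.add_halves ε]
  refine (enorm_add_le _ _).trans (add_le_add ?_ hj)
  exact (hhold j (hg.sub hφm)).trans ((mul_le_mul_left hφ _).trans hδ.le)

/-- If finitely many sequences of functions are bounded in `L^q`, with `q > 1`, and converge against
smooth test functions, then common convex combinations of their tails converge almost
everywhere. -/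
lemma exists_convex_combination_ae_tendsto {m : ℕ} {μ : Measure (E m)} [IsFiniteMeasure μ] {q : ℝ}
    (hq : 1 < q) {ι : Type*} [Fintype ι] {f : ℕ → ι → E m → ℝ} {f' : ι → E m → ℝ}
    (hf : ∀ j i, MemLp (f j i) (ENNReal.ofReal q) μ) (hf' : ∀ i, MemLp (f' i) (ENNReal.ofReal q) μ)
    {C : ℝ≥0∞} (hCt : C ≠ ⊤) (hC : ∀ j i, eLpNorm (f j i) (ENNReal.ofReal q) μ ≤ C)
    (hweak : ∀ i, ∀ φ : E m → ℝ, ContDiff ℝ ∞ φ → HasCompactSupport φ →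
      Tendsto (fun j => ∫ z, φ z * f j i z ∂μ) atTop (𝓝 (∫ z, φ z * f' i z ∂μ))) :
    ∃ (s : ℕ → Finset ℕ) (a : ℕ → ℕ → ℝ), (∀ n, ∀ j ∈ s n, n ≤ j) ∧ (∀ n j, 0 ≤ a n j) ∧
      (∀ n, ∑ j ∈ s n, a n j = 1) ∧ ∀ᵐ z ∂μ, ∀ i,
        Tendsto (fun n => ∑ j ∈ s n, a n j * f j i z) atTop (𝓝 (f' i z)) := by
  classical
  have hql : 1 ≤ ENNReal.ofReal q := by simpa using hq.le
  have hf1 : ∀ j i, MemLp (f j i) 1 μ := fun j i => (hf j i).mono_exponent hql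
  have hf1' : ∀ i, MemLp (f' i) 1 μ := fun i => (hf' i).mono_exponent hql
  set x : ℕ → ι → Lp ℝ 1 μ := fun j i => (hf1 j i).toLp _ with hx
  set y : ι → Lp ℝ 1 μ := fun i => (hf1' i).toLp _ with hy
  have hdiff : ∀ i, ∀ ℓ : Lp ℝ 1 μ →L[ℝ] ℝ,
      Tendsto (fun j => ℓ (x j i)) atTop (𝓝 (ℓ (y i))) := by
    intro i ℓ
    obtain ⟨g, hg, hgb, hgℓ⟩ := exists_bounded_representative ℓ
    have h1 := tendsto_integral_mul_of_bounded hq (f := fun j => f j i - f' i)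
      (fun j => (hf j i).sub (hf' i))
      (ENNReal.add_ne_top.2 ⟨hCt, (hf' i).eLpNorm_ne_top⟩)
      (fun j => (eLpNorm_sub_le (hf j i).aestronglyMeasurable (hf' i).aestronglyMeasurable
        hql).trans (add_le_add (hC j i) le_rfl)) (fun φ hφ hφc => ?_) hg hgb
    · rw [← tendsto_sub_nhds_zero_iff]
      refine h1.congr fun j => ?_
      rw [hgℓ, hgℓ, ← integral_sub]
      · refine integral_congr_ae ?_
        filter_upwards [(hf1 j i).coeFn_toLp, (hf1' i).coeFn_toLp] with z h2 h3
        simp only [hx, hy, Pi.sub_apply]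
        rw [h2, h3]
        ring
      · exact (L1.integrable_coeFn _).bdd_mul hg hgb
      · exact (L1.integrable_coeFn _).bdd_mul hg hgb
    · rw [← sub_self (∫ z, φ z * f' i z ∂μ)]
      refine ((hweak i φ hφ hφc).sub_const _).congr fun j => ?_
      obtain ⟨M', hM'⟩ := hφc.exists_bound_of_continuous hφ.continuous
      rw [← integral_sub]
      · refine integral_congr_ae (ae_of_all _ fun z => ?_)
        simp [mul_sub]
      · exact ((hf1 j i).integrable le_rfl).bdd_mul hφ.continuous.aestronglyMeasurable
          (ae_of_all _ hM')
      · exact ((hf1' i).integrable le_rfl).bdd_mul hφ.continuous.aestronglyMeasurable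
          (ae_of_all _ hM')
  have hw : ∀ L : (ι → Lp ℝ 1 μ) →L[ℝ] ℝ, Tendsto (fun j => L (x j)) atTop (𝓝 (L y)) := by
    intro L
    have e : ∀ v : ι → Lp ℝ 1 μ, L v = ∑ i, (L ∘L ContinuousLinearMap.single ℝ _ i) (v i) := by
      intro v
      conv_lhs => rw [← Finset.univ_sum_single v]
      rw [map_sum]
      rfl
    simp only [e]
    exact tendsto_finsetSum _ fun i _ => hdiff i _
  choose s a hs ha0 ha1 hd using fun n : ℕ =>
    exists_convex_combination_of_weak hw n (ε := (1 / 2) ^ n) (by positivity)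
  refine ⟨s, a, hs, ha0, ha1, ?_⟩
  rw [ae_all_iff]
  intro i
  -- the distances are summable, so there is no need to pass to a subsequence
  have hcoe : ∀ n, ((∑ j ∈ s n, a n j • x j) i - y i : Lp ℝ 1 μ) =ᵐ[μ]
      fun z => ∑ j ∈ s n, a n j * f j i z - f' i z := by
    intro n
    have e : (∑ j ∈ s n, a n j • x j) i = ∑ j ∈ s n, a n j • x j i := by
      rw [Finset.sum_apply]
      rfl
    have h2 : ∀ᵐ z ∂μ, ∀ j, (a n j • x j i : Lp ℝ 1 μ) z = a n j * f j i z := by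
      rw [ae_all_iff]
      intro j
      filter_upwards [Lp.coeFn_smul (a n j) (x j i), (hf1 j i).coeFn_toLp] with z h3 h4
      rw [h3, Pi.smul_apply, h4, smul_eq_mul]
    rw [e]
    filter_upwards [Lp.coeFn_sub (∑ j ∈ s n, a n j • x j i) (y i),
      Lp.coeFn_fun_finsetSum (s n) (fun j => a n j • x j i), h2, (hf1' i).coeFn_toLp]
      with z h3 h4 h5 h6
    rw [h3, Pi.sub_apply, h4, h6]
    simp only [h5]
  have hnorm : ∀ n, ∫⁻ z, ‖∑ j ∈ s n, a n j * f j i z - f' i z‖ₑ ∂μ ≤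
      ENNReal.ofReal ((1 / 2) ^ n) := by
    intro n
    have h1 : ‖(∑ j ∈ s n, a n j • x j) i - y i‖ ≤ (1 / 2) ^ n := by
      have := hd n
      rw [dist_eq_norm] at this
      exact (norm_le_pi_norm (∑ j ∈ s n, a n j • x j - y) i).trans this.le
    have h2 : ∫⁻ z, ‖((∑ j ∈ s n, a n j • x j) i - y i : Lp ℝ 1 μ) z‖ₑ ∂μ =
        ∫⁻ z, ‖∑ j ∈ s n, a n j * f j i z - f' i z‖ₑ ∂μ :=
      lintegral_congr_ae ((hcoe n).fun_comp enorm)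
    rw [← h2, ← eLpNorm_one_eq_lintegral_enorm,
      ← Lp.enorm_def, ← ofReal_norm]
    exact ENNReal.ofReal_le_ofReal h1
  have hm : ∀ n, AEMeasurable (fun z => ‖∑ j ∈ s n, a n j * f j i z - f' i z‖ₑ) μ := by
    intro n
    refine AEStronglyMeasurable.enorm ((Finset.aestronglyMeasurable_fun_sum _ fun j _ => ?_).sub
      (hf1' i).aestronglyMeasurable)
    exact (hf1 j i).aestronglyMeasurable.const_mul _
  have hsum : ∫⁻ z, ∑' n, ‖∑ j ∈ s n, a n j * f j i z - f' i z‖ₑ ∂μ ≠ ⊤ := by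
    rw [lintegral_tsum hm]
    refine ne_top_of_le_ne_top ?_ (ENNReal.tsum_le_tsum hnorm)
    rw [← ENNReal.ofReal_tsum_of_nonneg (fun n => by positivity) summable_geometric_two]
    exact ENNReal.ofReal_ne_top
  filter_upwards [ae_lt_top' (AEMeasurable.tsum hm) hsum] with z hz
  rw [← tendsto_sub_nhds_zero_iff, tendsto_zero_iff_enorm_tendsto_zero]
  exact ENNReal.tendsto_atTop_zero_of_tsum_ne_top hz.ne

end Mazur

/-! ### Compactness on a ball -/

section Local

variable {m : ℕ} {p : ℝ}

/-- `g` is the weak gradient of `w` on the open set `B`. The integrals are Bochner integrals; for `w`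
and `g` integrable on `B` they all exist. -/
def HasWeakGradientOn (B : Set (E m)) (w : E m → ℝ) (g : E m → E m →L[ℝ] ℝ) : Prop :=
  ∀ φ : E m → ℝ, ContDiff ℝ ∞ φ → HasCompactSupport φ → tsupport φ ⊆ B → ∀ v : E m,
    ∫ z in B, fderiv ℝ φ z v * w z = - ∫ z in B, φ z * g z v

/-- An `L^p` function on `B`, transformed by pointwise operations `T z` that are bounded by `M` and
vanish for `z` outside `B`, is an `L^p` function on the whole space. -/
lemma memLp_cutoff {F : Type*} [NormedAddCommGroup F] [NormedSpace ℝ F] {P : ℝ≥0∞}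
    {B : Set (E m)} (hB : MeasurableSet B) {f : E m → F} (hf : MemLp f P (volume.restrict B))
    {T : E m → F → F} {M : ℝ≥0} (hT : ∀ z x, ‖T z x‖ ≤ M * ‖x‖)
    (hTm : AEStronglyMeasurable (fun z => T z (f z)) (volume.restrict B))
    (hT0 : ∀ z, z ∉ B → ∀ x, T z x = 0) :
    MemLp (fun z => T z (f z)) P volume ∧
      eLpNorm (fun z => T z (f z)) P volume ≤ M * eLpNorm f P (volume.restrict B) := by
  have e : (fun z => T z (f z)) = B.indicator fun z => T z (f z) := by
    funext z
    by_cases hz : z ∈ B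
    · rw [indicator_of_mem hz]
    · rw [indicator_of_notMem hz, hT0 z hz]
  have h1 : eLpNorm (fun z => T z (f z)) P (volume.restrict B) ≤
      M * eLpNorm f P (volume.restrict B) := by
    have := eLpNorm_le_nnreal_smul_eLpNorm_of_ae_le_mul (μ := volume.restrict B)
      (f := fun z => T z (f z)) (g := f) (c := M) (ae_of_all _ fun z => hT z (f z)) P
    simpa [ENNReal.smul_def] using this
  rw [e, memLp_indicator_iff_restrict hB, eLpNorm_indicator_eq_eLpNorm_restrict hB]
  exact ⟨⟨hTm, lt_of_le_of_lt h1 (ENNReal.mul_lt_top ENNReal.coe_lt_top hf.2)⟩, h1⟩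

/-- The product of a weakly differentiable function with a cutoff. -/
lemma HasWeakGradientOn.cutoff {B : Set (E m)} {w : E m → ℝ}
    {g : E m → E m →L[ℝ] ℝ} (h : HasWeakGradientOn B w g)
    (hw : IntegrableOn w B) (hg : IntegrableOn g B)
    {χ : E m → ℝ} (hχ : ContDiff ℝ ∞ χ) (hχc : HasCompactSupport χ) (hχB : tsupport χ ⊆ B) :
    HasWeakGradient (fun z => χ z * w z) (fun z => χ z • g z + w z • fderiv ℝ χ z) := by
  intro φ hφ hφc v
  have hχ0 : ∀ z, z ∉ B → χ z = 0 := fun z hz =>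
    image_eq_zero_of_notMem_tsupport fun h => hz (hχB h)
  have hDχ0 : ∀ z, z ∉ B → fderiv ℝ χ z = 0 := fun z hz =>
    image_eq_zero_of_notMem_tsupport fun h => hz (hχB (tsupport_fderiv_subset ℝ h))
  have e1 : ∫ z, fderiv ℝ φ z v * (χ z * w z) = ∫ z in B, fderiv ℝ φ z v * (χ z * w z) :=
    (setIntegral_eq_integral_of_forall_compl_eq_zero fun z hz => by simp [hχ0 z hz]).symm
  have e2 : ∫ z, φ z * (χ z • g z + w z • fderiv ℝ χ z) v =
      ∫ z in B, φ z * (χ z • g z + w z • fderiv ℝ χ z) v :=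
    (setIntegral_eq_integral_of_forall_compl_eq_zero fun z hz => by
      simp [hχ0 z hz, hDχ0 z hz]).symm
  have h1 := h (fun z => φ z * χ z) (hφ.mul hχ) hφc.mul_right
    ((tsupport_mul_subset_right).trans hχB) v
  have hD : ∀ z, fderiv ℝ (fun z => φ z * χ z) z v =
      φ z * fderiv ℝ χ z v + χ z * fderiv ℝ φ z v := by
    intro z
    rw [fderiv_fun_mul (hφ.differentiable (by simp) z) (hχ.differentiable (by simp) z)]
    simp
  have hcφ : Continuous fun z => fderiv ℝ φ z v :=
    (hφ.continuous_fderiv (by simp)).clm_apply continuous_const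
  have hcχ : Continuous fun z => fderiv ℝ χ z v :=
    (hχ.continuous_fderiv (by simp)).clm_apply continuous_const
  have hbd : ∀ {f F : E m → ℝ}, Continuous f → HasCompactSupport f → IntegrableOn F B →
      IntegrableOn (fun z => f z * F z) B := by
    intro f F hf hfc hF
    obtain ⟨C, hC⟩ := hfc.exists_bound_of_continuous hf
    exact Integrable.bdd_mul hF hf.aestronglyMeasurable (ae_of_all _ hC)
  have hgv : IntegrableOn (fun z => g z v) B :=
    ((ContinuousLinearMap.apply ℝ ℝ v).integrable_comp hg)
  have i1 : IntegrableOn (fun z => (χ z * fderiv ℝ φ z v) * w z) B :=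
    hbd (hχ.continuous.mul hcφ) hχc.mul_right hw
  have i2 : IntegrableOn (fun z => (φ z * fderiv ℝ χ z v) * w z) B :=
    hbd (hφ.continuous.mul hcχ) hφc.mul_right hw
  have i3 : IntegrableOn (fun z => (φ z * χ z) * g z v) B :=
    hbd (hφ.continuous.mul hχ.continuous) hφc.mul_right hgv
  rw [e1, e2]
  have e3 : ∫ z in B, fderiv ℝ (fun z => φ z * χ z) z v * w z =
      (∫ z in B, (φ z * fderiv ℝ χ z v) * w z) + ∫ z in B, (χ z * fderiv ℝ φ z v) * w z := by
    rw [← integral_add i2 i1]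
    refine integral_congr_ae (ae_of_all _ fun z => ?_)
    simp only [hD]
    ring
  have e4 : ∫ z in B, φ z * (χ z • g z + w z • fderiv ℝ χ z) v =
      (∫ z in B, (φ z * χ z) * g z v) + ∫ z in B, (φ z * fderiv ℝ χ z v) * w z := by
    rw [← integral_add i3 i2]
    refine integral_congr_ae (ae_of_all _ fun z => ?_)
    simp only [_root_.add_apply, _root_.smul_apply, smul_eq_mul]
    ring
  have e5 : ∫ z in B, fderiv ℝ φ z v * (χ z * w z) =
      ∫ z in B, (χ z * fderiv ℝ φ z v) * w z :=
    integral_congr_ae (ae_of_all _ fun z => by ring)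
  rw [e4, e5]
  rw [e3] at h1
  linarith

lemma HasWeakGradient.sub {w w' : E m → ℝ} {g g' : E m → E m →L[ℝ] ℝ}
    (h : HasWeakGradient w g) (h' : HasWeakGradient w' g') (hw : LocallyIntegrable w)
    (hw' : LocallyIntegrable w') (hg : LocallyIntegrable g) (hg' : LocallyIntegrable g') :
    HasWeakGradient (w - w') (g - g') := by
  intro φ hφ hφc v
  have hcφ : Continuous fun z => fderiv ℝ φ z v :=
    (hφ.continuous_fderiv (by simp)).clm_apply continuous_const
  have hcc : HasCompactSupport fun z => fderiv ℝ φ z v := hφc.fderiv_apply ℝ v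
  have happ : ∀ {g : E m → E m →L[ℝ] ℝ}, LocallyIntegrable g →
      Integrable fun z => φ z * g z v := by
    intro g hg
    exact ((ContinuousLinearMap.apply ℝ ℝ v).integrable_comp
      (hg.integrable_smul_left_of_hasCompactSupport hφ.continuous hφc)).congr
        (ae_of_all _ fun z => by simp)
  have i1 := hw.integrable_smul_left_of_hasCompactSupport hcφ hcc
  have i2 := hw'.integrable_smul_left_of_hasCompactSupport hcφ hcc
  simp only [smul_eq_mul] at i1 i2
  simp only [Pi.sub_apply, _root_.sub_apply, mul_sub]
  rw [integral_sub i1 i2, integral_sub (happ hg) (happ hg'), h φ hφ hφc v, h' φ hφ hφc v]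
  ring

/-- Convergence almost everywhere along a subsequence, for finitely many sequences at once. -/
lemma exists_subseq_ae_tendsto {α : Type*} [MeasurableSpace α] {μ : Measure α} {P : ℝ≥0∞}
    (hP : 1 ≤ P) {ι : Type*} [Fintype ι] {δ : ℕ → ι → α → ℝ}
    (hm : ∀ j i, AEStronglyMeasurable (δ j i) μ)
    (h : ∀ i, Tendsto (fun j => eLpNorm (δ j i) P μ) atTop (𝓝 0)) :
    ∃ θ : ℕ → ℕ, StrictMono θ ∧ ∀ᵐ x ∂μ, ∀ i, Tendsto (fun j => δ (θ j) i x) atTop (𝓝 0) := by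
  classical
  have hsum : Tendsto (fun j => eLpNorm ((fun x => ∑ i, ‖δ j i x‖) - fun _ => 0) P μ) atTop
      (𝓝 0) := by
    have h1 : Tendsto (fun j => ∑ i, eLpNorm (δ j i) P μ) atTop (𝓝 0) := by
      simpa using tendsto_finsetSum Finset.univ fun i _ => h i
    refine tendsto_of_tendsto_of_tendsto_of_le_of_le tendsto_const_nhds h1
      (fun _ => zero_le) fun j => ?_
    have e : ((fun x => ∑ i, ‖δ j i x‖) - fun _ => 0) = ∑ i, fun x => ‖δ j i x‖ := by
      funext x
      simp
    dsimp only
    rw [e]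
    refine (eLpNorm_sum_le (fun i _ => (hm j i).norm) hP).trans ?_
    simp only [eLpNorm_norm]
    exact le_rfl
  have hmeas := tendstoInMeasure_of_tendsto_eLpNorm (zero_lt_one.trans_le hP).ne'
    (fun j => by
      have := Finset.aestronglyMeasurable_fun_sum Finset.univ fun i _ => (hm j i).norm
      exact this) aestronglyMeasurable_const hsum
  obtain ⟨θ, hθ, hx⟩ := hmeas.exists_seq_tendsto_ae
  refine ⟨θ, hθ, ?_⟩
  filter_upwards [hx] with x hx i
  rw [tendsto_zero_iff_norm_tendsto_zero]
  refine tendsto_of_tendsto_of_tendsto_of_le_of_le tendsto_const_nhds hx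
    (fun _ => norm_nonneg _) fun j => ?_
  exact Finset.single_le_sum (f := fun i => ‖δ (θ j) i x‖) (fun _ _ => norm_nonneg _)
    (Finset.mem_univ i)

/-- The directions of the canonical basis that are selected by `c`. -/
noncomputable def basisDirections {k : ℕ} (c : Fin k → Fin m) : Fin k → E m :=
  fun a => EuclideanSpace.single (c a) 1

/-- The choices of `k + 1` rows and `k + 1` columns, `k < m`, in any order and possibly with
repetitions. -/
abbrev ChartMinorIndex (d m : ℕ) : Type :=
  Σ k : Fin m, (Fin (k + 1) → Fin d) × (Fin (k + 1) → Fin m)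

lemma minorOf_eq_zero {k : ℕ} (s : Fin k → E m) {ξ : Fin k → E m →L[ℝ] ℝ} (i : Fin k)
    (h : ξ i = 0) : minorOf s ξ = 0 := by
  rw [minorOf]
  exact Matrix.det_eq_zero_of_row_eq_zero i fun j => by simp [h]

/-- Minors of order at most `m` of covector fields that are bounded in `L^p` are bounded in
`L^{p/m}`. -/
lemma exists_eLpNorm_minorOf_le {μ : Measure (E m)} [IsFiniteMeasure μ] (hm : 0 < m) (hp : (m : ℝ) < p)
    {k : ℕ} (hk : k ≤ m) (s : Fin k → E m) :
    ∃ D : ℝ≥0, ∀ (G : Fin k → E m → E m →L[ℝ] ℝ) (C : ℝ≥0∞),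
      (∀ i, MemLp (G i) (ENNReal.ofReal p) μ) → (∀ i, eLpNorm (G i) (ENNReal.ofReal p) μ ≤ C) →
      eLpNorm (fun z => minorOf s fun i => G i z) (ENNReal.ofReal (p / m)) μ ≤
        D * (μ univ + k * C ^ p) ^ (1 / (p / m)) := by
  obtain ⟨D, hD⟩ := exists_enorm_minorOf_le s
  refine ⟨D, fun G C hG hC => ?_⟩
  have hm0 : (0 : ℝ) < m := by exact_mod_cast hm
  have hp0 : 0 < p := hm0.trans hp
  have hq0 : 0 < p / m := div_pos hp0 hm0
  rw [eLpNorm_le_iff_lintegral_rpow hq0, ENNReal.mul_rpow_of_nonneg _ _ hq0.le,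
    ← ENNReal.rpow_mul, one_div_mul_cancel hq0.ne', ENNReal.rpow_one]
  calc ∫⁻ z, ‖minorOf s fun i => G i z‖ₑ ^ (p / m) ∂μ
      ≤ ∫⁻ z, (D : ℝ≥0∞) ^ (p / m) * ∏ i, ‖G i z‖ₑ ^ (p / m) ∂μ := by
        refine lintegral_mono fun z => ?_
        rw [ENNReal.prod_rpow_of_nonneg hq0.le, ← ENNReal.mul_rpow_of_nonneg _ _ hq0.le]
        exact ENNReal.rpow_le_rpow (hD _) hq0.le
    _ = (D : ℝ≥0∞) ^ (p / m) * ∫⁻ z, ∏ i, ‖G i z‖ₑ ^ (p / m) ∂μ :=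
        lintegral_const_mul' _ _ (ENNReal.rpow_ne_top_of_nonneg hq0.le ENNReal.coe_ne_top)
    _ ≤ _ := by
        refine mul_le_mul_right ?_ _
        refine lintegral_prod_le hm0 (by exact_mod_cast hk)
          (fun i => (hG i).aestronglyMeasurable.enorm.pow_const _) fun i => ?_
        have e : ∀ z, (‖G i z‖ₑ ^ (p / m)) ^ (m : ℝ) = ‖G i z‖ₑ ^ p := by
          intro z
          rw [← ENNReal.rpow_mul, div_mul_cancel₀ _ hm0.ne']
        simp only [e]
        rw [lintegral_enorm_rpow_eq hp0]
        exact ENNReal.rpow_le_rpow (hC i) hp0.le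

/-- Compactness on a ball: for a weakly convergent sequence in `W^{1,p}` of a ball of `ℝ^m`, with
`p > m`, a subsequence converges almost everywhere on the ball of half the radius, and so do convex
combinations of all the minors of the gradients. -/
theorem exists_subseq_convex_combination_minors {d : ℕ} (hm : 0 < m) (hp : (m : ℝ) < p)
    {z₀ : E m} {r : ℝ} (hr : 0 < r)
    {w : ℕ → Fin d → E m → ℝ} {g : ℕ → Fin d → E m → E m →L[ℝ] ℝ}
    {w' : Fin d → E m → ℝ} {g' : Fin d → E m → E m →L[ℝ] ℝ}
    (hw : ∀ j i, MemLp (w j i) (ENNReal.ofReal p) (volume.restrict (Metric.ball z₀ r)))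
    (hg : ∀ j i, MemLp (g j i) (ENNReal.ofReal p) (volume.restrict (Metric.ball z₀ r)))
    (hw' : ∀ i, MemLp (w' i) (ENNReal.ofReal p) (volume.restrict (Metric.ball z₀ r)))
    (hg' : ∀ i, MemLp (g' i) (ENNReal.ofReal p) (volume.restrict (Metric.ball z₀ r)))
    (hwg : ∀ j i, HasWeakGradientOn (Metric.ball z₀ r) (w j i) (g j i))
    (hwg' : ∀ i, HasWeakGradientOn (Metric.ball z₀ r) (w' i) (g' i))
    {C : ℝ≥0∞} (hCt : C ≠ ⊤)
    (hwC : ∀ j i, eLpNorm (w j i) (ENNReal.ofReal p) (volume.restrict (Metric.ball z₀ r)) ≤ C)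
    (hgC : ∀ j i, eLpNorm (g j i) (ENNReal.ofReal p) (volume.restrict (Metric.ball z₀ r)) ≤ C)
    (hweak : ∀ i, ∀ φ : E m → ℝ, ContDiff ℝ ∞ φ → HasCompactSupport φ →
      tsupport φ ⊆ Metric.ball z₀ r → Tendsto (fun j => ∫ z in Metric.ball z₀ r, φ z * w j i z)
        atTop (𝓝 (∫ z in Metric.ball z₀ r, φ z * w' i z))) :
    ∃ (θ : ℕ → ℕ) (s : ℕ → Finset ℕ) (a : ℕ → ℕ → ℝ), StrictMono θ ∧
      (∀ n, ∀ j ∈ s n, n ≤ j) ∧ (∀ n j, 0 ≤ a n j) ∧ (∀ n, ∑ j ∈ s n, a n j = 1) ∧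
      ∀ᵐ z ∂volume.restrict (Metric.ball z₀ (r / 2)),
        (∀ i, Tendsto (fun j => w (θ j) i z) atTop (𝓝 (w' i z))) ∧
        ∀ q : ChartMinorIndex d m, Tendsto (fun n => ∑ j ∈ s n, a n j *
          minorOf (basisDirections q.2.2) (fun b => g (θ j) (q.2.1 b) z)) atTop
          (𝓝 (minorOf (basisDirections q.2.2) (fun b => g' (q.2.1 b) z))) := by
  have hm0 : (0 : ℝ) < m := by exact_mod_cast hm
  have hp0 : 0 < p := hm0.trans hp
  have hmp1 : (1 : ℝ) ≤ m := by exact_mod_cast hm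
  have hp1 : 1 ≤ p := hmp1.trans hp.le
  have hP1 : 1 ≤ ENNReal.ofReal p := by simpa using hp1
  set B := Metric.ball z₀ r with hB
  have hBm : MeasurableSet B := Metric.isOpen_ball.measurableSet
  have : IsFiniteMeasure ((volume : Measure (E m)).restrict B) :=
    ⟨by rw [Measure.restrict_apply_univ]; exact measure_ball_lt_top⟩
  -- a cutoff that is equal to one on the ball of half the radius
  set χ : ContDiffBump z₀ := ⟨r / 2, 3 * r / 4, by linarith, by linarith⟩ with hχdef
  have hχ : ContDiff ℝ ∞ χ := χ.contDiff
  have hχc : HasCompactSupport χ := χ.hasCompactSupport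
  have hχB : tsupport χ ⊆ B := by
    rw [χ.tsupport_eq]
    exact Metric.closedBall_subset_ball (by simp only [hχdef]; linarith)
  obtain ⟨M, hM⟩ := (hχc.fderiv ℝ).exists_bound_of_continuous (hχ.continuous_fderiv (by simp))
  have hχ0 : ∀ z, z ∉ B → χ z = 0 := fun z hz =>
    image_eq_zero_of_notMem_tsupport fun h => hz (hχB h)
  have hDχ0 : ∀ z, z ∉ B → fderiv ℝ χ z = 0 := fun z hz =>
    image_eq_zero_of_notMem_tsupport fun h => hz (hχB (tsupport_fderiv_subset ℝ h))
  have hχ1 : ∀ z ∈ Metric.ball z₀ (r / 2), χ z = 1 := fun z hz =>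
    χ.one_of_mem_closedBall (Metric.ball_subset_closedBall hz)
  have hDχ1 : ∀ z ∈ Metric.ball z₀ (r / 2), fderiv ℝ χ z = 0 := by
    intro z hz
    have h1 : (χ : E m → ℝ) =ᶠ[𝓝 z] fun _ => 1 := by
      filter_upwards [Metric.isOpen_ball.mem_nhds hz] with y hy using hχ1 y hy
    rw [h1.fderiv_eq]
    simp
  set cutG : (E m → ℝ) → (E m → E m →L[ℝ] ℝ) → E m → E m →L[ℝ] ℝ := fun w g z =>
    χ z • g z + w z • fderiv ℝ χ z with hcutG
  have cw : ∀ {w : E m → ℝ}, MemLp w (ENNReal.ofReal p) (volume.restrict B) →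
      MemLp (fun z => χ z * w z) (ENNReal.ofReal p) volume ∧
      eLpNorm (fun z => χ z * w z) (ENNReal.ofReal p) volume ≤
        eLpNorm w (ENNReal.ofReal p) (volume.restrict B) := by
    intro w hw
    have h1 := memLp_cutoff hBm hw (T := fun z x => χ z * x) (M := 1)
      (fun z x => by
        rw [norm_mul, Real.norm_of_nonneg χ.nonneg]
        simpa using mul_le_mul_of_nonneg_right χ.le_one (norm_nonneg x))
      (hχ.continuous.aestronglyMeasurable.mul hw.aestronglyMeasurable)
      (fun z hz x => by simp [hχ0 z hz])
    simpa using h1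
  have cg : ∀ {w : E m → ℝ} {g : E m → E m →L[ℝ] ℝ},
      MemLp w (ENNReal.ofReal p) (volume.restrict B) →
      MemLp g (ENNReal.ofReal p) (volume.restrict B) →
      MemLp (cutG w g) (ENNReal.ofReal p) volume ∧
      eLpNorm (cutG w g) (ENNReal.ofReal p) volume ≤
        eLpNorm g (ENNReal.ofReal p) (volume.restrict B) +
        M.toNNReal * eLpNorm w (ENNReal.ofReal p) (volume.restrict B) := by
    intro w g hw hg
    have h1 := memLp_cutoff hBm hg (T := fun z x => χ z • x) (M := 1)
      (fun z x => by
        rw [norm_smul, Real.norm_of_nonneg χ.nonneg]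
        simpa using mul_le_mul_of_nonneg_right χ.le_one (norm_nonneg x))
      (hχ.continuous.aestronglyMeasurable.smul hg.aestronglyMeasurable)
      (fun z hz x => by simp [hχ0 z hz])
    have h2 : MemLp (fun z => w z • fderiv ℝ χ z) (ENNReal.ofReal p) volume ∧
        eLpNorm (fun z => w z • fderiv ℝ χ z) (ENNReal.ofReal p) volume ≤
          M.toNNReal * eLpNorm w (ENNReal.ofReal p) (volume.restrict B) := by
      have h3 := memLp_cutoff hBm hw (T := fun z x => ‖fderiv ℝ χ z‖ * x) (M := M.toNNReal)
        (fun z x => by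
          rw [norm_mul, norm_norm]
          gcongr
          exact (hM z).trans (Real.le_coe_toNNReal M))
        ((hχ.continuous_fderiv (by simp)).norm.aestronglyMeasurable.mul hw.aestronglyMeasurable)
        (fun z hz x => by simp [hDχ0 z hz])
      have h4 : ∀ z, ‖w z • fderiv ℝ χ z‖ = ‖‖fderiv ℝ χ z‖ * w z‖ := by
        intro z
        rw [norm_smul, norm_mul, norm_norm, mul_comm]
      have h5 : AEStronglyMeasurable (fun z => w z • fderiv ℝ χ z) volume := by
        have e : (fun z => w z • fderiv ℝ χ z) = B.indicator fun z => w z • fderiv ℝ χ z := by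
          funext z
          by_cases hz : z ∈ B
          · rw [indicator_of_mem hz]
          · rw [indicator_of_notMem hz, hDχ0 z hz, smul_zero]
        rw [e, aestronglyMeasurable_indicator_iff hBm]
        exact hw.aestronglyMeasurable.smul
          (hχ.continuous_fderiv (by simp)).aestronglyMeasurable
      refine ⟨(memLp_congr_norm h5 h3.1.aestronglyMeasurable (ae_of_all _ h4)).2 h3.1, ?_⟩
      rw [eLpNorm_congr_norm_ae (ae_of_all _ h4)]
      exact h3.2
    refine ⟨h1.1.add h2.1, ?_⟩
    refine (eLpNorm_add_le h1.1.aestronglyMeasurable h2.1.aestronglyMeasurable hP1).trans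
      (add_le_add (by simpa using h1.2) h2.2)
  set W : ℕ → Fin d → E m → ℝ := fun j i z => χ z * w j i z with hW
  set W' : Fin d → E m → ℝ := fun i z => χ z * w' i z with hW'
  set G : ℕ → Fin d → E m → E m →L[ℝ] ℝ := fun j i => cutG (w j i) (g j i) with hG
  set G' : Fin d → E m → E m →L[ℝ] ℝ := fun i => cutG (w' i) (g' i) with hG'
  have hWG : ∀ j i, HasWeakGradient (W j i) (G j i) := fun j i =>
    (hwg j i).cutoff ((hw j i).integrable hP1) ((hg j i).integrable hP1) hχ hχc hχB
  have hWG' : ∀ i, HasWeakGradient (W' i) (G' i) := fun i =>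
    (hwg' i).cutoff ((hw' i).integrable hP1) ((hg' i).integrable hP1) hχ hχc hχB
  have hWm := fun j i => (cw (hw j i)).1
  have hWm' := fun i => (cw (hw' i)).1
  have hGm := fun j i => (cg (hw j i) (hg j i)).1
  have hGm' := fun i => (cg (hw' i) (hg' i)).1
  have hWc : ∀ j i, HasCompactSupport (W j i) := fun j i => hχc.mul_right
  have hWc' : ∀ i, HasCompactSupport (W' i) := fun i => hχc.mul_right
  set C' : ℝ≥0∞ := C + M.toNNReal * C with hC'
  have hC't : C' ≠ ⊤ := ENNReal.add_ne_top.2 ⟨hCt, ENNReal.mul_ne_top ENNReal.coe_ne_top hCt⟩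
  have hWC : ∀ j i, eLpNorm (W j i) (ENNReal.ofReal p) volume ≤ C' := fun j i =>
    ((cw (hw j i)).2.trans (hwC j i)).trans le_self_add
  have hGC : ∀ j i, eLpNorm (G j i) (ENNReal.ofReal p) volume ≤ C' := fun j i =>
    (cg (hw j i) (hg j i)).2.trans (add_le_add (hgC j i) (mul_le_mul_right (hwC j i) _))
  -- strong convergence of the localized functions
  have hstrong : ∀ i, Tendsto (fun j => eLpNorm (W j i - W' i) (ENNReal.ofReal p) volume) atTop
      (𝓝 0) := by
    intro i
    refine tendsto_eLpNorm_of_weak hp1 (g := fun j => G j i - G' i) (R := ‖z₀‖ + r)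
      (fun j => (hWm j i).sub (hWm' i)) (fun j => (hGm j i).sub (hGm' i))
      (fun j => (hWG j i).sub (hWG' i) ((hWm j i).locallyIntegrable hP1)
        ((hWm' i).locallyIntegrable hP1) ((hGm j i).locallyIntegrable hP1)
        ((hGm' i).locallyIntegrable hP1)) (fun j z hz => ?_)
      (C := C' + (eLpNorm (W' i) (ENNReal.ofReal p) volume +
        eLpNorm (G' i) (ENNReal.ofReal p) volume))
      (ENNReal.add_ne_top.2 ⟨hC't, ENNReal.add_ne_top.2
        ⟨(hWm' i).eLpNorm_ne_top, (hGm' i).eLpNorm_ne_top⟩⟩)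
      (fun j => (eLpNorm_sub_le (hWm j i).aestronglyMeasurable (hWm' i).aestronglyMeasurable
        hP1).trans (add_le_add (hWC j i) le_self_add))
      (fun j => (eLpNorm_sub_le (hGm j i).aestronglyMeasurable (hGm' i).aestronglyMeasurable
        hP1).trans (add_le_add (hGC j i) le_add_self)) fun φ hφ hφc => ?_
    · have hzB : z ∈ B := by
        by_contra h0
        refine hz ?_
        simp [hW, hW', hχ0 z h0]
      rw [Metric.mem_closedBall, dist_zero_right]
      have h1 : ‖z - z₀‖ < r := by simpa [hB, dist_eq_norm] using hzB
      have h2 := norm_add_le z₀ (z - z₀)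
      rw [add_sub_cancel] at h2
      linarith
    · have h1 := hweak i (fun z => φ z * χ z) (hφ.mul hχ) hφc.mul_right
        ((tsupport_mul_subset_right).trans hχB)
      have e : ∀ {v : E m → ℝ}, ∫ z, φ z * (χ z * v z) = ∫ z in B, (φ z * χ z) * v z := by
        intro v
        rw [← setIntegral_eq_integral_of_forall_compl_eq_zero (s := B)
          (fun z hz => by simp [hχ0 z hz])]
        simp only [mul_assoc]
      have h2 := h1.sub_const (∫ z in B, (φ z * χ z) * w' i z)
      rw [sub_self] at h2
      refine h2.congr fun j => ?_
      rw [← e, ← e, ← integral_sub]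
      · refine integral_congr_ae (ae_of_all _ fun z => ?_)
        simp only [hW, hW', Pi.sub_apply]
        ring
      · exact ((hWm j i).locallyIntegrable hP1).integrable_smul_left_of_hasCompactSupport
          hφ.continuous hφc
      · exact ((hWm' i).locallyIntegrable hP1).integrable_smul_left_of_hasCompactSupport
          hφ.continuous hφc
  obtain ⟨θ, hθ, hae⟩ := exists_subseq_ae_tendsto hP1 (δ := fun j i => W j i - W' i)
    (fun j i => (hWm j i).aestronglyMeasurable.sub (hWm' i).aestronglyMeasurable) hstrong
  -- the minors of the localized gradients
  have hq : 1 < p / m := (one_lt_div hm0).2 hp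
  have hμB : IsFiniteMeasure ((volume : Measure (E m)).restrict B) := this
  have hr' : ∀ {f : E m → E m →L[ℝ] ℝ} {b : ℝ≥0∞}, eLpNorm f (ENNReal.ofReal p) volume ≤ b →
      eLpNorm f (ENNReal.ofReal p) (volume.restrict B) ≤ b := fun h =>
    (eLpNorm_mono_measure _ Measure.restrict_le_self).trans h
  choose D hD using fun q : ChartMinorIndex d m =>
    exists_eLpNorm_minorOf_le (μ := volume.restrict B) hm hp (k := q.1 + 1) q.1.2 (basisDirections q.2.2)
  set A : ChartMinorIndex d m → ℝ≥0∞ → ℝ≥0∞ := fun q c =>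
    D q * ((volume.restrict B : Measure (E m)) univ + ((q.1 + 1 : ℕ) : ℝ≥0∞) * c ^ p) ^
      (1 / (p / m)) with hA
  have hAt : ∀ q c, c ≠ ⊤ → A q c ≠ ⊤ := by
    intro q c hc
    refine ENNReal.mul_ne_top ENNReal.coe_ne_top (ENNReal.rpow_ne_top_of_nonneg ?_ ?_)
    · positivity
    · exact ENNReal.add_ne_top.2 ⟨measure_ne_top _ _, ENNReal.mul_ne_top (by simp)
        (ENNReal.rpow_ne_top_of_nonneg hp0.le hc)⟩
  have hAb := fun (q : ChartMinorIndex d m) (j : ℕ) => hD q (fun b => G (θ j) (q.2.1 b)) C'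
    (fun b => (hGm _ _).restrict B) (fun b => hr' (hGC _ _))
  set C'' : ℝ≥0∞ := ∑ i, eLpNorm (G' i) (ENNReal.ofReal p) volume with hC''
  have hC''t : C'' ≠ ⊤ := ENNReal.sum_ne_top.2 fun i _ => (hGm' i).eLpNorm_ne_top
  have hGC' : ∀ i, eLpNorm (G' i) (ENNReal.ofReal p) volume ≤ C'' := fun i =>
    Finset.single_le_sum (f := fun i => eLpNorm (G' i) (ENNReal.ofReal p) volume)
      (fun _ _ => zero_le) (Finset.mem_univ i)
  have hAb' := fun (q : ChartMinorIndex d m) => hD q (fun b => G' (q.2.1 b)) C''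
    (fun b => (hGm' _).restrict B) (fun b => hr' (hGC' _))
  obtain ⟨s, a, hs, ha0, ha1, hconv⟩ := exists_convex_combination_ae_tendsto
    (μ := volume.restrict B) hq (ι := ChartMinorIndex d m)
    (f := fun j q z => minorOf (basisDirections q.2.2) fun b => G (θ j) (q.2.1 b) z)
    (f' := fun q z => minorOf (basisDirections q.2.2) fun b => G' (q.2.1 b) z)
    (fun j q => ⟨aestronglyMeasurable_minorOf _ fun b =>
        (hGm _ _).aestronglyMeasurable.restrict, lt_of_le_of_lt (hAb q j) (hAt q C' hC't).lt_top⟩)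
    (fun q => ⟨aestronglyMeasurable_minorOf _ fun b =>
        (hGm' _).aestronglyMeasurable.restrict, lt_of_le_of_lt (hAb' q)
          (hAt q C'' hC''t).lt_top⟩)
    (C := ∑ q, A q C') (ENNReal.sum_ne_top.2 fun q _ => hAt q C' hC't)
    (fun j q => (hAb q j).trans (Finset.single_le_sum (f := fun q => A q C')
      (fun _ _ => zero_le) (Finset.mem_univ q)))
    (fun q φ hφ hφc => by
      have hcut0 : ∀ (w : E m → ℝ) g z, z ∉ B → cutG w g z = 0 := by
        intro w g z hz
        simp [hcutG, hχ0 z hz, hDχ0 z hz]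
      have h1 := tendsto_integral_minorOf (k := q.1 + 1) hp1
        ((Nat.cast_le.2 (Nat.succ_le_of_lt q.1.2)).trans hp.le) (basisDirections q.2.2)
        (w := fun j b => W (θ j) (q.2.1 b)) (g := fun j b => G (θ j) (q.2.1 b))
        (w' := fun b => W' (q.2.1 b)) (g' := fun b => G' (q.2.1 b))
        (fun j b => hWm _ _) (fun j b => hGm _ _) (fun b => hWm' _) (fun b => hGm' _)
        (fun j b => hWG _ _) (fun b => hWG' _) (fun j b => hWc _ _) (fun b => hWc' _)
        hC't (fun j b => hGC _ _) (fun b => (hstrong (q.2.1 b)).comp hθ.tendsto_atTop) hφ hφc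
      have e : ∀ {H : Fin (q.1 + 1) → E m → E m →L[ℝ] ℝ}, (∀ b z, z ∉ B → H b z = 0) →
          ∫ z in B, φ z * minorOf (basisDirections q.2.2) (fun b => H b z) =
            ∫ z, φ z * minorOf (basisDirections q.2.2) (fun b => H b z) := by
        intro H hH
        refine setIntegral_eq_integral_of_forall_compl_eq_zero fun z hz => ?_
        rw [minorOf_eq_zero _ 0 (hH 0 z hz), mul_zero]
      rw [e fun b z hz => hcut0 _ _ z hz]
      refine h1.congr fun j => ?_
      rw [e fun b z hz => hcut0 _ _ z hz])
  refine ⟨θ, s, a, hθ, hs, ha0, ha1, ?_⟩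
  have hsub : Metric.ball z₀ (r / 2) ⊆ B := Metric.ball_subset_ball (by linarith)
  filter_upwards [ae_restrict_of_ae hae, ae_restrict_of_ae_restrict_of_subset hsub hconv,
    ae_restrict_mem Metric.isOpen_ball.measurableSet] with z h1 h2 hz
  constructor
  · intro i
    rw [← tendsto_sub_nhds_zero_iff]
    refine (h1 i).congr fun j => ?_
    simp [hW, hW', hχ1 z hz]
  · intro q
    have e : ∀ (w : E m → ℝ) g, cutG w g z = g z := by
      intro w g
      simp [hcutG, hχ1 z hz, hDχ1 z hz]
    simpa only [hG, hG', e] using h2 q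

end Local

/-! ### Lower semicontinuity along convergent convex combinations of the minors -/

section Pointwise

/-- A power dominates a polynomial of smaller degree. -/
lemma exists_forall_polynomial_le_rpow {m : ℕ} {p : ℝ} (hp : (m : ℝ) < p) {c : ℝ} (hc : 0 < c)
    {K : ℝ} (hK : 0 ≤ K) (k₀ : ℝ) : ∃ R : ℝ, ∀ t, R ≤ t → K * (1 + t) ^ m + k₀ ≤ c * t ^ p := by
  have h := (tendsto_rpow_atTop (sub_pos.2 hp)).eventually_ge_atTop ((K * 2 ^ m + |k₀|) / c)
  obtain ⟨R, hR⟩ := eventually_atTop.1 h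
  refine ⟨max R 1, fun t ht => ?_⟩
  have ht1 : 1 ≤ t := (le_max_right _ _).trans ht
  have h1 := hR t ((le_max_left _ _).trans ht)
  rw [div_le_iff₀ hc] at h1
  have h2 : t ^ p = t ^ (p - m) * t ^ m := by
    rw [← Real.rpow_natCast t m, ← Real.rpow_add (by linarith), sub_add_cancel]
  have h3 : (1 : ℝ) ≤ t ^ m := one_le_pow₀ ht1
  have h4 : (1 + t) ^ m ≤ 2 ^ m * t ^ m := by
    rw [← mul_pow]
    exact pow_le_pow_left₀ (by linarith) (by linarith) m
  calc K * (1 + t) ^ m + k₀ ≤ K * (2 ^ m * t ^ m) + |k₀| * t ^ m := by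
        refine add_le_add (mul_le_mul_of_nonneg_left h4 hK) ((le_abs_self _).trans ?_)
        exact le_mul_of_one_le_right (abs_nonneg _) h3
    _ = (K * 2 ^ m + |k₀|) * t ^ m := by ring
    _ ≤ (t ^ (p - m) * c) * t ^ m := mul_le_mul_of_nonneg_right h1 (by positivity)
    _ = c * t ^ p := by rw [h2]; ring

/-- Let `U` be lower semicontinuous, coercive of degree `p > m`, and at `y₀` a convex function of
quantities `M` of degree at most `m`. If tail convex combinations of the `M (G j)` converge to `M F`
and `y j → y₀`, then the same convex combinations of the `U (y j) (G j)` are asymptotically at least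
`U y₀ F`. Indeed an affine minorant of the convex function that is almost exact at `M F` is, up to a
small error, a minorant of `U y` for all `y` near `y₀`. -/
lemma eventually_le_convex_combination {X W I : Type*} [TopologicalSpace X]
    [NormedAddCommGroup W] [ProperSpace W] [Fintype I] {m : ℕ} {p : ℝ} (hp : (m : ℝ) < p)
    {M : W → I → ℝ} (hM : Continuous M) {D : ℝ} (hD : 0 ≤ D)
    (hMD : ∀ G, ‖M G‖ ≤ D * (1 + ‖G‖) ^ m)
    {U : X → W → ℝ} (hU : LowerSemicontinuous fun q : X × W => U q.1 q.2)
    {a c : ℝ} (hc : 0 < c) (hUc : ∀ y G, a + c * ‖G‖ ^ p ≤ U y G)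
    {Φ : (I → ℝ) → ℝ} (hΦ : ConvexOn ℝ univ Φ) {y₀ : X} (hΦU : ∀ G, U y₀ G = Φ (M G))
    {y : ℕ → X} (hy : Tendsto y atTop (𝓝 y₀)) {G : ℕ → W} {F : W}
    {s : ℕ → Finset ℕ} {w : ℕ → ℕ → ℝ} (hs : ∀ n, ∀ j ∈ s n, n ≤ j) (hw : ∀ n j, 0 ≤ w n j)
    (hw1 : ∀ n, ∑ j ∈ s n, w n j = 1)
    (hlim : Tendsto (fun n => ∑ j ∈ s n, w n j • M (G j)) atTop (𝓝 (M F)))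
    {ε : ℝ} (hε : 0 < ε) :
    ∀ᶠ n in atTop, U y₀ F - ε ≤ ∑ j ∈ s n, w n j * U (y j) (G j) := by
  have hΦc : Continuous Φ := continuousOn_univ.1 (hΦ.continuousOn isOpen_univ)
  obtain ⟨ℓ, k, hℓ, hℓF⟩ := hΦ.exists_affine_le_of_lt (𝕜 := ℝ) (mem_univ (M F))
    (show Φ (M F) - ε / 3 < Φ (M F) by linarith) isClosed_univ
    (hΦc.lowerSemicontinuous.lowerSemicontinuousOn _)
  have hℓ' : ∀ ξ, ℓ ξ + k ≤ Φ ξ := fun ξ => hℓ ⟨ξ, mem_univ ξ⟩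
  have hℓF' : ℓ (M F) + k = Φ (M F) - ε / 3 := hℓF
  -- the affine minorant is a minorant of `U y`, for `y` near `y₀`
  have key : ∀ᶠ y in 𝓝 y₀, ∀ G, ℓ (M G) + k - ε / 3 ≤ U y G := by
    obtain ⟨R, hR⟩ := exists_forall_polynomial_le_rpow hp hc
      (mul_nonneg (norm_nonneg ℓ) hD) (k - a)
    have hK := (isCompact_closedBall (0 : W) R).eventually_forall_of_forall_eventually
      (x₀ := y₀) (P := fun y G => ℓ (M G) + k - ε / 3 ≤ U y G) fun G _ => by
        have h1 : LowerSemicontinuous fun q : X × W => U q.1 q.2 + -(ℓ (M q.2)) :=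
          hU.add (ℓ.continuous.comp (hM.comp continuous_snd)).neg.lowerSemicontinuous
        have h2 := h1 (y₀, G) (k - ε / 3) (by
          have := hℓ' (M G)
          simp only [hΦU]
          linarith)
        filter_upwards [h2] with q hq
        linarith
    filter_upwards [hK] with y hy G
    by_cases hG : ‖G‖ ≤ R
    · exact hy G (by simpa using hG)
    · have h1 := hR ‖G‖ (not_le.1 hG).le
      have h2 := hUc y G
      have h3 : ℓ (M G) ≤ ‖ℓ‖ * D * (1 + ‖G‖) ^ m := by
        rw [mul_assoc]
        exact (le_abs_self _).trans ((ℓ.le_opNorm _).trans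
          (mul_le_mul_of_nonneg_left (hMD G) (norm_nonneg _)))
      linarith
  obtain ⟨N, hN⟩ := eventually_atTop.1 (hy.eventually key)
  have hlim' : Tendsto (fun n => ℓ (∑ j ∈ s n, w n j • M (G j))) atTop (𝓝 (ℓ (M F))) :=
    (ℓ.continuous.tendsto _).comp hlim
  filter_upwards [eventually_ge_atTop N,
    hlim'.eventually (lt_mem_nhds (show ℓ (M F) - ε / 3 < ℓ (M F) by linarith))] with n hn hn'
  have h1 : ∑ j ∈ s n, w n j * (ℓ (M (G j)) + k - ε / 3) ≤ ∑ j ∈ s n, w n j * U (y j) (G j) :=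
    Finset.sum_le_sum fun j hj =>
      mul_le_mul_of_nonneg_left (hN j (hn.trans (hs n j hj)) _) (hw n j)
  have h2 : ∑ j ∈ s n, w n j * (ℓ (M (G j)) + k - ε / 3) =
      ℓ (∑ j ∈ s n, w n j • M (G j)) + (k - ε / 3) := by
    rw [map_sum]
    simp only [map_smul, smul_eq_mul, add_sub_assoc, mul_add, Finset.sum_add_distrib]
    rw [← Finset.sum_mul, hw1, one_mul]
  rw [h2] at h1
  have h3 := hΦU F
  linarith

lemma continuous_minors {d m : ℕ} {V : Submodule ℝ (E d)} (v : Fin m → V) :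
    Continuous fun F : V →L[ℝ] E d => minors (coordMatrix v F) := by
  refine continuous_pi fun q => ?_
  refine Continuous.matrix_det (continuous_matrix fun a b => ?_)
  simp only [coordMatrix, Matrix.submatrix_apply, Matrix.of_apply]
  fun_prop

lemma exists_norm_minors_le {d m : ℕ} {V : Submodule ℝ (E d)} (v : Fin m → V) :
    ∃ D : ℝ, 0 ≤ D ∧ ∀ F : V →L[ℝ] E d, ‖minors (coordMatrix v F)‖ ≤ D * (1 + ‖F‖) ^ m := by
  set S : ℝ := 1 + ∑ j, ‖v j‖ with hS
  have hS1 : 1 ≤ S := by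
    have : 0 ≤ ∑ j, ‖v j‖ := Finset.sum_nonneg fun _ _ => norm_nonneg _
    linarith
  have hvS : ∀ j, ‖v j‖ ≤ S := fun j => by
    have := Finset.single_le_sum (f := fun j => ‖v j‖) (fun _ _ => norm_nonneg _)
      (Finset.mem_univ j)
    linarith
  refine ⟨(m.factorial : ℝ) * S ^ m, by positivity, fun F => ?_⟩
  refine (pi_norm_le_iff_of_nonneg (by positivity)).2 fun q => ?_
  have h1 := Matrix.det_le (abv := AbsoluteValue.abs)
    (A := (coordMatrix v F).submatrix q.2.1 q.2.2) (x := (1 + ‖F‖) * S) fun a b => by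
      simp only [coordMatrix, Matrix.submatrix_apply, Matrix.of_apply, AbsoluteValue.abs_apply]
      rw [← Real.norm_eq_abs]
      refine (PiLp.norm_apply_le _ _).trans ((F.le_opNorm _).trans ?_)
      exact mul_le_mul (by linarith) (hvS _) (norm_nonneg _) (by positivity)
  have hk : (q.1 : ℕ) + 1 ≤ m := q.1.2
  have hx : 1 ≤ (1 + ‖F‖) * S := by nlinarith [norm_nonneg F]
  simp only [Fintype.card_fin, nsmul_eq_mul, AbsoluteValue.abs_apply] at h1
  rw [Real.norm_eq_abs]
  refine h1.trans ?_
  calc (((q.1 : ℕ) + 1).factorial : ℝ) * ((1 + ‖F‖) * S) ^ ((q.1 : ℕ) + 1)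
      ≤ (m.factorial : ℝ) * ((1 + ‖F‖) * S) ^ m := by
        refine mul_le_mul ?_ (pow_le_pow_right₀ hx hk) (by positivity) (by positivity)
        exact_mod_cast Nat.factorial_le hk
    _ = _ := by rw [mul_pow]; ring

/-- Multilinearity of a minor in the directions. -/
lemma minorOf_eq_sum_basisDirections {m k : ℕ} (b : Fin k → E m) (ξ : Fin k → E m →L[ℝ] ℝ) :
    minorOf b ξ = ∑ σ : Fin k → Fin m, (∏ l, b l (σ l)) * minorOf (basisDirections σ) ξ := by
  have h : ∀ t : Fin k → E m, minorOf t ξ =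
      Matrix.detRowAlternating.toMultilinearMap (fun (j : Fin k) (i : Fin k) => ξ i (t j)) := by
    intro t
    rw [minorOf, ← Matrix.det_transpose]
    rfl
  have h2 : (fun (j : Fin k) (i : Fin k) => ξ i (b j)) =
      fun j => ∑ l : Fin m, b j l • fun i => ξ i (EuclideanSpace.single l 1) := by
    funext j i
    have e : b j = ∑ l : Fin m, b j l • EuclideanSpace.single l (1 : ℝ) := by
      ext t
      simp [Finset.sum_apply, Pi.single_apply]
    conv_lhs => rw [e]
    simp [Finset.sum_apply]
  rw [h, h2, MultilinearMap.map_sum]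
  refine Finset.sum_congr rfl fun σ _ => ?_
  rw [MultilinearMap.map_smul_univ, h, smul_eq_mul]
  rfl

/-- Convergence of convex combinations of all the minors in a chart carries over to the minors with
respect to any family of tangent vectors. -/
lemma tendsto_minors_of_tendsto_minorOf {d m : ℕ} {V : Submodule ℝ (E d)} {L : E m →L[ℝ] E d}
    (v : Fin m → V) (hv : ∀ j, ∃ b, L b = v j)
    {A : ℕ → E d →L[ℝ] E d} {A' : E d →L[ℝ] E d} {s : ℕ → Finset ℕ} {a : ℕ → ℕ → ℝ}
    (h : ∀ q : ChartMinorIndex d m, Tendsto (fun n => ∑ j ∈ s n, a n j *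
      minorOf (basisDirections q.2.2)
        (fun b => EuclideanSpace.proj (q.2.1 b) ∘L (A j ∘L L))) atTop
      (𝓝 (minorOf (basisDirections q.2.2)
        (fun b => EuclideanSpace.proj (q.2.1 b) ∘L (A' ∘L L))))) :
    Tendsto (fun n => ∑ j ∈ s n, a n j • minors (coordMatrix v ((A j).comp V.subtypeL))) atTop
      (𝓝 (minors (coordMatrix v (A'.comp V.subtypeL)))) := by
  choose b hb using hv
  refine tendsto_pi_nhds.2 fun q => ?_
  have e : ∀ B : E d →L[ℝ] E d, minors (coordMatrix v (B.comp V.subtypeL)) q =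
      ∑ σ : Fin (q.1 + 1) → Fin m, (∏ l, b (q.2.2 l) (σ l)) * minorOf (basisDirections σ)
        (fun r => EuclideanSpace.proj (q.2.1 r) ∘L (B ∘L L)) := by
    intro B
    rw [← minorOf_eq_sum_basisDirections (fun l => b (q.2.2 l))]
    rw [minors, minorOf]
    congr 1
    ext r l
    simp [coordMatrix, hb]
  simp only [Finset.sum_apply, Pi.smul_apply, smul_eq_mul, e, Finset.mul_sum]
  simp_rw [Finset.sum_comm (s := s _)]
  refine tendsto_finsetSum _ fun σ _ => ?_
  have h1 := (h ⟨q.1, q.2.1, σ⟩).const_mul (∏ l, b (q.2.2 l) (σ l))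
  refine h1.congr fun n => ?_
  rw [Finset.mul_sum]
  exact Finset.sum_congr rfl fun j _ => by ring

end Pointwise

/-! ### Tangent spaces, normals and null sets in a chart -/

namespace GraphChart

variable {d : ℕ} {Ω : Set (E d)} (c : GraphChart Ω)

/-- The horizontal coordinate `R z + t e ↦ z` of a chart, which is the adjoint of `R`. -/
noncomputable def proj : E d →L[ℝ] E (d - 1) :=
  ContinuousLinearMap.adjoint c.R.toContinuousLinearMap

/-- The height `R z + t e ↦ t - f z` above the graph. -/
noncomputable def height (x : E d) : ℝ := inner ℝ c.e x - c.f (c.proj x)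

/-- The neighbourhood of a piece of the graph, of horizontal radius `ρ`, in which `Ω` is described
by the chart. -/
def tube (ρ : ℝ) : Set (E d) := {x | c.proj x ∈ Metric.ball c.z₀ ρ ∧ |c.height x| < c.β}

lemma inner_e_R (z : E (d - 1)) : inner ℝ c.e (c.R z) = 0 := by
  rw [real_inner_comm]
  exact c.orthogonal z

lemma inner_e_e : inner ℝ c.e c.e = 1 := by
  rw [real_inner_self_eq_norm_sq, c.norm_e, one_pow]

lemma inner_proj (x : E d) (z : E (d - 1)) : inner ℝ (c.proj x) z = inner ℝ x (c.R z) :=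
  ContinuousLinearMap.adjoint_inner_left _ _ _

lemma proj_R (z : E (d - 1)) : c.proj (c.R z) = z := by
  refine ext_inner_right ℝ fun w => ?_
  rw [inner_proj, c.R.inner_map_map]

lemma proj_e : c.proj c.e = 0 := by
  refine ext_inner_right ℝ fun w => ?_
  rw [inner_proj, inner_e_R, inner_zero_left]

lemma proj_param (z : E (d - 1)) : c.proj (c.param z) = z := by
  simp [param, proj_R, proj_e]

lemma height_param (z : E (d - 1)) : c.height (c.param z) = 0 := by
  rw [height, proj_param, param, inner_add_right, inner_e_R, inner_smul_right, inner_e_e]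
  ring

/-- The chart coordinates determine a point. -/
lemma R_proj_add (hd : 1 ≤ d) (x : E d) : c.R (c.proj x) + inner ℝ c.e x • c.e = x := by
  set V : Submodule ℝ (E d) := LinearMap.range c.R.toLinearMap with hV
  have hfV : Module.finrank ℝ V = d - 1 := by
    rw [hV, LinearMap.finrank_range_of_inj c.R.injective]
    simp
  have hfV' : Module.finrank ℝ Vᗮ = 1 := by
    have h1 := V.finrank_add_finrank_orthogonal
    rw [hfV, finrank_euclideanSpace, Fintype.card_fin] at h1
    omega
  have he : c.e ∈ Vᗮ := by
    rw [Submodule.mem_orthogonal]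
    rintro _ ⟨z, rfl⟩
    exact c.orthogonal z
  have hx : x - c.R (c.proj x) ∈ Vᗮ := by
    rw [Submodule.mem_orthogonal']
    rintro _ ⟨z, rfl⟩
    change inner ℝ _ (c.R z) = 0
    rw [inner_sub_left, ← inner_proj, c.R.inner_map_map, sub_self]
  have he0 : (⟨c.e, he⟩ : Vᗮ) ≠ 0 := by
    intro h
    have h1 := c.norm_e
    rw [show c.e = 0 from congrArg Subtype.val h, norm_zero] at h1
    exact zero_ne_one h1
  obtain ⟨t, ht⟩ := (finrank_eq_one_iff_of_nonzero' _ he0).1 hfV' ⟨_, hx⟩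
  have ht' : t • c.e = x - c.R (c.proj x) := congrArg Subtype.val ht
  have h2 : inner ℝ c.e x = t := by
    have h3 : x = c.R (c.proj x) + t • c.e := by rw [ht']; abel
    rw [h3, inner_add_right, inner_e_R, inner_smul_right, inner_e_e]
    ring
  rw [h2, ht']
  abel

lemma continuous_height : Continuous c.height := by
  unfold height
  exact (continuous_const.inner continuous_id).sub (c.lipschitz.continuous.comp c.proj.continuous)

lemma isOpen_tube (ρ : ℝ) : IsOpen (c.tube ρ) :=
  (Metric.isOpen_ball.preimage c.proj.continuous).inter
    (isOpen_lt c.continuous_height.abs continuous_const)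

lemma param_mem_tube {ρ : ℝ} {z : E (d - 1)} (hz : z ∈ Metric.ball c.z₀ ρ) :
    c.param z ∈ c.tube ρ := by
  refine ⟨by rwa [proj_param], ?_⟩
  rw [height_param, abs_zero]
  exact c.β_pos

lemma mem_iff_height_neg (hd : 1 ≤ d) {x : E d} (hx : x ∈ c.tube c.r) :
    x ∈ Ω ↔ c.height x < 0 := by
  have h := c.mem_iff (c.proj x) hx.1 (inner ℝ c.e x) hx.2
  rw [c.R_proj_add hd] at h
  rw [h, height, sub_neg]

lemma notMem_closure_of_height_pos (hd : 1 ≤ d) {x : E d} (hx : x ∈ c.tube c.r)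
    (h : 0 < c.height x) : x ∉ closure Ω := by
  intro hcl
  have ho : IsOpen (c.tube c.r ∩ {y | 0 < c.height y}) :=
    (c.isOpen_tube _).inter (isOpen_lt continuous_const c.continuous_height)
  obtain ⟨y, hy, hyΩ⟩ := mem_closure_iff.1 hcl _ ho ⟨hx, h⟩
  exact lt_asymm hy.2 ((c.mem_iff_height_neg hd hy.1).1 hyΩ)

lemma height_eq_zero_of_mem_frontier (hd : 1 ≤ d) (hΩ : IsOpen Ω) {x : E d}
    (hx : x ∈ c.tube c.r) (hxf : x ∈ frontier Ω) : c.height x = 0 := by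
  rw [hΩ.frontier_eq] at hxf
  refine le_antisymm (not_lt.1 fun h => c.notMem_closure_of_height_pos hd hx h hxf.1)
    (not_lt.1 fun h => hxf.2 ((c.mem_iff_height_neg hd hx).2 h))

lemma param_proj_of_mem_frontier (hd : 1 ≤ d) (hΩ : IsOpen Ω) {x : E d}
    (hx : x ∈ c.tube c.r) (hxf : x ∈ frontier Ω) : c.param (c.proj x) = x := by
  have h := c.height_eq_zero_of_mem_frontier hd hΩ hx hxf
  rw [height, sub_eq_zero] at h
  rw [param, ← h, c.R_proj_add hd]

/-- Null sets of the parameter domain give null sets of the boundary, because the parametrization is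
Lipschitz. -/
lemma ae_tube (hd : 1 ≤ d) (hΩ : IsOpen Ω) {ρ : ℝ} (hρ : ρ ≤ c.r) {Q : E d → Prop}
    (h : ∀ᵐ z ∂volume.restrict (Metric.ball c.z₀ ρ), Q (c.param z)) :
    ∀ᵐ x ∂(surface Ω).restrict (c.tube ρ), Q x := by
  rw [ae_restrict_iff' Metric.isOpen_ball.measurableSet] at h
  rw [ae_restrict_iff' (c.isOpen_tube ρ).measurableSet, surface,
    ae_restrict_iff' isClosed_frontier.measurableSet]
  obtain ⟨K, hK⟩ := c.lipschitz_param
  set N : Set (E (d - 1)) := {z | ¬ (z ∈ Metric.ball c.z₀ ρ → Q (c.param z))} with hN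
  have hN0 : volume N = 0 := h
  have hN1 : (Measure.hausdorffMeasure ((d - 1 : ℕ) : ℝ) : Measure (E (d - 1))) N = 0 := by
    rw [← EuclideanSpace.euclideanHausdorffMeasure_eq_volume,
      Measure.euclideanHausdorffMeasure_def, Measure.smul_apply, smul_eq_zero] at hN0
    exact hN0.resolve_left (Measure.addHaarScalarFactor_volume_hausdorffMeasure_ne_zero _)
  have h2 : (Measure.hausdorffMeasure ((d - 1 : ℕ) : ℝ) : Measure (E d)) (c.param '' N) = 0 := by
    have h3 := (hK.lipschitzOnWith (s := N)).hausdorffMeasure_image_le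
      (Nat.cast_nonneg (α := ℝ) (d - 1))
    rw [hN1, mul_zero] at h3
    exact le_antisymm h3 zero_le
  have h3 : (μHE[d - 1] : Measure (E d)) (c.param '' N) = 0 := by
    rw [Measure.euclideanHausdorffMeasure_def, Measure.smul_apply, h2, smul_zero]
  refine measure_mono_null (fun x hx => ?_) h3
  simp only [mem_compl_iff, mem_ofPred_eq, Classical.not_imp] at hx
  obtain ⟨hxf, hxt, hxQ⟩ := hx
  have e := c.param_proj_of_mem_frontier hd hΩ
    ⟨Metric.ball_subset_ball hρ hxt.1, hxt.2⟩ hxf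
  refine ⟨c.proj x, ?_, e⟩
  simp only [hN, mem_ofPred_eq, Classical.not_imp, e]
  exact ⟨hxt.1, hxQ⟩

lemma hasFDerivAt_param {z : E (d - 1)} (hz : DifferentiableAt ℝ c.f z) :
    HasFDerivAt c.param (c.R.toContinuousLinearMap + (fderiv ℝ c.f z).smulRight c.e) z :=
  c.R.toContinuousLinearMap.hasFDerivAt.add (hz.hasFDerivAt.smul_const c.e)

lemma fderiv_param_apply {z : E (d - 1)} (hz : DifferentiableAt ℝ c.f z) (w : E (d - 1)) :
    fderiv ℝ c.param z w = c.R w + fderiv ℝ c.f z w • c.e := by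
  rw [(c.hasFDerivAt_param hz).fderiv]
  rfl

lemma hasFDerivAt_height {z : E (d - 1)} (hz : DifferentiableAt ℝ c.f z) :
    HasFDerivAt c.height (innerSL ℝ c.e - (fderiv ℝ c.f z) ∘L c.proj) (c.param z) := by
  have h1 : HasFDerivAt (fun x : E d => inner ℝ c.e x) (innerSL ℝ c.e) (c.param z) :=
    (innerSL ℝ c.e).hasFDerivAt
  have h2 : HasFDerivAt c.f (fderiv ℝ c.f z) (c.proj (c.param z)) := by
    rw [proj_param]
    exact hz.hasFDerivAt
  exact h1.sub (h2.comp _ c.proj.hasFDerivAt)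

/-- Where the graph function is differentiable, the tangent space is the range of the derivative of
the parametrization. -/
lemma tangentSpace_param (hd : 1 ≤ d) (hΩ : IsOpen Ω) {z : E (d - 1)} (hz : z ∈ c.dom)
    (hfz : DifferentiableAt ℝ c.f z) :
    tangentSpace Ω (c.param z) = LinearMap.range (fderiv ℝ c.param z).toLinearMap := by
  refine le_antisymm (Submodule.span_le.2 fun y hy => ?_) ?_
  · rw [← tangentConeAt_inter_nhds ((c.isOpen_tube c.r).mem_nhds (c.param_mem_tube hz))] at hy
    have h1 := (c.hasFDerivAt_height hfz).hasFDerivWithinAt.mapsTo_tangent_cone hy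
    have h2 : c.height '' (frontier Ω ∩ c.tube c.r) ⊆ {0} := by
      rintro _ ⟨x, hx, rfl⟩
      exact c.height_eq_zero_of_mem_frontier hd hΩ hx.2 hx.1
    have h3 := tangentConeAt_mono h2 h1
    have h4 := tangentConeAt_subset_zero (𝕜 := ℝ) (s := {(0 : ℝ)}) (x := c.height (c.param z))
      (by
        intro h
        rw [accPt_iff_nhds] at h
        obtain ⟨y, hy, hne⟩ := h univ univ_mem
        rw [height_param] at hne
        exact hne hy.2) h3
    have h5 : inner ℝ c.e y - fderiv ℝ c.f z (c.proj y) = 0 := h4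
    refine ⟨c.proj y, ?_⟩
    change fderiv ℝ c.param z (c.proj y) = y
    rw [c.fderiv_param_apply hfz, ← sub_eq_zero.1 h5, c.R_proj_add hd]
  · rintro _ ⟨w, rfl⟩
    refine Submodule.subset_span ?_
    have h1 := (c.hasFDerivAt_param hfz).differentiableAt.hasFDerivAt.hasFDerivWithinAt
      (s := c.dom) |>.mapsTo_tangent_cone
    have h2 : w ∈ tangentConeAt ℝ c.dom z := by
      rw [tangentConeAt_of_mem_nhds (c.isOpen_dom.mem_nhds hz)]
      trivial
    exact tangentConeAt_mono (by
      rintro _ ⟨y, hy, rfl⟩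
      exact c.param_mem_frontier hΩ hy) (h1 h2)

lemma finrank_tangentSpace (hd : 1 ≤ d) (hΩ : IsOpen Ω) {z : E (d - 1)} (hz : z ∈ c.dom)
    (hfz : DifferentiableAt ℝ c.f z) : Module.finrank ℝ (tangentSpace Ω (c.param z)) + 1 = d := by
  have hinj : Function.Injective (fderiv ℝ c.param z).toLinearMap := by
    refine Function.LeftInverse.injective (g := c.proj) fun w => ?_
    change c.proj (fderiv ℝ c.param z w) = w
    simp [c.fderiv_param_apply hfz, proj_R, proj_e]
  rw [c.tangentSpace_param hd hΩ hz hfz, LinearMap.finrank_range_of_inj hinj]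
  simp
  omega

/-- An upward normal vector to the graph. -/
noncomputable def normalVector (z : E (d - 1)) : E d :=
  c.e - c.R ((InnerProductSpace.toDual ℝ (E (d - 1))).symm (fderiv ℝ c.f z))

lemma inner_e_normalVector (z : E (d - 1)) : inner ℝ c.e (c.normalVector z) = 1 := by
  rw [normalVector, inner_sub_right, inner_e_e, inner_e_R, sub_zero]

lemma normalVector_ne_zero (z : E (d - 1)) : c.normalVector z ≠ 0 := by
  intro h
  have := c.inner_e_normalVector z
  rw [h, inner_zero_right] at this
  exact zero_ne_one this

lemma normalVector_mem (hd : 1 ≤ d) (hΩ : IsOpen Ω) {z : E (d - 1)} (hz : z ∈ c.dom)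
    (hfz : DifferentiableAt ℝ c.f z) : c.normalVector z ∈ (tangentSpace Ω (c.param z))ᗮ := by
  rw [c.tangentSpace_param hd hΩ hz hfz, Submodule.mem_orthogonal']
  rintro _ ⟨w, rfl⟩
  change inner ℝ _ (fderiv ℝ c.param z w) = 0
  rw [c.fderiv_param_apply hfz, normalVector, inner_sub_left, inner_add_right, inner_add_right,
    inner_e_R, inner_smul_right, inner_smul_right, inner_e_e, c.R.inner_map_map, c.orthogonal,
    InnerProductSpace.toDual_symm_apply]
  ring

/-- The unit upward normal to the graph. -/
noncomputable def unitNormal (z : E (d - 1)) : E d := ‖c.normalVector z‖⁻¹ • c.normalVector z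

lemma unitNormal_mem (hd : 1 ≤ d) (hΩ : IsOpen Ω) {z : E (d - 1)} (hz : z ∈ c.dom)
    (hfz : DifferentiableAt ℝ c.f z) : c.unitNormal z ∈ unitNormals Ω (c.param z) :=
  ⟨Submodule.smul_mem _ _ (c.normalVector_mem hd hΩ hz hfz),
    norm_smul_inv_norm (c.normalVector_ne_zero z)⟩

/-- The upward normal points out of `Ω`, because the height has a positive derivative along it. -/
lemma isOutwardNormal_unitNormal (hd : 1 ≤ d) (hΩ : IsOpen Ω) {z : E (d - 1)} (hz : z ∈ c.dom)
    (hfz : DifferentiableAt ℝ c.f z) : IsOutwardNormal Ω (c.param z) (c.unitNormal z) := by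
  refine ⟨c.unitNormal_mem hd hΩ hz hfz, ?_⟩
  set n := c.unitNormal z with hn
  have hline : HasDerivAt (fun t : ℝ => c.param z + t • n) n 0 := by
    simpa using ((hasDerivAt_id (0 : ℝ)).smul_const n).const_add (c.param z)
  have hH : HasFDerivAt c.height (innerSL ℝ c.e - (fderiv ℝ c.f z) ∘L c.proj)
      (c.param z + (0 : ℝ) • n) := by
    simpa using c.hasFDerivAt_height hfz
  have hderiv := hH.comp_hasDerivAt 0 hline
  have hpos : 0 < (innerSL ℝ c.e - (fderiv ℝ c.f z) ∘L c.proj) n := by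
    have h1 : (innerSL ℝ c.e - (fderiv ℝ c.f z) ∘L c.proj) (c.normalVector z) =
        1 + ‖(InnerProductSpace.toDual ℝ (E (d - 1))).symm (fderiv ℝ c.f z)‖ ^ 2 := by
      have h2 : c.proj (c.normalVector z) =
          -(InnerProductSpace.toDual ℝ (E (d - 1))).symm (fderiv ℝ c.f z) := by
        simp [normalVector, proj_e, proj_R]
      rw [_root_.sub_apply, innerSL_apply_apply, inner_e_normalVector,
        ContinuousLinearMap.comp_apply, h2, map_neg, ← real_inner_self_eq_norm_sq,
        InnerProductSpace.toDual_symm_apply]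
      ring
    rw [hn, unitNormal, map_smul, h1, smul_eq_mul]
    have := norm_pos_iff.2 (c.normalVector_ne_zero z)
    positivity
  have hφ0 : (c.height ∘ fun t : ℝ => c.param z + t • n) 0 = 0 := by simp [height_param]
  have hcont : Continuous fun t : ℝ => c.param z + t • n := by fun_prop
  have htube : ∀ᶠ t : ℝ in 𝓝 0, c.param z + t • n ∈ c.tube c.r :=
    hcont.continuousAt.eventually_mem ((c.isOpen_tube _).mem_nhds
      (by simpa using c.param_mem_tube hz))
  -- the height has the sign of `t` along the normal line
  have hslope := hasDerivAt_iff_tendsto_slope.1 hderiv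
  have hsgn : ∀ᶠ t in 𝓝[≠] (0 : ℝ), 0 < slope (c.height ∘ fun t : ℝ => c.param z + t • n) 0 t :=
    hslope.eventually (lt_mem_nhds hpos)
  have hsgn' : ∀ᶠ t in 𝓝[≠] (0 : ℝ), 0 < t⁻¹ * c.height (c.param z + t • n) ∧
      c.param z + t • n ∈ c.tube c.r := by
    filter_upwards [hsgn, nhdsWithin_le_nhds htube] with t ht ht'
    refine ⟨?_, ht'⟩
    simpa [slope, height_param] using ht
  have hR : Tendsto (fun t : ℝ => t) (𝓝[>] 0) (𝓝[≠] 0) :=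
    nhdsWithin_mono _ fun t ht => (ne_of_gt ht : t ≠ 0)
  have hL : Tendsto (fun t : ℝ => -t) (𝓝[>] 0) (𝓝[≠] 0) := by
    refine tendsto_nhdsWithin_iff.2 ⟨?_, ?_⟩
    · exact (continuous_neg.tendsto' (0 : ℝ) 0 neg_zero).mono_left nhdsWithin_le_nhds
    · filter_upwards [self_mem_nhdsWithin] with t ht
      simpa using (ne_of_gt ht : t ≠ 0)
  filter_upwards [hR.eventually hsgn', hL.eventually hsgn', self_mem_nhdsWithin] with t h1 h2 ht
  have ht : 0 < t := ht
  constructor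
  · rw [neg_smul, ← sub_eq_add_neg] at h2
    rw [c.mem_iff_height_neg hd h2.2]
    have h3 := h2.1
    rw [inv_neg, neg_mul, neg_pos] at h3
    by_contra h
    exact absurd h3 (not_lt.2 (mul_nonneg (inv_pos.2 ht).le (not_lt.1 h)))
  · exact c.notMem_closure_of_height_pos hd h1.2
      ((mul_pos_iff_of_pos_left (inv_pos.2 ht)).1 h1.1)

/-- The outward normal is unique, since the normal space is a line and the opposite unit vector points
into `Ω`. -/
lemma outwardNormal_param (hd : 1 ≤ d) (hΩ : IsOpen Ω) {z : E (d - 1)} (hz : z ∈ c.dom)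
    (hfz : DifferentiableAt ℝ c.f z) : outwardNormal Ω (c.param z) = c.unitNormal z := by
  have hN := c.isOutwardNormal_unitNormal hd hΩ hz hfz
  have hex : ∃ n, IsOutwardNormal Ω (c.param z) n := ⟨_, hN⟩
  rw [outwardNormal, dif_pos hex]
  have hn := hex.choose_spec
  set n := hex.choose
  set N := c.unitNormal z
  -- the normal space is a line
  have hf1 : Module.finrank ℝ (tangentSpace Ω (c.param z))ᗮ = 1 := by
    have h1 := (tangentSpace Ω (c.param z)).finrank_add_finrank_orthogonal
    have h2 := c.finrank_tangentSpace hd hΩ hz hfz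
    rw [finrank_euclideanSpace, Fintype.card_fin] at h1
    omega
  have hN0 : (⟨N, hN.1.1⟩ : (tangentSpace Ω (c.param z))ᗮ) ≠ 0 := by
    intro h
    have h1 := hN.1.2
    rw [show N = 0 from congrArg Subtype.val h, norm_zero] at h1
    exact zero_ne_one h1
  obtain ⟨t, ht⟩ := (finrank_eq_one_iff_of_nonzero' _ hN0).1 hf1 ⟨n, hn.1.1⟩
  have ht' : t • N = n := congrArg Subtype.val ht
  have habs : |t| = 1 := by
    have h1 := hn.1.2
    rw [← ht', norm_smul, hN.1.2, mul_one, Real.norm_eq_abs] at h1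
    exact h1
  rcases (abs_eq zero_le_one).1 habs with h | h
  · rw [← ht', h, one_smul]
  · exfalso
    rw [h, neg_one_smul] at ht'
    obtain ⟨τ, h1, h2⟩ := (hn.2.and hN.2).exists
    refine h2.2 (subset_closure ?_)
    have h3 := h1.1
    rw [← ht', smul_neg, sub_neg_eq_add] at h3
    exact h3

lemma measurable_unitNormal : Measurable c.unitNormal := by
  have h1 : Measurable c.normalVector :=
    measurable_const.sub (c.R.continuous.measurable.comp
      ((LinearIsometryEquiv.continuous _).measurable.comp (measurable_fderiv ℝ c.f)))
  exact h1.norm.inv.smul h1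

lemma ae_differentiableAt : ∀ᵐ z ∂(volume : Measure (E (d - 1))), DifferentiableAt ℝ c.f z :=
  c.lipschitz.ae_differentiableAt

/-- Almost every boundary point in a tube is regular, and the outward normal there is a unit normal,
given by the chart. -/
lemma ae_tube_outwardNormal (hd : 1 ≤ d) (hΩ : IsOpen Ω) :
    ∀ᵐ x ∂(surface Ω).restrict (c.tube c.r), x ∈ regularBoundary Ω ∧
      outwardNormal Ω x ∈ unitNormals Ω x ∧ outwardNormal Ω x = c.unitNormal (c.proj x) := by
  refine c.ae_tube hd hΩ le_rfl ?_
  filter_upwards [ae_restrict_of_ae c.ae_differentiableAt,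
    ae_restrict_mem Metric.isOpen_ball.measurableSet] with z hfz hz
  rw [proj_param, c.outwardNormal_param hd hΩ hz hfz]
  exact ⟨⟨c.param_mem_frontier hΩ hz, c.finrank_tangentSpace hd hΩ hz hfz⟩,
    c.unitNormal_mem hd hΩ hz hfz, rfl⟩

end GraphChart

/-- Every point of a Lipschitz boundary is in the tube of half the radius of some chart. -/
lemma HasLipschitzBoundary.exists_mem_tube {d : ℕ} {Ω : Set (E d)}
    (h : HasLipschitzBoundary Ω) {x : E d} (hx : x ∈ frontier Ω) :
    ∃ c : GraphChart Ω, x ∈ c.tube (c.r / 2) := by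
  obtain ⟨c, z, hz, rfl⟩ := h x hx
  have hz' : dist z c.z₀ < c.r := hz
  -- the chart is restricted to a ball around the given point
  let c' : GraphChart Ω :=
    { c with
      z₀ := z
      r := c.r - dist z c.z₀
      r_pos := sub_pos.2 hz'
      mem_iff := fun y hy t ht => c.mem_iff y (by
        rw [Metric.mem_ball] at hy ⊢
        linarith [dist_triangle y z c.z₀]) t ht }
  exact ⟨c', c'.param_mem_tube (z := z) (Metric.mem_ball_self (half_pos c'.r_pos))⟩

/-- Finitely many tubes of half the radius cover the boundary of a bounded Lipschitz set. -/
lemma HasLipschitzBoundary.exists_finite_cover {d : ℕ} {Ω : Set (E d)}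
    (h : HasLipschitzBoundary Ω) (hb : Bornology.IsBounded Ω) :
    ∃ (N : ℕ) (c : Fin N → GraphChart Ω), frontier Ω ⊆ ⋃ i, (c i).tube ((c i).r / 2) := by
  have hK : IsCompact (frontier Ω) := hb.isCompact_closure.of_isClosed_subset isClosed_frontier
    frontier_subset_closure
  obtain ⟨t, ht⟩ := hK.elim_finite_subcover (fun c : GraphChart Ω => c.tube (c.r / 2))
    (fun c => c.isOpen_tube _) fun x hx => by
      obtain ⟨c, hc⟩ := h.exists_mem_tube hx
      exact mem_iUnion.2 ⟨c, hc⟩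
  refine ⟨t.card, fun i => (t.equivFin.symm i : GraphChart Ω), fun x hx => ?_⟩
  obtain ⟨c, hc, hxc⟩ := mem_iUnion₂.1 (ht hx)
  exact mem_iUnion.2 ⟨t.equivFin ⟨c, hc⟩, by simpa using hxc⟩

lemma restrict_surface_of_cover {d : ℕ} {Ω : Set (E d)} {N : ℕ} {O : Fin N → Set (E d)}
    (hO : frontier Ω ⊆ ⋃ i, O i) : (surface Ω).restrict (⋃ i, O i) = surface Ω := by
  refine Measure.restrict_eq_self_of_ae_mem ?_
  filter_upwards [ae_restrict_mem (μ := μHE[d - 1]) isClosed_frontier.measurableSet] with x hx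
    using hO hx

/-- If finitely many open sets cover the boundary, then a property that holds almost everywhere on
each of them holds almost everywhere on the boundary. -/
lemma ae_surface_of_cover {d : ℕ} {Ω : Set (E d)} {N : ℕ} {O : Fin N → Set (E d)}
    (hO : frontier Ω ⊆ ⋃ i, O i) {Q : E d → Prop}
    (h : ∀ i, ∀ᵐ x ∂(surface Ω).restrict (O i), Q x) : ∀ᵐ x ∂surface Ω, Q x := by
  have h1 : ∀ᵐ x ∂(surface Ω).restrict (⋃ i, O i), Q x := (ae_restrict_iUnion_iff _ _).2 h
  rwa [restrict_surface_of_cover hO] at h1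

lemma HasLipschitzBoundary.ae_regular {d : ℕ} {Ω : Set (E d)} (h : HasLipschitzBoundary Ω)
    (hb : Bornology.IsBounded Ω) (hd : 1 ≤ d) (hΩ : IsOpen Ω) :
    ∀ᵐ x ∂surface Ω, x ∈ regularBoundary Ω ∧ outwardNormal Ω x ∈ unitNormals Ω x := by
  obtain ⟨N, c, hc⟩ := h.exists_finite_cover hb
  refine ae_surface_of_cover (O := fun i => (c i).tube (c i).r)
    (hc.trans (iUnion_mono fun i => ?_)) fun i => ?_
  · exact fun x hx => ⟨Metric.ball_subset_ball (by linarith [(c i).r_pos]) hx.1, hx.2⟩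
  · filter_upwards [(c i).ae_tube_outwardNormal hd hΩ] with x hx using ⟨hx.1, hx.2.1⟩

lemma HasLipschitzBoundary.aemeasurable_outwardNormal {d : ℕ} {Ω : Set (E d)}
    (h : HasLipschitzBoundary Ω) (hb : Bornology.IsBounded Ω) (hd : 1 ≤ d) (hΩ : IsOpen Ω) :
    AEMeasurable (outwardNormal Ω) (surface Ω) := by
  obtain ⟨N, c, hc⟩ := h.exists_finite_cover hb
  have hO : frontier Ω ⊆ ⋃ i, (c i).tube (c i).r := hc.trans (iUnion_mono fun i x hx =>
    ⟨Metric.ball_subset_ball (by linarith [(c i).r_pos]) hx.1, hx.2⟩)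
  rw [← restrict_surface_of_cover hO, aemeasurable_iUnion_iff]
  intro i
  refine AEMeasurable.congr
    ((c i).measurable_unitNormal.comp (c i).proj.continuous.measurable).aemeasurable ?_
  filter_upwards [(c i).ae_tube_outwardNormal hd hΩ] with x hx using hx.2.2.symm

/-! ### Sobolev functions in a chart -/

section Charts

variable {d : ℕ} {Ω : Set (E d)} {hΩ : IsOpen Ω} {P : ℝ≥0∞} [Fact (1 ≤ P)]

namespace GraphChart

variable (c : GraphChart Ω)

/-- The `i`-th component of a Sobolev function in a chart. -/
noncomputable def pullback (u : sobolev Ω hΩ P) (i : Fin d) (z : E (d - 1)) : ℝ :=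
  u.1.1 (c.param z) i

/-- The gradient of the `i`-th component of a Sobolev function in a chart. -/
noncomputable def pullbackGradient (u : sobolev Ω hΩ P) (i : Fin d) (z : E (d - 1)) :
    E (d - 1) →L[ℝ] ℝ :=
  EuclideanSpace.proj i ∘L (u.1.2 (c.param z) ∘L fderiv ℝ c.param z)

lemma memLp_comp_param (hΩ : IsOpen Ω) {F : Type*} [NormedAddCommGroup F]
    (g : Lp F P (surface Ω)) : MemLp (fun z => g (c.param z)) P (volume.restrict c.dom) ∧
      eLpNorm (fun z => g (c.param z)) P (volume.restrict c.dom) ≤ ‖g‖ₑ := by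
  have hm : AEMeasurable c.param (volume.restrict c.dom) :=
    c.continuous_param.measurable.aemeasurable
  have h1 : MemLp g P ((volume.restrict c.dom).map c.param) :=
    (Lp.memLp g).mono_measure (c.map_param_le hΩ)
  refine ⟨h1.comp_of_map hm, ?_⟩
  have h2 : eLpNorm (fun z => g (c.param z)) P (volume.restrict c.dom) =
      eLpNorm g P ((volume.restrict c.dom).map c.param) :=
    (eLpNorm_map_measure h1.aestronglyMeasurable hm).symm
  rw [h2, Lp.enorm_def]
  exact eLpNorm_mono_measure _ (c.map_param_le hΩ)

lemma memLp_pullback (u : sobolev Ω hΩ P) (i : Fin d) :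
    MemLp (c.pullback u i) P (volume.restrict c.dom) ∧
      eLpNorm (c.pullback u i) P (volume.restrict c.dom) ≤ ‖u‖ₑ := by
  obtain ⟨h1, h2⟩ := c.memLp_comp_param hΩ u.1.1
  have hle : ∀ z, ‖c.pullback u i z‖ ≤ ‖u.1.1 (c.param z)‖ := fun z => PiLp.norm_apply_le _ _
  have hm : AEStronglyMeasurable (c.pullback u i) (volume.restrict c.dom) :=
    (EuclideanSpace.proj (𝕜 := ℝ) i).continuous.comp_aestronglyMeasurable h1.aestronglyMeasurable
  refine ⟨h1.mono hm (ae_of_all _ hle), (eLpNorm_mono hle).trans (h2.trans ?_)⟩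
  rw [← ofReal_norm, ← ofReal_norm]
  exact ENNReal.ofReal_le_ofReal (le_max_left _ _)

lemma exists_memLp_pullbackGradient : ∃ K : ℝ≥0, ∀ (u : sobolev Ω hΩ P) (i : Fin d),
    MemLp (c.pullbackGradient u i) P (volume.restrict c.dom) ∧
      eLpNorm (c.pullbackGradient u i) P (volume.restrict c.dom) ≤ K * ‖u‖ₑ := by
  obtain ⟨K, hK⟩ := c.lipschitz_param
  refine ⟨K, fun u i => ?_⟩
  obtain ⟨h1, h2⟩ := c.memLp_comp_param hΩ u.1.2
  have hle : ∀ z, ‖c.pullbackGradient u i z‖ ≤ K * ‖u.1.2 (c.param z)‖ := by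
    intro z
    have hi : ‖(EuclideanSpace.proj i : E d →L[ℝ] ℝ)‖ ≤ 1 :=
      ContinuousLinearMap.opNorm_le_bound _ zero_le_one fun y => by
        rw [one_mul]
        exact PiLp.norm_apply_le y i
    refine (ContinuousLinearMap.opNorm_comp_le _ _).trans ?_
    have h3 : ‖u.1.2 (c.param z) ∘L fderiv ℝ c.param z‖ ≤ ‖u.1.2 (c.param z)‖ * K :=
      (ContinuousLinearMap.opNorm_comp_le _ _).trans
        (mul_le_mul_of_nonneg_left (norm_fderiv_le_of_lipschitz ℝ hK) (norm_nonneg _))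
    calc _ ≤ 1 * (‖u.1.2 (c.param z)‖ * K) :=
          mul_le_mul hi h3 (norm_nonneg _) zero_le_one
      _ = _ := by ring
  have hf : AEStronglyMeasurable (fderiv ℝ c.param) (volume.restrict c.dom) :=
    (measurable_fderiv ℝ c.param).aestronglyMeasurable
  have hm : AEStronglyMeasurable (c.pullbackGradient u i) (volume.restrict c.dom) := by
    have h3 : AEStronglyMeasurable (fun z => u.1.2 (c.param z) ∘L fderiv ℝ c.param z)
        (volume.restrict c.dom) :=
      (ContinuousLinearMap.compL ℝ (E (d - 1)) (E d) (E d)).aestronglyMeasurable_comp₂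
        h1.aestronglyMeasurable hf
    exact ((ContinuousLinearMap.compL ℝ (E (d - 1)) (E d) ℝ
      (EuclideanSpace.proj i)).continuous).comp_aestronglyMeasurable h3
  refine ⟨MemLp.of_le_mul h1 hm (ae_of_all _ hle), ?_⟩
  have h4 := eLpNorm_le_nnreal_smul_eLpNorm_of_ae_le_mul (μ := volume.restrict c.dom)
    (f := c.pullbackGradient u i) (g := fun z => u.1.2 (c.param z)) (c := K)
    (ae_of_all _ hle) P
  rw [ENNReal.smul_def, smul_eq_mul] at h4
  refine h4.trans (mul_le_mul_right (h2.trans ?_) _)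
  rw [← ofReal_norm, ← ofReal_norm]
  exact ENNReal.ofReal_le_ofReal (le_max_right _ _)

lemma hasWeakGradientOn_pullback (u : sobolev Ω hΩ P) (i : Fin d) :
    HasWeakGradientOn c.dom (c.pullback u i) (c.pullbackGradient u i) := by
  intro φ hφ hφc hφB v
  have h := congrArg (EuclideanSpace.proj i : E d →L[ℝ] ℝ)
    (u.2.2 c φ hφ hφc hφB v)
  rw [map_neg, ← ContinuousLinearMap.integral_comp_comm _ (c.integrable_left hΩ u.1.1 hφ hφc v),
    ← ContinuousLinearMap.integral_comp_comm _ (c.integrable_right hΩ u.1.2 hφ hφc v)] at h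
  simpa [pullback, pullbackGradient] using h

lemma integral_mul_pullback_bound {φ : E (d - 1) → ℝ} (hφ : Continuous φ)
    (hφc : HasCompactSupport φ) (i : Fin d) : ∃ K : ℝ, ∀ u : sobolev Ω hΩ P,
      ‖∫ z in c.dom, φ z * c.pullback u i z‖ ≤ K * ‖u‖ := by
  obtain ⟨C, hC⟩ := hφc.exists_bound_of_continuous hφ
  have hfin : IsFiniteMeasure (volume.restrict c.dom) :=
    ⟨by rw [Measure.restrict_apply_univ]; exact measure_ball_lt_top⟩
  set μ := volume.restrict c.dom with hμ
  have hP : (1 : ℝ≥0∞) ≤ P := Fact.out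
  set A : ℝ≥0∞ := μ univ ^ (1 / (1 : ℝ≥0∞).toReal - 1 / P.toReal) with hA
  have hAt : A ≠ ⊤ := by
    refine ENNReal.rpow_ne_top_of_nonneg ?_ (measure_ne_top _ _)
    rw [ENNReal.toReal_one, div_one, sub_nonneg]
    rcases eq_or_ne P ⊤ with rfl | hPt
    · simp
    · refine div_le_one_of_le₀ ?_ ENNReal.toReal_nonneg
      rw [← ENNReal.toReal_one]
      exact ENNReal.toReal_mono hPt hP
  refine ⟨C.toNNReal * A.toReal, fun u => ?_⟩
  obtain ⟨h1, h2⟩ := c.memLp_pullback u i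
  have h3 : ‖∫ z in c.dom, φ z * c.pullback u i z‖ₑ ≤ C.toNNReal * (‖u‖ₑ * A) := by
    refine (enorm_integral_le_lintegral_enorm _).trans ?_
    rw [← eLpNorm_one_eq_lintegral_enorm]
    have h4 := eLpNorm_le_nnreal_smul_eLpNorm_of_ae_le_mul (μ := μ)
      (f := fun z => φ z * c.pullback u i z) (g := c.pullback u i) (c := C.toNNReal)
      (ae_of_all _ fun z => by
        rw [← NNReal.coe_le_coe]
        push_cast
        rw [norm_mul]
        exact mul_le_mul_of_nonneg_right ((hC z).trans (Real.le_coe_toNNReal C))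
          (norm_nonneg _)) 1
    rw [ENNReal.smul_def, smul_eq_mul] at h4
    refine h4.trans (mul_le_mul_right ?_ _)
    exact (eLpNorm_le_eLpNorm_mul_rpow_measure_univ hP h1.aestronglyMeasurable).trans
      (mul_le_mul_left h2 _)
  have h5 := ENNReal.toReal_mono (ENNReal.mul_ne_top ENNReal.coe_ne_top
    (ENNReal.mul_ne_top enorm_ne_top hAt)) h3
  rw [toReal_enorm, ENNReal.toReal_mul, ENNReal.toReal_mul, toReal_enorm,
    ENNReal.coe_toReal] at h5
  linarith

/-- In a chart, the components of a weakly convergent sequence converge in the sense of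
distributions. -/
lemma tendsto_integral_mul_pullback {u : ℕ → sobolev Ω hΩ P} {v : sobolev Ω hΩ P}
    (huv : WeaklyConverges u v) {φ : E (d - 1) → ℝ} (hφ : Continuous φ)
    (hφc : HasCompactSupport φ) (i : Fin d) :
    Tendsto (fun j => ∫ z in c.dom, φ z * c.pullback (u j) i z) atTop
      (𝓝 (∫ z in c.dom, φ z * c.pullback v i z)) := by
  obtain ⟨K, hK⟩ := c.integral_mul_pullback_bound (hΩ := hΩ) (P := P) hφ hφc i
  have hint : ∀ u : sobolev Ω hΩ P,
      Integrable (fun z => φ z * c.pullback u i z) (volume.restrict c.dom) := by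
    intro u
    have hfin : IsFiniteMeasure (volume.restrict c.dom) :=
      ⟨by rw [Measure.restrict_apply_univ]; exact measure_ball_lt_top⟩
    obtain ⟨C, hC⟩ := hφc.exists_bound_of_continuous hφ
    exact ((c.memLp_pullback u i).1.integrable Fact.out).bdd_mul hφ.aestronglyMeasurable
      (ae_of_all _ hC)
  let ℓ : sobolev Ω hΩ P →ₗ[ℝ] ℝ :=
    { toFun := fun u => ∫ z in c.dom, φ z * c.pullback u i z
      map_add' := fun a b => by
        rw [← integral_add (hint a) (hint b)]
        refine integral_congr_ae ?_
        filter_upwards [c.ae_comp hΩ (Lp.coeFn_add a.1.1 b.1.1)] with z hz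
        have e : c.pullback (a + b) i z = c.pullback a i z + c.pullback b i z :=
          congrArg (fun y : E d => y i) hz
        rw [e, mul_add]
      map_smul' := fun k a => by
        rw [RingHom.id_apply, smul_eq_mul, ← integral_const_mul]
        refine integral_congr_ae ?_
        filter_upwards [c.ae_comp hΩ (Lp.coeFn_smul k a.1.1)] with z hz
        have e : c.pullback (k • a) i z = k * c.pullback a i z :=
          congrArg (fun y : E d => y i) hz
        rw [e]
        ring }
  exact huv (ℓ.mkContinuous K hK)

end GraphChart

/-- A sequence in a normed space on which every functional is bounded is bounded. -/
lemma exists_norm_le_of_weakly_bounded {X : Type*} [NormedAddCommGroup X] [NormedSpace ℝ X]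
    {u : ℕ → X} (h : ∀ ℓ : X →L[ℝ] ℝ, ∃ C, ∀ j, ‖ℓ (u j)‖ ≤ C) : ∃ C : ℝ, ∀ j, ‖u j‖ ≤ C := by
  obtain ⟨C, hC⟩ := banach_steinhaus
    (g := fun j => NormedSpace.inclusionInDoubleDual ℝ X (u j)) h
  refine ⟨C, fun j => ?_⟩
  rw [← (NormedSpace.inclusionInDoubleDualLi ℝ (E := X)).norm_map (u j)]
  exact hC j

lemma WeaklyConverges.exists_norm_le {u : ℕ → sobolev Ω hΩ P} {v : sobolev Ω hΩ P}
    (huv : WeaklyConverges u v) : ∃ C : ℝ, ∀ j, ‖u j‖ ≤ C :=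
  exists_norm_le_of_weakly_bounded fun ℓ => by
    obtain ⟨C, hC⟩ := (huv ℓ).norm.bddAbove_range
    exact ⟨C, fun j => hC ⟨j, rfl⟩⟩

end Charts

/-! ### The energy density along a weakly convergent sequence -/

section EnergyDensity

variable {d : ℕ} {Ω : Set (E d)} {hΩ : IsOpen Ω}

/-- The integrand of the boundary energy. -/
noncomputable def energyDensity {P : ℝ≥0∞} [Fact (1 ≤ P)] (U : Density Ω) (u : sobolev Ω hΩ P)
    (x : E d) : ℝ :=
  U x (u.1.1 x) (tangentialDerivative u x) (outwardNormal Ω x)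

/-- The integrand is measurable. Measurability for the completed σ-algebra suffices, since a function
that is measurable for the completion agrees almost everywhere with a measurable one. -/
lemma aemeasurable_energyDensity {P : ℝ≥0∞} [Fact (1 ≤ P)] {U : Density Ω}
    (hU : IsMeasurableDensity U)
    (hreg : ∀ᵐ x ∂surface Ω, x ∈ regularBoundary Ω ∧ outwardNormal Ω x ∈ unitNormals Ω x)
    (hn : AEMeasurable (outwardNormal Ω) (surface Ω)) (u : sobolev Ω hΩ P) :
    AEMeasurable (energyDensity U u) (surface Ω) := by
  classical
  have hu : AEMeasurable u.1.1 (surface Ω) := (Lp.aestronglyMeasurable u.1.1).aemeasurable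
  have hD : AEMeasurable u.1.2 (surface Ω) := (Lp.aestronglyMeasurable u.1.2).aemeasurable
  have hgood : ∀ᵐ x ∂surface Ω, (x ∈ regularBoundary Ω ∧ hn.mk _ x ∈ unitNormals Ω x) ∧
      energyDensity U u x = U x (hu.mk _ x) ((hD.mk _ x).comp (tangentSpace Ω x).subtypeL)
        (hn.mk _ x) := by
    filter_upwards [hreg, hu.ae_eq_mk, hD.ae_eq_mk, hn.ae_eq_mk] with x h1 h2 h3 h4
    rw [← h2, ← h3, ← h4]
    exact ⟨h1, rfl⟩
  obtain ⟨T, hTsub, hTm, hT0⟩ := exists_measurable_superset_of_null (ae_iff.1 hgood)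
  let S : Set (NullMeasurableSpace (E d) (surface Ω)) := (Tᶜ : Set (E d))
  have hSm : MeasurableSet S := hTm.compl.nullMeasurableSet
  have hS : ∀ x ∈ S, (x ∈ regularBoundary Ω ∧ hn.mk _ x ∈ unitNormals Ω x) ∧
      energyDensity U u x = U x (hu.mk _ x) ((hD.mk _ x).comp (tangentSpace Ω x).subtypeL)
        (hn.mk _ x) := by
    intro x hx
    by_contra h
    exact hx (hTsub h)
  let f : NullMeasurableSpace (E d) (surface Ω) → ℝ := S.indicator (energyDensity U u)
  have hle : ∀ {β : Type} [MeasurableSpace β] {g : E d → β}, Measurable g →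
      Measurable (fun x : NullMeasurableSpace (E d) (surface Ω) => g x) := fun hg =>
    hg.nullMeasurable (μ := surface Ω)
  have hf : Measurable f := by
    refine measurable_of_restrict_of_restrict_compl hSm ?_ ?_
    · have hF := hU.comp (f := fun x : S => ⟨((x : NullMeasurableSpace (E d) (surface Ω)),
        hu.mk _ x.1, hD.mk _ x.1, hn.mk _ x.1), (hS x x.2).1⟩)
        (Measurable.subtype_mk (measurable_subtype_coe.prodMk
          (((hle hu.measurable_mk).comp measurable_subtype_coe).prodMk
            (((hle hD.measurable_mk).comp measurable_subtype_coe).prodMk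
              ((hle hn.measurable_mk).comp measurable_subtype_coe)))))
      refine Eq.mp (congrArg Measurable (funext fun x => ?_)) hF
      have e : f x.1 = energyDensity U u x.1 := indicator_of_mem x.2 _
      exact ((hS x x.2).2.symm.trans e.symm)
    · have e : Sᶜ.domRestrict f = fun _ => 0 := by
        funext x
        exact indicator_of_notMem x.2 _
      rw [e]
      exact measurable_const
  have hf' : NullMeasurable ((Tᶜ : Set (E d)).indicator (energyDensity U u)) (surface Ω) := hf
  refine hf'.aemeasurable.congr ?_
  have hT : ∀ᵐ x ∂surface Ω, x ∉ T := measure_eq_zero_iff_ae_notMem.1 hT0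
  filter_upwards [hT] with x hx
  exact indicator_of_mem (s := (Tᶜ : Set (E d))) hx _

/-- The lower semicontinuity along convergent convex combinations of minors, for a boundary energy
density at a fixed boundary point. -/
lemma eventually_le_convex_combination_density {p : ℝ} {m : ℕ} (hp : (m : ℝ) < p)
    {U : Density Ω} {x n : E d} (hn : n ∈ unitNormals Ω x)
    (hlsc : LowerSemicontinuousOn
      (fun q : E d × (tangentSpace Ω x →L[ℝ] E d) × E d => U x q.1 q.2.1 q.2.2)
      {q | q.2.2 ∈ unitNormals Ω x})
    {y₀ : E d} {b : Fin m → tangentSpace Ω x} (hpoly : IsPolyconvex b fun F => U x y₀ F n)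
    {a c : ℝ} (hc : 0 < c) (hbound : ∀ y F, a + c * ‖F‖ ^ p ≤ U x y F n)
    {y : ℕ → E d} (hy : Tendsto y atTop (𝓝 y₀)) {G : ℕ → tangentSpace Ω x →L[ℝ] E d}
    {F : tangentSpace Ω x →L[ℝ] E d} {s : ℕ → Finset ℕ} {w : ℕ → ℕ → ℝ}
    (hs : ∀ n, ∀ j ∈ s n, n ≤ j) (hw : ∀ n j, 0 ≤ w n j) (hw1 : ∀ n, ∑ j ∈ s n, w n j = 1)
    (hlim : Tendsto (fun n => ∑ j ∈ s n, w n j • minors (coordMatrix b (G j))) atTop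
      (𝓝 (minors (coordMatrix b F)))) {ε : ℝ} (hε : 0 < ε) :
    ∀ᶠ k in atTop, U x y₀ F n - ε ≤ ∑ j ∈ s k, w k j * U x (y j) (G j) n := by
  obtain ⟨Φ, hΦ, hΦU⟩ := hpoly
  have hproper := FiniteDimensional.proper ℝ (tangentSpace Ω x →L[ℝ] E d)
  obtain ⟨D, hD, hMD⟩ := exists_norm_minors_le b
  have hlsc' : LowerSemicontinuous fun q : E d × (tangentSpace Ω x →L[ℝ] E d) =>
      U x q.1 q.2 n := by
    intro q t ht
    have h1 := hlsc (q.1, q.2, n) hn t ht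
    have h2 : Tendsto (fun q : E d × (tangentSpace Ω x →L[ℝ] E d) => (q.1, q.2, n)) (𝓝 q)
        (𝓝[{q | q.2.2 ∈ unitNormals Ω x}] (q.1, q.2, n)) := by
      refine tendsto_nhdsWithin_iff.2 ⟨?_, Eventually.of_forall fun _ => hn⟩
      exact (continuous_fst.prodMk (continuous_snd.prodMk continuous_const)).tendsto q
    exact h2.eventually h1
  have h := @eventually_le_convex_combination (E d) (tangentSpace Ω x →L[ℝ] E d) (MinorIndex d m)
    _ _ _ _ m p hp (fun F => minors (coordMatrix b F)) (continuous_minors b) D hD hMD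
    (fun y F => U x y F n) hlsc' a c hc hbound
  exact @h Φ hΦ y₀ hΦU y hy G F s w hs hw hw1 hlim ε hε

/-- In a chart, tail convex combinations of the energy densities of a subsequence are asymptotically
at least the energy density of the limit. -/
lemma exists_subseq_convex_combination_energyDensity {p : ℝ} [Fact (1 ≤ ENNReal.ofReal p)]
    (hd : 2 ≤ d) (hp : ((d - 1 : ℕ) : ℝ) < p) {U : Density Ω} (hUlsc : IsLscDensity U)
    (hUpoly : TangentiallyPolyconvex U) {c : ℝ} (hc : 0 < c) {a : E d → ℝ}
    (hUbound : ∀ᵐ x ∂surface Ω, ∀ (y : E d) (F : tangentSpace Ω x →L[ℝ] E d),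
      ∀ n ∈ unitNormals Ω x, a x + c * ‖F‖ ^ p ≤ U x y F n)
    {u : ℕ → sobolev Ω hΩ (ENNReal.ofReal p)} {v : sobolev Ω hΩ (ENNReal.ofReal p)}
    (huv : WeaklyConverges u v) (C : GraphChart Ω) :
    ∃ (θ : ℕ → ℕ) (s : ℕ → Finset ℕ) (w : ℕ → ℕ → ℝ), (∀ n j, 0 ≤ w n j) ∧
      (∀ n, ∑ j ∈ s n, w n j = 1) ∧
      ∀ᵐ x ∂(surface Ω).restrict (C.tube (C.r / 2)), ∀ ε > 0, ∀ᶠ n in atTop,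
        energyDensity U v x - ε ≤ ∑ j ∈ s n, w n j * energyDensity U (u (θ j)) x := by
  obtain ⟨B, hB⟩ := huv.exists_norm_le
  obtain ⟨K, hK⟩ := C.exists_memLp_pullbackGradient (hΩ := hΩ) (P := ENNReal.ofReal p)
  have hB' : ∀ j, ‖u j‖ₑ ≤ ENNReal.ofReal B := fun j => by
    rw [← ofReal_norm]
    exact ENNReal.ofReal_le_ofReal (hB j)
  obtain ⟨θ, s, w, hθ, hs, hw0, hw1, hae⟩ := exists_subseq_convex_combination_minors
    (m := d - 1) (d := d) (by omega) hp C.r_pos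
    (w := fun j => C.pullback (u j)) (g := fun j => C.pullbackGradient (u j))
    (w' := C.pullback v) (g' := C.pullbackGradient v)
    (fun j i => (C.memLp_pullback (u j) i).1) (fun j i => (hK (u j) i).1)
    (fun i => (C.memLp_pullback v i).1) (fun i => (hK v i).1)
    (fun j i => C.hasWeakGradientOn_pullback (u j) i)
    (fun i => C.hasWeakGradientOn_pullback v i)
    (C := (1 + K) * ENNReal.ofReal B)
    (ENNReal.mul_ne_top (ENNReal.add_ne_top.2 ⟨ENNReal.one_ne_top, ENNReal.coe_ne_top⟩)
      ENNReal.ofReal_ne_top)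
    (fun j i => (C.memLp_pullback (u j) i).2.trans ((hB' j).trans (by
      rw [add_mul, one_mul]
      exact le_self_add)))
    (fun j i => (hK (u j) i).2.trans ((mul_le_mul_right (hB' j) _).trans
      (mul_le_mul_left le_add_self _)))
    (fun i φ hφ hφc _ => C.tendsto_integral_mul_pullback huv hφ.continuous hφc i)
  refine ⟨θ, s, w, hw0, hw1, C.ae_tube (by omega) hΩ (by linarith [C.r_pos]) ?_⟩
  obtain ⟨b, -, hb⟩ := hUpoly
  have hsub : Metric.ball C.z₀ (C.r / 2) ⊆ C.dom :=
    Metric.ball_subset_ball (by linarith [C.r_pos])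
  filter_upwards [hae, ae_restrict_of_ae C.ae_differentiableAt,
    ae_restrict_mem Metric.isOpen_ball.measurableSet,
    ae_restrict_of_ae_restrict_of_subset hsub (C.ae_comp hΩ hb),
    ae_restrict_of_ae_restrict_of_subset hsub (C.ae_comp hΩ hUlsc),
    ae_restrict_of_ae_restrict_of_subset hsub (C.ae_comp hΩ hUbound)]
    with z hz hfz hzB hpoly hlsc hbound ε hε
  have hz' : z ∈ C.dom := hsub hzB
  have hn : outwardNormal Ω (C.param z) ∈ unitNormals Ω (C.param z) := by
    rw [C.outwardNormal_param (by omega) hΩ hz' hfz]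
    exact C.unitNormal_mem (by omega) hΩ hz' hfz
  have hy : Tendsto (fun j => (u (θ j)).1.1 (C.param z)) atTop (𝓝 (v.1.1 (C.param z))) :=
    ((EuclideanSpace.equiv (Fin d) ℝ).symm.continuous.tendsto _).comp
      (tendsto_pi_nhds.2 fun i => hz.1 i)
  have hlim := tendsto_minors_of_tendsto_minorOf (L := fderiv ℝ C.param z) (b (C.param z))
    (fun j => (C.tangentSpace_param (by omega) hΩ hz' hfz).le (b (C.param z) j).2)
    (A := fun j => (u (θ j)).1.2 (C.param z)) (A' := v.1.2 (C.param z)) hz.2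
  exact eventually_le_convex_combination_density hp hn hlsc (hpoly _ _ hn) hc
    (fun y F => hbound y F _ hn) hy hs hw0 hw1 hlim hε

end EnergyDensity

/-! ### Integrating -/

section Integration

variable {α : Type*} [MeasurableSpace α] {μ : Measure α}

/-- Fatou's lemma for convex combinations: if every subsequence has convex combinations along a
further subsequence that are asymptotically at least `h`, then `∫ h ≤ liminf ∫ h_j`. -/
lemma lintegral_le_liminf_of_convex_combination {h : α → ℝ} {g : ℕ → α → ℝ}
    (hg : ∀ j, AEMeasurable (g j) μ)
    (H : ∀ κ : ℕ → ℕ, StrictMono κ → ∃ (θ : ℕ → ℕ) (s : ℕ → Finset ℕ) (w : ℕ → ℕ → ℝ),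
      (∀ n j, 0 ≤ w n j) ∧ (∀ n, ∑ j ∈ s n, w n j = 1) ∧
      ∀ᵐ x ∂μ, ∀ ε > 0, ∀ᶠ n in atTop, h x - ε ≤ ∑ j ∈ s n, w n j * g (κ (θ j)) x) :
    ∫⁻ x, ENNReal.ofReal (h x) ∂μ ≤ liminf (fun j => ∫⁻ x, ENNReal.ofReal (g j x) ∂μ) atTop := by
  by_contra hlt
  -- otherwise the integrals along some subsequence stay below a number `t < ∫ h`
  obtain ⟨t, ht1, ht2⟩ := exists_between (not_le.1 hlt)
  obtain ⟨κ, hκ, hκt⟩ := extraction_of_frequently_atTop (frequently_lt_of_liminf_lt (by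
    isBoundedDefault) ht1)
  obtain ⟨θ, s, w, hw0, hw1, hae⟩ := H κ hκ
  refine absurd ht2 (not_lt.2 ?_)
  have hm : ∀ j, AEMeasurable (fun x => ENNReal.ofReal (g j x)) μ := fun j => (hg j).ennreal_ofReal
  have hsum : ∀ n, ∫⁻ x, ∑ j ∈ s n, ENNReal.ofReal (w n j) * ENNReal.ofReal (g (κ (θ j)) x) ∂μ
      ≤ t := by
    intro n
    rw [lintegral_finsetSum' _ fun j _ => (hm _).const_mul _]
    calc ∑ j ∈ s n, ∫⁻ x, ENNReal.ofReal (w n j) * ENNReal.ofReal (g (κ (θ j)) x) ∂μ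
        ≤ ∑ j ∈ s n, ENNReal.ofReal (w n j) * t := by
          refine Finset.sum_le_sum fun j _ => ?_
          rw [lintegral_const_mul'' _ (hm _)]
          exact mul_le_mul_right (hκt (θ j)).le _
      _ = t := by
          rw [← Finset.sum_mul, ← ENNReal.ofReal_sum_of_nonneg fun j _ => hw0 n j, hw1,
            ENNReal.ofReal_one, one_mul]
  calc ∫⁻ x, ENNReal.ofReal (h x) ∂μ
      ≤ ∫⁻ x, liminf (fun n => ∑ j ∈ s n, ENNReal.ofReal (w n j) *
          ENNReal.ofReal (g (κ (θ j)) x)) atTop ∂μ := by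
        refine lintegral_mono_ae ?_
        filter_upwards [hae] with x hx
        refine ENNReal.le_of_forall_pos_le_add fun ε hε _ => ?_
        have h1 : ENNReal.ofReal (h x - ε) ≤ liminf (fun n => ∑ j ∈ s n, ENNReal.ofReal (w n j) *
            ENNReal.ofReal (g (κ (θ j)) x)) atTop := by
          refine le_liminf_of_le (by isBoundedDefault) ?_
          filter_upwards [hx ε hε] with n hn
          refine (ENNReal.ofReal_le_ofReal hn).trans ((Finset.le_sum_of_subadditive
            ENNReal.ofReal ENNReal.ofReal_zero.le (fun _ _ => ENNReal.ofReal_add_le) _ _).trans ?_)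
          exact Finset.sum_le_sum fun j _ => (ENNReal.ofReal_mul (hw0 n j)).le
        calc ENNReal.ofReal (h x) = ENNReal.ofReal ((h x - ε) + ε) := by rw [sub_add_cancel]
          _ ≤ ENNReal.ofReal (h x - ε) + ENNReal.ofReal ε := ENNReal.ofReal_add_le
          _ ≤ _ := by
            rw [ENNReal.ofReal_coe_nnreal]
            exact add_le_add_left h1 _
    _ ≤ liminf (fun n => ∫⁻ x, ∑ j ∈ s n, ENNReal.ofReal (w n j) *
          ENNReal.ofReal (g (κ (θ j)) x) ∂μ) atTop :=
        lintegral_liminf_le' fun n => Finset.aemeasurable_fun_sum _ fun j _ => (hm _).const_mul _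
    _ ≤ t := liminf_le_of_frequently_le' (Eventually.of_forall hsum).frequently

/-- Lower semicontinuity of an integral is local: the cover is made disjoint, and Fatou's lemma for
the counting measure shows that a finite sum of lower limits is at most the lower limit of the sum. -/
lemma lintegral_le_liminf_of_cover {N : ℕ} {O : Fin N → Set α} (hO : ∀ i, MeasurableSet (O i))
    (hcov : μ.restrict (⋃ i, O i) = μ) {h : α → ℝ≥0∞} {g : ℕ → α → ℝ≥0∞}
    (H : ∀ i, ∀ T ⊆ O i, MeasurableSet T →
      ∫⁻ x in T, h x ∂μ ≤ liminf (fun j => ∫⁻ x in T, g j x ∂μ) atTop) :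
    ∫⁻ x, h x ∂μ ≤ liminf (fun j => ∫⁻ x, g j x ∂μ) atTop := by
  have hOm : ∀ i, MeasurableSet (disjointed O i) := fun i =>
    disjointedRec (p := MeasurableSet) (fun _ j h => h.diff (hO j)) (hO i)
  have e : ∀ f : α → ℝ≥0∞, ∫⁻ x, f x ∂μ = ∫⁻ i, ∫⁻ x in disjointed O i, f x ∂μ ∂Measure.count := by
    intro f
    rw [lintegral_count, ← lintegral_iUnion hOm
      (disjoint_disjointed O), iUnion_disjointed, hcov]
  simp only [e]
  refine (lintegral_mono fun i => H i _ (disjointed_subset O i) (hOm i)).trans ?_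
  exact lintegral_liminf_le fun j => measurable_of_finite _

/-- For a function with an integrable minorant, the extended integral is a Lebesgue integral up to a
constant. -/
lemma extendedIntegral_eq {g a : α → ℝ} (hg : AEMeasurable g μ) (ha : Integrable a μ)
    (hag : ∀ᵐ x ∂μ, a x ≤ g x) :
    extendedIntegral μ g = ((∫⁻ x, ENNReal.ofReal (g x - a x) ∂μ : ℝ≥0∞) : EReal) +
      ((∫ x, a x ∂μ : ℝ) : EReal) := by
  have ham := ha.aemeasurable
  have hga : AEMeasurable (fun x => g x - a x) μ := hg.sub ham
  have hng : AEMeasurable (fun x => -g x) μ := hg.neg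
  -- the identity `g⁺ - g⁻ = (g - a) + a⁺ - a⁻`, without subtraction
  have h1 : (∫⁻ x, ENNReal.ofReal (g x) ∂μ) + ∫⁻ x, ENNReal.ofReal (-a x) ∂μ =
      ((∫⁻ x, ENNReal.ofReal (g x - a x) ∂μ) + ∫⁻ x, ENNReal.ofReal (a x) ∂μ) +
        ∫⁻ x, ENNReal.ofReal (-g x) ∂μ := by
    rw [← lintegral_add_left' hg.ennreal_ofReal,
      ← lintegral_add_left' hga.ennreal_ofReal,
      ← lintegral_add_right' _ hng.ennreal_ofReal]
    refine lintegral_congr_ae ?_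
    filter_upwards [hag] with x hx
    rw [← ENNReal.toReal_eq_toReal_iff' (by simp) (by simp)]
    rw [ENNReal.toReal_add (by simp) (by simp), ENNReal.toReal_add (by simp) (by simp),
      ENNReal.toReal_add (by simp) (by simp)]
    simp only [ENNReal.toReal_ofReal']
    rw [max_eq_left (sub_nonneg.2 hx)]
    have e : ∀ t : ℝ, max t 0 - max (-t) 0 = t := fun t => max_zero_sub_max_neg_zero_eq_self t
    linarith [e (g x), e (a x)]
  have ha1 : ∫⁻ x, ENNReal.ofReal (a x) ∂μ ≠ ⊤ := ha.lintegral_lt_top.ne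
  have ha2 : ∫⁻ x, ENNReal.ofReal (-a x) ∂μ ≠ ⊤ := ha.neg.lintegral_lt_top.ne
  have hB : ∫⁻ x, ENNReal.ofReal (-g x) ∂μ ≠ ⊤ := by
    refine ne_top_of_le_ne_top ha2 (lintegral_mono_ae ?_)
    filter_upwards [hag] with x hx using ENNReal.ofReal_le_ofReal (neg_le_neg hx)
  rw [extendedIntegral, integral_eq_lintegral_pos_part_sub_lintegral_neg_part ha]
  generalize (∫⁻ x, ENNReal.ofReal (g x) ∂μ) = A at *
  generalize (∫⁻ x, ENNReal.ofReal (g x - a x) ∂μ) = H at *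
  generalize (∫⁻ x, ENNReal.ofReal (a x) ∂μ) = a₁ at *
  generalize (∫⁻ x, ENNReal.ofReal (-a x) ∂μ) = a₂ at *
  generalize (∫⁻ x, ENNReal.ofReal (-g x) ∂μ) = B at *
  lift a₁ to ℝ≥0 using ha1
  lift a₂ to ℝ≥0 using ha2
  lift B to ℝ≥0 using hB
  rcases eq_or_ne H ⊤ with rfl | hH
  · have hA : A = ⊤ := by
      by_contra hA
      have : A + a₂ ≠ ⊤ := ENNReal.add_ne_top.2 ⟨hA, ENNReal.coe_ne_top⟩
      rw [h1] at this
      simp at this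
    rw [hA, EReal.coe_ennreal_top, EReal.coe_nnreal_eq_coe_real, EReal.top_sub_coe,
      EReal.top_add_coe]
  · have hA : A ≠ ⊤ := by
      rintro rfl
      have : H + a₁ + B ≠ ⊤ := ENNReal.add_ne_top.2
        ⟨ENNReal.add_ne_top.2 ⟨hH, ENNReal.coe_ne_top⟩, ENNReal.coe_ne_top⟩
      rw [← h1] at this
      simp at this
    lift A to ℝ≥0 using hA
    lift H to ℝ≥0 using hH
    have h2 : (A : ℝ) + a₂ = H + a₁ + B := by exact_mod_cast h1
    simp only [EReal.coe_nnreal_eq_coe_real, ENNReal.coe_toReal]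
    rw [← EReal.coe_sub, ← EReal.coe_add, EReal.coe_eq_coe_iff]
    linarith

end Integration

end BoundarySobolev

open BoundarySobolev in
theorem lemma9p5 (d : ℕ) (hd : 2 ≤ d)
    (Ω : Set (BoundarySobolev.E d)) (hΩ : IsOpen Ω) (hΩb : Bornology.IsBounded Ω)
    (hΩL : BoundarySobolev.HasLipschitzBoundary Ω)
    (p : ℝ) [Fact (1 ≤ ENNReal.ofReal p)] (hp : (d : ℝ) - 1 < p)
    (U : BoundarySobolev.Density Ω)
    (hUmeas : BoundarySobolev.IsMeasurableDensity U)
    (hUlsc : BoundarySobolev.IsLscDensity U)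
    (hUpoly : BoundarySobolev.TangentiallyPolyconvex U)
    (c : ℝ) (hc : 0 < c) (a : BoundarySobolev.E d → ℝ)
    (ha : Integrable a (BoundarySobolev.surface Ω))
    (hUbound : ∀ᵐ x ∂BoundarySobolev.surface Ω,
      ∀ (y : BoundarySobolev.E d)
        (F : BoundarySobolev.tangentSpace Ω x →L[ℝ] BoundarySobolev.E d),
        ∀ n ∈ BoundarySobolev.unitNormals Ω x, a x + c * ‖F‖ ^ p ≤ U x y F n)
    (u : ℕ → BoundarySobolev.sobolev Ω hΩ (ENNReal.ofReal p))
    (v : BoundarySobolev.sobolev Ω hΩ (ENNReal.ofReal p))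
    (huv : BoundarySobolev.WeaklyConverges u v) :
    BoundarySobolev.boundaryEnergy U v ≤
      liminf (fun j => BoundarySobolev.boundaryEnergy U (u j)) atTop := by
  have hd1 : 1 ≤ d := by omega
  have hp' : ((d - 1 : ℕ) : ℝ) < p := by
    rw [Nat.cast_sub hd1, Nat.cast_one]
    exact hp
  have hreg := hΩL.ae_regular hΩb hd1 hΩ
  have hmeas : ∀ w : sobolev Ω hΩ (ENNReal.ofReal p),
      AEMeasurable (energyDensity U w) (surface Ω) :=
    aemeasurable_energyDensity hUmeas hreg (hΩL.aemeasurable_outwardNormal hΩb hd1 hΩ)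
  have hle : ∀ w : sobolev Ω hΩ (ENNReal.ofReal p),
      ∀ᵐ x ∂surface Ω, a x ≤ energyDensity U w x := by
    intro w
    filter_upwards [hreg, hUbound] with x hx hb
    refine le_trans ?_ (hb (w.1.1 x) (tangentialDerivative w x) _ hx.2)
    exact le_add_of_nonneg_right (by positivity)
  have henergy : ∀ w : sobolev Ω hΩ (ENNReal.ofReal p), boundaryEnergy U w =
      ((∫⁻ x, ENNReal.ofReal (energyDensity U w x - a x) ∂surface Ω : ℝ≥0∞) : EReal) +
        ((∫ x, a x ∂surface Ω : ℝ) : EReal) := fun w =>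
    extendedIntegral_eq (hmeas w) ha (hle w)
  obtain ⟨N, C, hC⟩ := hΩL.exists_finite_cover hΩb
  have hfatou : ∫⁻ x, ENNReal.ofReal (energyDensity U v x - a x) ∂surface Ω ≤
      liminf (fun j => ∫⁻ x, ENNReal.ofReal (energyDensity U (u j) x - a x) ∂surface Ω) atTop := by
    refine lintegral_le_liminf_of_cover (O := fun i => (C i).tube ((C i).r / 2))
      (fun i => ((C i).isOpen_tube _).measurableSet) (restrict_surface_of_cover hC)
      fun i T hT _ => ?_
    refine lintegral_le_liminf_of_convex_combination
      (fun j => ((hmeas (u j)).sub ha.aemeasurable).restrict) fun κ hκ => ?_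
    obtain ⟨θ, s, w, hw0, hw1, hae⟩ := exists_subseq_convex_combination_energyDensity hd hp' hUlsc
      hUpoly hc hUbound (u := fun j => u (κ j)) (v := v)
      (fun ℓ => (huv ℓ).comp hκ.tendsto_atTop) (C i)
    refine ⟨θ, s, w, hw0, hw1, ?_⟩
    filter_upwards [ae_restrict_of_ae_restrict_of_subset hT hae] with x hx ε hε
    filter_upwards [hx ε hε] with n hn
    simp only [mul_sub, Finset.sum_sub_distrib, ← Finset.sum_mul, hw1, one_mul]
    linarith
  simp only [henergy]
  calc _ ≤ ((liminf (fun j => ∫⁻ x, ENNReal.ofReal (energyDensity U (u j) x - a x) ∂surface Ω)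
        atTop : ℝ≥0∞) : EReal) + ((∫ x, a x ∂surface Ω : ℝ) : EReal) := by
        gcongr
        exact EReal.coe_ennreal_le_coe_ennreal_iff.2 hfatou
    _ = liminf (fun j => ((∫⁻ x, ENNReal.ofReal (energyDensity U (u j) x - a x)
          ∂surface Ω : ℝ≥0∞) : EReal)) atTop +
        liminf (fun _ : ℕ => ((∫ x, a x ∂surface Ω : ℝ) : EReal)) atTop := by
        rw [liminf_const]
        congr 1
        exact EReal.coe_ennreal_strictMono.monotone.map_liminf_of_continuousAt _
          continuous_coe_ennreal_ereal.continuousAt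
    _ ≤ _ := EReal.le_liminf_add
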